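/- **Setting.** Let $W\neq 0$ be a finite-dimensional complex $C^*$ weak Hopf algebra (a weak Hopf algebra with an antilinear antimultiplicative involution for which $\Delta$ is a $*$-homomorphism and which has a faithful $*$-representation on a Hilbert space), with counital maps $\varepsilon_L(x)=\sum\varepsilon(1^{(1)}x)1^{(2)}$, $\varepsilon_R(x)=\sum 1^{(1)}\varepsilon(x1^{(2)})$ and antipode $S$. Let $\hat W=\operatorname{Hom}(W,\mathbb C)$ be its dual, with $\langle\varphi\psi,x\rangle=\sum\varphi(x^{(1)})\psi(x^{(2)})$, unit $\varepsilon$, $\langle\hat\Delta(\varphi),x\otimes y\rangle=\varphi(xy)$, and counit $\varphi\mapsto\varphi(1)$. A Haar integral is an element $h$ with $xh=\varepsilon_L(x)h$ and $hx=h\varepsilon_R(x)$ for all $x$, and $\varepsilon_L(h)=\varepsilon_R(h)=1$. Let $h_W$ and $\varphi_{\hat W}$ be the Haar integrals of $W$ and $\hat W$, and assume that $h_W$ is cocommutative, $\Delta^{\rm op}(h_W)=\Delta(h_W)$. Let $C(\Sigma)$ be a finite cellulation, with directed edges, of a closed oriented surface $\Sigma$ (every component of $\Sigma$ carrying at least one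 edge), with vertices $V$, edges $E$, faces $F$; it may be given combinatorially, by the counterclockwise rotation of the half-edges around each vertex. A site is a corner of a face $f$ at a vertex $v$. Let $\mathcal H=\bigotimes_{e\in E}W$, and on a tensor factor put $$L_+^hx=hx,\quad L_-^hx=xS^{-1}(h),\quad T_+^\varphi x=\sum\varphi(x^{(2)})x^{(1)},\quad T_-^\varphi x=\sum\varphi(S(x^{(1)}))x^{(2)} .$$ For a site $s$ at $v$ and $f$ let $A^h(s)=\sum_{(h)}\bigotimes_iL_{\pm}^{h^{(i)}}$ over the edges at $v$ in counterclockwise order starting from $s$, with $L_-$ at the starting vertex of an edge and $L_+$ at its ending vertex, and let $B^\varphi(s)=\sum_{(\varphi)}\bigotimes_iT_{\pm}^{\varphi^{(i)}}$ over the boundary edges of $f$ in counterclockwise order starting from $s$, with $T_-$ if $f$ is on the left of the edge and $T_+$ if it is on the right. Write $A_v=A^{h_W}(s)$ and $B_f=B^{\varphi_{\hat W}}(s)$ for a site $s$ at $v$, respectively in $f$. The Hamiltonian is $$H=\sum_{v\in V}(I-A_v)+\sum_{f\in F}(I-B_f).$$ For $x_e\in W$ and $\varphi_f\in\hat W$ (and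 a chosen starting site for each face), the weak Hopf trace is $$\operatorname{ttr}(\{x_e\},\{\varphi_f\})=\sum_{(x_e)}\ \prod_{f\in F}\ \sum_{(\varphi_f)}\langle\varphi_f^{(1)},y_1\rangle\langle\varphi_f^{(2)},y_2\rangle\cdots,$$ where $y_1,y_2,\dots$ are the contributions to $f$ of its boundary edges in clockwise order from the starting site: an edge $e$ contributes $x_e^{(2)}$ to the face on its left and $S(x_e^{(1)})$ to the face on its right. The weak Hopf tensor network state is $$|\Psi(\{x_e\},\{\varphi_f\})\rangle=\sum_{(x_e)}\operatorname{ttr}(\{x_e^{(2)}\},\{\varphi_f\})\ \bigotimes_{e\in E}|x_e^{(1)}\rangle .$$ **Theorem.** For all choices of sites in the above, let $|\Psi\rangle$ be the state with $x_e=h_W$ for every edge and $\varphi_f=\varphi_{\hat W}$ for every face. Then $A^{h_W}(s)|\Psi\rangle=|\Psi\rangle$ and $B^{\varphi_{\hat W}}(s)|\Psi\rangle=|\Psi\rangle$ for every site $s$; that is, $A_v|\Psi\rangle=|\Psi\rangle$ for every vertex $v$ and $B_f|\Psi\rangle=|\Psi\rangle$ for every face $f$. Moreover $|\Psi\rangle$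 is a ground state of $H$: it is nonzero, it is an eigenvector of $H$, all eigenvalues of $H$ are real, and its eigenvalue is the lowest one. -/

import Mathlib

open scoped TensorProduct
open Coalgebra

noncomputable section

namespace WeakHopf

/-! ### Weak Hopf algebras and Haar integrals -/

section Integrals

variable {W : Type*} [Ring W] [Algebra ℂ W] [Coalgebra ℂ W]

/-- The left counital map `ε_L(x) = (ε ⊗ id)(Δ(1)(x ⊗ 1)) = ∑ ε(1⁽¹⁾ x) 1⁽²⁾`. -/
def epsL (x : W) : W :=
  TensorProduct.lid ℂ W
    ((counit (R := ℂ) (A := W)).rTensor W (comul (R := ℂ) (1 : W) * (x ⊗ₜ[ℂ] (1 : W))))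

/-- The right counital map `ε_R(x) = (id ⊗ ε)((1 ⊗ x)Δ(1)) = ∑ 1⁽¹⁾ ε(x 1⁽²⁾)`. -/
def epsR (x : W) : W :=
  TensorProduct.rid ℂ W
    ((counit (R := ℂ) (A := W)).lTensor W (((1 : W) ⊗ₜ[ℂ] x) * comul (R := ℂ) (1 : W)))

/-- A Haar integral: a two-sided integral which is normalized on both sides. -/
structure IsHaarIntegral (h : W) : Prop where
  left_integral : ∀ x : W, x * h = epsL x * h
  right_integral : ∀ x : W, h * x = h * epsR x
  left_normalized : epsL h = 1
  right_normalized : epsR h = 1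

/-- `Δᵒᵖ(h) = Δ(h)`. -/
def IsCocommutativeElement (h : W) : Prop :=
  TensorProduct.comm ℂ W W (comul (R := ℂ) h) = comul (R := ℂ) h

end Integrals

/-- A complex weak Hopf algebra (on a given complex algebra). -/
class WeakHopfAlgebra (W : Type*) [Ring W] [Algebra ℂ W] extends Coalgebra ℂ W where
  /-- `Δ(xy) = Δ(x)Δ(y)`. -/
  comul_mul : ∀ x y : W, comul (x * y) = comul x * comul y
  /-- `(Δ ⊗ id)Δ(1) = (Δ(1) ⊗ 1)(1 ⊗ Δ(1))`. -/
  comul_comul_one :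
    comul.rTensor W (comul (1 : W)) =
      (comul (1 : W) ⊗ₜ[ℂ] (1 : W)) *
        (TensorProduct.assoc ℂ W W W).symm ((1 : W) ⊗ₜ[ℂ] comul (1 : W))
  /-- `(Δ ⊗ id)Δ(1) = (1 ⊗ Δ(1))(Δ(1) ⊗ 1)`. -/
  comul_comul_one' :
    comul.rTensor W (comul (1 : W)) =
      (TensorProduct.assoc ℂ W W W).symm ((1 : W) ⊗ₜ[ℂ] comul (1 : W)) *
        (comul (1 : W) ⊗ₜ[ℂ] (1 : W))
  /-- `ε(xyz) = ∑ ε(x y⁽¹⁾) ε(y⁽²⁾ z)`. -/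
  counit_mul_mul : ∀ x y z : W,
    counit (x * y * z) =
      LinearMap.mul' ℂ ℂ
        (TensorProduct.map (counit ∘ₗ LinearMap.mulLeft ℂ x) (counit ∘ₗ LinearMap.mulRight ℂ z)
          (comul y))
  /-- `ε(xyz) = ∑ ε(x y⁽²⁾) ε(y⁽¹⁾ z)`. -/
  counit_mul_mul' : ∀ x y z : W,
    counit (x * y * z) =
      LinearMap.mul' ℂ ℂ
        (TensorProduct.map (counit ∘ₗ LinearMap.mulLeft ℂ x) (counit ∘ₗ LinearMap.mulRight ℂ z)
          (TensorProduct.comm ℂ W W (comul y)))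
  /-- The antipode `S`. -/
  antipode : W →ₗ[ℂ] W
  /-- `∑ x⁽¹⁾ S(x⁽²⁾) = ε_L(x)`. -/
  mul_antipode : ∀ x : W, LinearMap.mul' ℂ W (antipode.lTensor W (comul x)) = epsL x
  /-- `∑ S(x⁽¹⁾) x⁽²⁾ = ε_R(x)`. -/
  antipode_mul : ∀ x : W, LinearMap.mul' ℂ W (antipode.rTensor W (comul x)) = epsR x
  /-- `S(x) = ∑ S(x⁽¹⁾) x⁽²⁾ S(x⁽³⁾)`. -/
  antipode_mul_antipode : ∀ x : W,
    antipode x =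
      LinearMap.mul' ℂ W
        (TensorProduct.map (LinearMap.mul' ℂ W ∘ₗ antipode.rTensor W ∘ₗ comul) antipode (comul x))

/-- A weak Hopf algebra with a conjugate-linear anti-multiplicative involution `*` is a
`C*` weak Hopf algebra if `Δ` is a `*`-homomorphism and there is a faithful `*`-representation on a
Hilbert space. -/
class IsCStarWeakHopfAlgebra (W : Type*) [Ring W] [StarRing W] [Algebra ℂ W] [StarModule ℂ W]
    [WeakHopfAlgebra W] : Prop where
  comul_star : ∀ x : W, comul (R := ℂ) (star x) = star (comul (R := ℂ) x)
  exists_faithful_rep :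
    ∃ (H : Type) (_ : NormedAddCommGroup H) (_ : InnerProductSpace ℂ H) (_ : CompleteSpace H)
      (ρ : W →⋆ₐ[ℂ] (H →L[ℂ] H)), Function.Injective ρ

/-! ### The dual -/

/-- The dual `Ŵ` of a coalgebra `W`. Its algebra structure is the convolution product
`⟨φψ, x⟩ = ∑ ⟨φ, x⁽¹⁾⟩⟨ψ, x⁽²⟩⟩` with unit `ε`. -/
abbrev DualAlg (W : Type*) [Ring W] [Algebra ℂ W] [Coalgebra ℂ W] : Type _ :=
  WithConv (W →ₗ[ℂ] ℂ)

section Dual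

variable (W : Type*) [Ring W] [Algebra ℂ W] [Coalgebra ℂ W]

/-- The identification of `Ŵ` with the dual vector space. -/
def toDual : DualAlg W ≃ₗ[ℂ] Module.Dual ℂ W := WithConv.linearEquiv ℂ (W →ₗ[ℂ] ℂ)

/-- The counit of `Ŵ`: `ε̂(φ) = ⟨φ, 1⟩`. -/
def dualCounit : DualAlg W →ₗ[ℂ] ℂ :=
  (LinearMap.applyₗ (R := ℂ) (M₂ := ℂ) (1 : W)) ∘ₗ (toDual W).toLinearMap

theorem dualCounit_apply (φ : DualAlg W) : dualCounit W φ = φ 1 := rfl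

variable [FiniteDimensional ℂ W]

/-- The isomorphism `Ŵ ⊗ Ŵ ≃ (W ⊗ W)^∨`. -/
def pair₂ : DualAlg W ⊗[ℂ] DualAlg W ≃ₗ[ℂ] Module.Dual ℂ (W ⊗[ℂ] W) :=
  (TensorProduct.congr (toDual W) (toDual W)).trans (TensorProduct.dualDistribEquiv ℂ W W)

/-- The isomorphism `Ŵ ⊗ (Ŵ ⊗ Ŵ) ≃ (W ⊗ (W ⊗ W))^∨`. -/
def pair₃ : DualAlg W ⊗[ℂ] (DualAlg W ⊗[ℂ] DualAlg W) ≃ₗ[ℂ]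
    Module.Dual ℂ (W ⊗[ℂ] (W ⊗[ℂ] W)) :=
  (TensorProduct.congr (toDual W) (pair₂ W)).trans (TensorProduct.dualDistribEquiv ℂ W (W ⊗[ℂ] W))

variable {W}

theorem pair₂_tmul (φ ψ : DualAlg W) (x y : W) :
    pair₂ W (φ ⊗ₜ ψ) (x ⊗ₜ y) = φ x * ψ y := rfl

theorem pair₃_tmul (φ : DualAlg W) (t : DualAlg W ⊗[ℂ] DualAlg W) (x : W) (u : W ⊗[ℂ] W) :
    pair₃ W (φ ⊗ₜ t) (x ⊗ₜ u) = φ x * pair₂ W t u := rfl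

variable (W)

/-- The comultiplication of `Ŵ`: `⟨Δ̂(φ), x ⊗ y⟩ = ⟨φ, xy⟩`. -/
def dualComul : DualAlg W →ₗ[ℂ] DualAlg W ⊗[ℂ] DualAlg W :=
  (pair₂ W).symm.toLinearMap ∘ₗ (LinearMap.mul' ℂ W).dualMap ∘ₗ (toDual W).toLinearMap

variable {W}

theorem pair₂_dualComul (φ : DualAlg W) (x y : W) :
    pair₂ W (dualComul W φ) (x ⊗ₜ y) = φ (x * y) := by
  simp [dualComul, toDual]

theorem pair₃_lTensor (t : DualAlg W ⊗[ℂ] DualAlg W) (x y z : W) :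
    pair₃ W ((dualComul W).lTensor _ t) (x ⊗ₜ (y ⊗ₜ z)) = pair₂ W t (x ⊗ₜ (y * z)) := by
  induction t with
  | zero => simp
  | tmul a b => simp [pair₃_tmul, pair₂_dualComul, pair₂_tmul]
  | add a b ha hb => simp [ha, hb]

theorem pair₃_assoc (s : DualAlg W ⊗[ℂ] DualAlg W) (b : DualAlg W) (x y z : W) :
    pair₃ W (TensorProduct.assoc ℂ _ _ _ (s ⊗ₜ b)) (x ⊗ₜ (y ⊗ₜ z)) =
      pair₂ W s (x ⊗ₜ y) * b z := by
  induction s with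
  | zero => simp
  | tmul a c => simp [pair₃_tmul, pair₂_tmul, mul_assoc]
  | add a c ha hc => simp [TensorProduct.add_tmul, ha, hc, add_mul]

theorem pair₃_assoc_rTensor (t : DualAlg W ⊗[ℂ] DualAlg W) (x y z : W) :
    pair₃ W (TensorProduct.assoc ℂ _ _ _ ((dualComul W).rTensor _ t)) (x ⊗ₜ (y ⊗ₜ z)) =
      pair₂ W t ((x * y) ⊗ₜ z) := by
  induction t with
  | zero => simp
  | tmul a b => simp [pair₃_assoc, pair₂_dualComul, pair₂_tmul]
  | add a b ha hb => simp [ha, hb]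

theorem lid_rTensor_dualCounit (t : DualAlg W ⊗[ℂ] DualAlg W) (x : W) :
    (TensorProduct.lid ℂ _ ((dualCounit W).rTensor _ t) : DualAlg W) x = pair₂ W t (1 ⊗ₜ x) := by
  induction t with
  | zero => simp
  | tmul a b => simp [pair₂_tmul, dualCounit_apply]
  | add a b ha hb => simp [ha, hb]

theorem rid_lTensor_dualCounit (t : DualAlg W ⊗[ℂ] DualAlg W) (x : W) :
    (TensorProduct.rid ℂ _ ((dualCounit W).lTensor _ t) : DualAlg W) x = pair₂ W t (x ⊗ₜ 1) := by
  induction t with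
  | zero => simp
  | tmul a b => simp [pair₂_tmul, dualCounit_apply, mul_comm]
  | add a b ha hb => simp [ha, hb]

/-- The coalgebra structure of `Ŵ`, dual to the algebra structure of `W`. -/
instance instCoalgebraDualAlg : Coalgebra ℂ (DualAlg W) where
  comul := dualComul W
  counit := dualCounit W
  coassoc := by
    refine LinearMap.ext fun φ => (pair₃ W).injective ?_
    refine TensorProduct.ext_threefold' fun x y z => ?_
    simp only [LinearMap.comp_apply, LinearEquiv.coe_coe]
    rw [pair₃_assoc_rTensor, pair₃_lTensor, pair₂_dualComul, pair₂_dualComul, mul_assoc]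
  rTensor_counit_comp_comul := by
    refine LinearMap.ext fun φ => (TensorProduct.lid ℂ (DualAlg W)).injective ?_
    refine WithConv.ext (LinearMap.ext fun x => ?_)
    simp only [LinearMap.comp_apply]
    rw [lid_rTensor_dualCounit, pair₂_dualComul]
    simp
  lTensor_counit_comp_comul := by
    refine LinearMap.ext fun φ => (TensorProduct.rid ℂ (DualAlg W)).injective ?_
    refine WithConv.ext (LinearMap.ext fun x => ?_)
    simp only [LinearMap.comp_apply]
    rw [rid_lTensor_dualCounit, pair₂_dualComul]
    simp

end Dual

/-! ### Iterated Sweedler sums -/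

/-- For linear maps `f₁, …, fₙ` from a coalgebra to an algebra, the map
`c ↦ ∑ f₁(c⁽¹⁾) f₂(c⁽²⁾) ⋯ fₙ(c⁽ⁿ⁾)` (and `c ↦ ε(c) 1` for `n = 0`). -/
def sweedler {C A : Type*} [AddCommGroup C] [Module ℂ C] [Coalgebra ℂ C] [Ring A] [Algebra ℂ A] :
    List (C →ₗ[ℂ] A) → (C →ₗ[ℂ] A)
  | [] => Algebra.linearMap ℂ A ∘ₗ counit
  | f :: l => LinearMap.mul' ℂ A ∘ₗ TensorProduct.map f (sweedler l) ∘ₗ comul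

/-! ### The four actions on an edge -/

section Actions

variable {W : Type*} [Ring W] [Algebra ℂ W] [WeakHopfAlgebra W]

/-- The inverse of the antipode, as the inverse in the ring of endomorphisms of `W` (the antipode of
a finite-dimensional weak Hopf algebra is bijective). -/
def antipodeInv : W →ₗ[ℂ] W :=
  Ring.inverse (M₀ := Module.End ℂ W) (WeakHopfAlgebra.antipode : W →ₗ[ℂ] W)

/-- `L₊ʰ |x⟩ = |h x⟩`. -/
def Lplus : W →ₗ[ℂ] Module.End ℂ W := LinearMap.mul ℂ W

/-- `L₋ʰ |x⟩ = |x S⁻¹(h)⟩`. -/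
def Lminus : W →ₗ[ℂ] Module.End ℂ W := (LinearMap.mul ℂ W).flip ∘ₗ antipodeInv

/-- The map sending a functional `φ` to the endomorphism `x ↦ ∑ ⟨φ, x⁽²⟩⟩ x⁽¹⁾`, that is
`T₊^φ |x⟩ = |φ ⇀ x⟩`. -/
def Tplus : DualAlg W →ₗ[ℂ] Module.End ℂ W where
  toFun φ := (TensorProduct.rid ℂ W).toLinearMap ∘ₗ (toDual W φ).lTensor W ∘ₗ comul
  map_add' φ ψ := by ext x; simp [LinearMap.lTensor_add]
  map_smul' c φ := by ext x; simp [LinearMap.lTensor_smul]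

/-- `T₋^φ |x⟩ = |x ↼ Ŝ(φ)⟩ = ∑ ⟨φ, S(x⁽¹⁾)⟩ |x⁽²⁾⟩`. -/
def Tminus : DualAlg W →ₗ[ℂ] Module.End ℂ W where
  toFun φ := (TensorProduct.lid ℂ W).toLinearMap ∘ₗ
    (toDual W φ ∘ₗ WeakHopfAlgebra.antipode).rTensor W ∘ₗ comul
  map_add' φ ψ := by ext x; simp [LinearMap.add_comp, LinearMap.rTensor_add]
  map_smul' c φ := by ext x; simp [LinearMap.smul_comp, LinearMap.rTensor_smul]

end Actions

/-! ### Directed lattices on closed oriented surfaces -/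

/-- A cellulation, with directed edges, of a closed oriented surface (each connected component
carrying at least one edge), presented as a rotation system. Each edge `e` has two half-edges:
`(e, true)`, at the starting vertex of `e`, and `(e, false)`, at its ending vertex. The permutation
`rot` sends a half-edge at a vertex `v` to the next half-edge at `v` in counterclockwise order. -/
structure DirectedLattice (E : Type*) where
  rot : Equiv.Perm (E × Bool)

namespace DirectedLattice

variable {E : Type*} (L : DirectedLattice E)

/-- The half-edge at the other end of the same edge. -/
def opp : Equiv.Perm (E × Bool) where
  toFun d := (d.1, !d.2)
  invFun d := (d.1, !d.2)
  left_inv d := by simp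
  right_inv d := by simp

/-- View a half-edge `d` as its edge, traversed away from the vertex of `d`, with a face on the left.
`L.faceRot d` is the next step in the counterclockwise traversal of the boundary of that face: at
the far end of `d`, turn to the half-edge clockwise-next to `opp d`. -/
def faceRot : Equiv.Perm (E × Bool) := opp.trans L.rot.symm

/-- Vertices are the cycles of `rot`. -/
def Vertex : Type _ := Quotient (Equiv.Perm.SameCycle.setoid L.rot)

/-- Faces are the cycles of `faceRot`. -/
def Face : Type _ := Quotient (Equiv.Perm.SameCycle.setoid L.faceRot)

/-- A site, that is, a corner of a face at a vertex. The half-edge `d` stands for the corner at the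
vertex of `d` in the face on the left of `d`; it lies between `d` and `L.rot d`. -/
abbrev Site (_ : DirectedLattice E) : Type _ := E × Bool

/-- The vertex of a site. -/
def Site.vertex {L : DirectedLattice E} (s : L.Site) : L.Vertex :=
  Quotient.mk (Equiv.Perm.SameCycle.setoid L.rot) s

/-- The face of a site. -/
def Site.face {L : DirectedLattice E} (s : L.Site) : L.Face :=
  Quotient.mk (Equiv.Perm.SameCycle.setoid L.faceRot) s

instance [Finite E] : Finite L.Vertex := Quotient.finite _

instance [Finite E] : Finite L.Face := Quotient.finite _

instance [Finite E] : Fintype L.Vertex := Fintype.ofFinite _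

instance [Finite E] : Fintype L.Face := Fintype.ofFinite _

/-- The cycle `[d, σ d, σ² d, …]` of `d` under `σ`, each element listed once. -/
def cycleList (σ : Equiv.Perm (E × Bool)) (d : E × Bool) : List (E × Bool) :=
  (List.range (Function.minimalPeriod σ d)).map fun k => (σ^[k]) d

/-- The half-edges at the vertex of the site `s`, counterclockwise starting from `s`. -/
def vertexOrder (s : L.Site) : List (E × Bool) := cycleList L.rot (L.rot s)

/-- The boundary of the face of the site `s`, counterclockwise starting from `s`. The edge `e` occurs
as `(e, true)` when the face is on its left and as `(e, false)` when the face is on its right. -/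
def faceOrder (s : L.Site) : List (E × Bool) := cycleList L.faceRot s

end DirectedLattice

/-! ### The quantum double model -/

section Model

variable (W : Type*) [Ring W] [Algebra ℂ W] {E : Type*} [DecidableEq E]

/-- The total space `⨂_{e ∈ E} W`. -/
abbrev TotalSpace (E : Type*) : Type _ := ⨂[ℂ] _ : E, W

variable {W}

/-- The operator acting by `T` on the tensor factor of the edge `e` and trivially on the others. -/
def onEdge (e : E) : Module.End ℂ W →ₗ[ℂ] Module.End ℂ (TotalSpace W E) :=
  (PiTensorProduct.mapMultilinear ℂ (fun _ : E => W) (fun _ : E => W)).toLinearMap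
    (fun _ => LinearMap.id) e

variable [WeakHopfAlgebra W] (L : DirectedLattice E)

/-- `Aʰ(s) = ∑ ⨂ L_±^{h⁽ⁱ⁾}`, over the edges at the vertex of `s` in counterclockwise order
starting from `s`: `L₋` at the starting vertex of an edge, `L₊` at its ending vertex. -/
def vertexOp (s : L.Site) (h : W) : Module.End ℂ (TotalSpace W E) :=
  sweedler ((L.vertexOrder s).map fun d => onEdge d.1 ∘ₗ if d.2 then Lminus else Lplus) h

variable [FiniteDimensional ℂ W]

/-- `B^φ(s) = ∑ ⨂ T_±^{φ⁽ⁱ⁾}`, over the edges of the face of `s` in counterclockwise order starting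
from `s`: `T₋` for the face on the left of an edge (where its dual edge ends), `T₊` for the face on
its right (where its dual edge starts). -/
def faceOp (s : L.Site) (φ : DualAlg W) : Module.End ℂ (TotalSpace W E) :=
  sweedler ((L.faceOrder s).map fun d => onEdge d.1 ∘ₗ if d.2 then Tminus else Tplus) φ

variable [Fintype E]

/-- The Hamiltonian `∑_v (I - A_v) + ∑_f (I - B_f)`, where `A_v = Aʰ(s)` and `B_f = B^φ(s)` are formed
at chosen sites `vs v` of `v` and `fs f` of `f`. -/
def hamiltonian (h : W) (φ : DualAlg W) (vs : L.Vertex → L.Site) (fs : L.Face → L.Site) :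
    Module.End ℂ (TotalSpace W E) :=
  ∑ v : L.Vertex, (1 - vertexOp L (vs v) h) + ∑ f : L.Face, (1 - faceOp L (fs f) φ)

/-! ### Weak Hopf tensor network states -/

/-- The evaluation of one face: `∑ ⟨φ⁽¹⁾, y_{d₁}⟩ ⟨φ⁽²⁾, y_{d₂}⟩ ⋯` over the boundary `d₁, d₂, …` of the
face of the site `s`, taken clockwise starting from `s`. -/
def faceEval (s : L.Site) (φ : DualAlg W) (y : E × Bool → W) : ℂ :=
  sweedler (((L.faceOrder s).reverse).map fun d =>
    LinearMap.applyₗ (R := ℂ) (M₂ := ℂ) (y d) ∘ₗ (toDual W).toLinearMap) φ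

/-- The weak Hopf trace
`ttr({x_e}, {φ_f}) = ∑_{(x_e)} ∏_f ∑ ⟨φ_f⁽¹⁾, y_{d₁}⟩ ⟨φ_f⁽²⁾, y_{d₂}⟩ ⋯`,
where the edge `e` contributes `S(x_e⁽¹⁾)` to the face on its right and `x_e⁽²⁾` to the face on its
left. The Sweedler sums are taken over some expression `Δ(x_e) = ∑ᵢ (x_e)ᵢ⁽¹⁾ ⊗ (x_e)ᵢ⁽²⁾`; as the
summand is multilinear, it does not matter which. -/
def ttr (fs : L.Face → L.Site) (x : E → W) (φ : L.Face → DualAlg W) : ℂ :=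
  ∑ i ∈ Fintype.piFinset fun e => (ℛ ℂ (x e)).index,
    ∏ f : L.Face, faceEval L (fs f) (φ f) fun d =>
      if d.2 then (ℛ ℂ (x d.1)).right (i d.1)
      else WeakHopfAlgebra.antipode ((ℛ ℂ (x d.1)).left (i d.1))

/-- The weak Hopf tensor network state `∑_{(x_e)} ttr({x_e⁽²⁾}, {φ_f}) ⨂_e |x_e⁽¹⁾⟩`. -/
def tensorNetworkState (fs : L.Face → L.Site) (x : E → W) (φ : L.Face → DualAlg W) :
    TotalSpace W E :=
  ∑ i ∈ Fintype.piFinset fun e => (ℛ ℂ (x e)).index,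
    ttr L fs (fun e => (ℛ ℂ (x e)).right (i e)) φ •
      PiTensorProduct.tprod ℂ fun e => (ℛ ℂ (x e)).left (i e)

end Model

/-- `ψ` is a ground state of `H`: a nonzero eigenvector for an eigenvalue `E₀` which is the lowest
among the eigenvalues of `H`, all of which are real. -/
def IsGroundState {V : Type*} [AddCommGroup V] [Module ℂ V] (H : Module.End ℂ V) (ψ : V) : Prop :=
  ∃ E₀ : ℝ, H.HasEigenvector (E₀ : ℂ) ψ ∧
    ∀ μ : ℂ, H.HasEigenvalue μ → ∃ r : ℝ, μ = r ∧ E₀ ≤ r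

end WeakHopf

end

/-! Cocommutativity of the Haar integral `h` makes the whole situation tracial. The exchange rule `∑
h⁽¹⁾ ⊗ a h⁽²⁾ = ∑ S(a) h⁽¹⁾ ⊗ h⁽²⁾` (`IsHaarIntegral.sw_mul_right`), applied once on each side of a
swap of the legs, yields `S² = id`. The trace `τ` of the left regular representation then satisfies
`∑ τ(S(h⁽¹⁾)x) h⁽²⁾ = x`. Hence `W` is semisimple, and the Haar integral of the dual is `φ = τ(v ·)`
with `v` central and invertible (`exists_central_of_isHaarIntegral`). So `φ` is a trace, it is
invariant under `S`, and it is cocommutative in `Ŵ`.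

Consequently all `A_v` and `B_f` are commuting idempotents, independent of the starting sites.
Operators of the same kind are words in commuting letters. For a face and a vertex with a common
corner, the relations on one edge (`EdgeCalculus`) allow a `W`-valued flag to be carried around the
face (`semiconjBy_faceOrder`). At the corner the flag is removed by means of `S² = id` and the
cyclic invariance of the threefold coproduct of `h` (`EdgeCalculus.commute_of_site`).

The trace is evaluated on the very legs of `h` that `T₊` and `T₋` split off, so `Ψ = ∏_f B_f (⨂ h)`
(`tensorNetworkState_eq`). Invariance under `B_f` is then idempotence. For `A_v`, commute it past
the product. On `⨂ h` a vertex letter depends on its argument only through `ε_L`, and a face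
operator absorbs `Δ(1)` placed at one of its corners (`EdgeCalculus.face_mul_corner`). The letters
of `A_v` therefore disappear one at a time, and the last one becomes `ε_L(h) = 1`
(`EdgeCalculus.vertex_apply`).

For `Ψ ≠ 0`, write `∑ h⁽¹⁾ ⊗ S(h⁽²⁾)` as the element `∑ nᵢ⁻¹ e_ab ⊗ e_ba` of a product of matrix
algebras. A product of functionals on the edges, twisted by powers of `u = v⁻¹` that turn every `φ`
into `τ`, sends `Ψ` to a sum of positive weights times traces of words in matrix units. These traces
are natural numbers, and at least one term is positive (`tensorNetworkState_ne_zero`).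

Finally `H` is a sum of commuting idempotents, so its eigenvalues are natural numbers, while `Ψ` has
eigenvalue `0`. -/

noncomputable section
set_option linter.unusedSectionVars false

namespace WeakHopf

/-! ### Linearity of unbundled functions -/

/-- Complex linearity of a function, as a property that `fun_prop` can prove. -/
@[fun_prop]
def Lin {M N : Type*} [AddCommGroup M] [Module ℂ M] [AddCommGroup N] [Module ℂ N] (f : M → N) :
    Prop :=
  IsLinearMap ℂ f

section Lin

variable {M N P A : Type*} [AddCommGroup M] [Module ℂ M] [AddCommGroup N] [Module ℂ N]
  [AddCommGroup P] [Module ℂ P] [Ring A] [Algebra ℂ A]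

@[fun_prop]
theorem Lin.id : Lin (fun x : M => x) := ⟨fun _ _ => rfl, fun _ _ => rfl⟩

@[fun_prop]
theorem Lin.comp {g : N → P} {f : M → N} (hg : Lin g) (hf : Lin f) : Lin (fun x => g (f x)) :=
  ⟨fun _ _ => by simp [hf.map_add, hg.map_add], fun _ _ => by simp [hf.map_smul, hg.map_smul]⟩

@[fun_prop]
theorem Lin.coe (f : M →ₗ[ℂ] N) : Lin (fun x => f x) := f.isLinear

@[fun_prop]
theorem Lin.coe_apply {f : M → N →ₗ[ℂ] P} (hf : Lin f) (y : N) : Lin (fun x => f x y) :=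
  ⟨fun _ _ => by simp [hf.map_add], fun _ _ => by simp [hf.map_smul]⟩

@[fun_prop]
theorem Lin.mul_const {f : M → A} (hf : Lin f) (c : A) : Lin (fun x => f x * c) :=
  ⟨fun _ _ => by simp [hf.map_add, add_mul], fun _ _ => by simp [hf.map_smul]⟩

@[fun_prop]
theorem Lin.const_mul {f : M → A} (hf : Lin f) (c : A) : Lin (fun x => c * f x) :=
  ⟨fun _ _ => by simp [hf.map_add, mul_add], fun _ _ => by simp [hf.map_smul]⟩

@[fun_prop]
theorem Lin.smul_const {f : M → ℂ} (hf : Lin f) (c : N) : Lin (fun x => f x • c) :=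
  ⟨fun _ _ => by simp [hf.map_add, add_smul], fun _ _ => by simp [hf.map_smul, mul_smul]⟩

@[fun_prop]
theorem Lin.const_smul {f : M → N} (hf : Lin f) (c : ℂ) : Lin (fun x => c • f x) :=
  ⟨fun _ _ => by simp [hf.map_add], fun _ _ => by simp [hf.map_smul, smul_comm c]⟩

@[fun_prop]
theorem Lin.tmul_const {f : M → N} (hf : Lin f) (c : P) : Lin (fun x => f x ⊗ₜ[ℂ] c) :=
  ⟨fun _ _ => by simp [hf.map_add, TensorProduct.add_tmul],
    fun _ _ => by simp [hf.map_smul, TensorProduct.smul_tmul']⟩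

@[fun_prop]
theorem Lin.const_tmul {f : M → N} (hf : Lin f) (c : P) : Lin (fun x => c ⊗ₜ[ℂ] f x) :=
  ⟨fun _ _ => by simp [hf.map_add, TensorProduct.tmul_add], fun _ _ => by simp [hf.map_smul]⟩

theorem Lin.map_sum' {f : M → N} (hf : Lin f) {ι : Type*} (s : Finset ι) (g : ι → M) :
    f (∑ i ∈ s, g i) = ∑ i ∈ s, f (g i) :=
  map_sum (IsLinearMap.mk' f hf) g s

@[fun_prop]
theorem Lin.sum {ι : Type*} {f : M → ι → N} (s : Finset ι) (hf : ∀ i, Lin fun x => f x i) :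
    Lin (fun x => ∑ i ∈ s, f x i) :=
  ⟨fun x y => by simp [fun i => (hf i).map_add x y, Finset.sum_add_distrib],
    fun c x => by simp [fun i => (hf i).map_smul c x, Finset.smul_sum]⟩

end Lin

/-! ### Sweedler sums -/

section Sweedler

variable {C : Type*} [AddCommGroup C] [Module ℂ C] [Coalgebra ℂ C]
variable {M N : Type*} [AddCommGroup M] [Module ℂ M] [AddCommGroup N] [Module ℂ N]
variable {A : Type*} [Ring A] [Algebra ℂ A]

/-- The Sweedler sum `∑ f(x⁽¹⁾, x⁽²⁾)`. -/
def sw (x : C) (f : C → C → M) : M :=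
  ∑ i ∈ (ℛ ℂ x).index, f ((ℛ ℂ x).left i) ((ℛ ℂ x).right i)

/-- The linear map on a tensor product induced by a bilinear function. -/
def bil {V W : Type*} [AddCommGroup V] [Module ℂ V] [AddCommGroup W] [Module ℂ W]
    (f : V → W → M) (h₁ : ∀ b, Lin fun a => f a b) (h₂ : ∀ a, Lin fun b => f a b) :
    V ⊗[ℂ] W →ₗ[ℂ] M :=
  TensorProduct.lift (LinearMap.mk₂ ℂ f (fun a b c => (h₁ c).map_add a b)
    (fun r a c => (h₁ c).map_smul r a) (fun a => (h₂ a).map_add) (fun r a c => (h₂ a).map_smul r c))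

@[simp]
theorem bil_tmul {V W : Type*} [AddCommGroup V] [Module ℂ V] [AddCommGroup W] [Module ℂ W]
    (f : V → W → M) (h₁ : ∀ b, Lin fun a => f a b) (h₂ : ∀ a, Lin fun b => f a b) (a : V) (b : W) :
    bil f h₁ h₂ (a ⊗ₜ b) = f a b := rfl

/-- For a bilinear summand the sum depends only on `Δ(x)`, not on the representative chosen by `ℛ`.
Identities between tensors pass to Sweedler sums in this way. -/
theorem sw_eq_bil (x : C) (f : C → C → M) (h₁ : ∀ b, Lin fun a => f a b)
    (h₂ : ∀ a, Lin fun b => f a b) : sw x f = bil f h₁ h₂ (comul x) := by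
  rw [← (ℛ ℂ x).eq, map_sum]; rfl

theorem sw_linearMap (x : C) (F : C ⊗[ℂ] C →ₗ[ℂ] M) : sw x (fun a b => F (a ⊗ₜ b)) = F (comul x) := by
  rw [← (ℛ ℂ x).eq, map_sum]; rfl

theorem sw_tmul (x : C) : sw x (fun a b => a ⊗ₜ[ℂ] b) = comul x := (ℛ ℂ x).eq

theorem sw_congr {x : C} {f g : C → C → M} (h : ∀ a b, f a b = g a b) : sw x f = sw x g :=
  Finset.sum_congr rfl fun _ _ => h _ _

-- The representative chosen by `ℛ` need not be linear in its argument; bilinearity of the summand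
-- makes the sum linear all the same.
@[fun_prop]
theorem Lin.sw_arg {g : N → C} (hg : Lin g) {f : C → C → M} (h₁ : ∀ b, Lin fun a => f a b)
    (h₂ : ∀ a, Lin fun b => f a b) : Lin (fun z => sw (g z) f) := by
  have : (fun z => sw (g z) f) = fun z => bil f h₁ h₂ (comul (g z)) :=
    funext fun z => sw_eq_bil _ _ _ _
  rw [this]; fun_prop

@[fun_prop]
theorem Lin.sw_fun {f : N → C → C → M} (hf : ∀ a b, Lin fun z => f z a b) (x : C) :
    Lin (fun z => sw x (f z)) := by
  unfold sw; fun_prop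

theorem Lin.map_sw {F : M → N} (hF : Lin F) (x : C) (f : C → C → M) :
    F (sw x f) = sw x fun a b => F (f a b) := hF.map_sum' _ _

theorem sw_mul_right (x : C) (f : C → C → A) (c : A) : sw x f * c = sw x fun a b => f a b * c :=
  Finset.sum_mul _ _ _

theorem sw_mul_left (x : C) (f : C → C → A) (c : A) : c * sw x f = sw x fun a b => c * f a b :=
  Finset.mul_sum _ _ _

theorem sw_comm {D : Type*} [AddCommGroup D] [Module ℂ D] [Coalgebra ℂ D] (x : C) (y : D)
    (f : C → C → D → D → M) :
    (sw x fun a b => sw y fun c d => f a b c d) = sw y fun c d => sw x fun a b => f a b c d :=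
  Finset.sum_comm

/-- A trilinear `f` is one linear map `T` on the threefold tensor product, and coassociativity
identifies its two arguments. -/
theorem sw_assoc (x : C) (f : C → C → C → M) (h₁ : ∀ b c, Lin fun a => f a b c)
    (h₂ : ∀ a c, Lin fun b => f a b c) (h₃ : ∀ a b, Lin fun c => f a b c) :
    (sw x fun a b => sw a fun c d => f c d b) = sw x fun a b => sw b fun c d => f a c d := by
  let T : C ⊗[ℂ] (C ⊗[ℂ] C) →ₗ[ℂ] M :=
    bil (fun a u => bil (f a) (h₂ a) (h₃ a) u)
      (fun u => by
        induction u with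
        | zero => simpa using ⟨fun _ _ => by simp, fun _ _ => by simp⟩
        | tmul b c => simpa using h₁ b c
        | add u v hu hv =>
          exact ⟨fun a b => by simp only [map_add, hu.map_add, hv.map_add]; abel,
            fun r a => by simp only [map_add, hu.map_smul, hv.map_smul, smul_add]⟩)
      (fun a => by fun_prop)
  have hl : ∀ a b, (sw a fun c d => f c d b) =
      T (TensorProduct.assoc ℂ C C C (comul.rTensor C (a ⊗ₜ b))) := by
    intro a b
    rw [LinearMap.rTensor_tmul, ← (ℛ ℂ a).eq, TensorProduct.sum_tmul, map_sum, map_sum]; rfl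
  have hr : ∀ a b, (sw b fun c d => f a c d) = T (comul.lTensor C (a ⊗ₜ b)) := by
    intro a b
    rw [LinearMap.lTensor_tmul, ← (ℛ ℂ b).eq, TensorProduct.tmul_sum, map_sum]; rfl
  simp only [hl, hr]
  refine (sw_linearMap x
    (T ∘ₗ (TensorProduct.assoc ℂ C C C).toLinearMap ∘ₗ comul.rTensor C)).trans
      (.trans ?_ (sw_linearMap x (T ∘ₗ comul.lTensor C)).symm)
  simp [Coalgebra.coassoc_apply]

theorem sw_counit_left (x : C) {f : C → M} (hf : Lin f) :
    (sw x fun a b => counit (R := ℂ) a • f b) = f x := by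
  have := (hf.map_sw x fun a b => counit (R := ℂ) a • b).symm
  simp only [hf.map_smul] at this
  rw [this]; congr 1
  exact Coalgebra.sum_counit_smul (ℛ ℂ x)

theorem sw_counit_right (x : C) {f : C → M} (hf : Lin f) :
    (sw x fun a b => counit (R := ℂ) b • f a) = f x := by
  have h := congrArg (TensorProduct.rid ℂ C) (Coalgebra.sum_tmul_counit_eq (ℛ ℂ x))
  simp only [map_sum, TensorProduct.rid_tmul, one_smul] at h
  have := (hf.map_sw x fun a b => counit (R := ℂ) b • a).symm
  simp only [hf.map_smul] at this
  rw [this]; congr 1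

end Sweedler

/-! ### The axioms as identities of Sweedler sums -/

section Basic

variable {W : Type*} [Ring W] [Algebra ℂ W] [WeakHopfAlgebra W]
variable {M : Type*} [AddCommGroup M] [Module ℂ M]

local notation "ε" => counit (R := ℂ)
local notation "𝓢" => WeakHopfAlgebra.antipode

theorem sw_mul (x y : W) (f : W → W → M) (h₁ : ∀ b, Lin fun a => f a b)
    (h₂ : ∀ a, Lin fun b => f a b) :
    sw (x * y) f = sw x fun a b => sw y fun c d => f (a * c) (b * d) := by
  rw [sw_eq_bil _ f h₁ h₂, WeakHopfAlgebra.comul_mul, ← (ℛ ℂ x).eq, ← (ℛ ℂ y).eq,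
    Finset.sum_mul_sum, map_sum]
  refine Finset.sum_congr rfl fun i _ => ?_
  rw [map_sum]
  exact Finset.sum_congr rfl fun j _ => by rw [Algebra.TensorProduct.tmul_mul_tmul]; rfl

/-- The axiom `comul_comul_one`, seen through a trilinear `f`. The primed version has the middle
factors in the other order, and the interplay of the two makes the counital subalgebras commute. -/
theorem sw_one_assoc (f : W → W → W → M) (h₁ : ∀ b c, Lin fun a => f a b c)
    (h₂ : ∀ a c, Lin fun b => f a b c) (h₃ : ∀ a b, Lin fun c => f a b c) :
    (sw (1 : W) fun a b => sw b fun c d => f a c d) =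
      sw (1 : W) fun a b => sw (1 : W) fun c d => f a (b * c) d := by
  let T : (W ⊗[ℂ] W) ⊗[ℂ] W →ₗ[ℂ] M :=
    bil (fun u c => bil (fun a b => f a b c) (fun b => h₁ b c) (fun a => h₂ a c) u)
      (fun c => by fun_prop)
      (fun u => by
        induction u with
        | zero => simpa using ⟨fun _ _ => by simp, fun _ _ => by simp⟩
        | tmul b c => simpa using h₃ b c
        | add u v hu hv =>
          exact ⟨fun a b => by simp only [map_add, hu.map_add, hv.map_add]; abel,
            fun r a => by simp only [map_add, hu.map_smul, hv.map_smul, smul_add]⟩)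
  have hT : ∀ a b c, T ((a ⊗ₜ b) ⊗ₜ c) = f a b c := fun _ _ _ => rfl
  have key := congrArg T (WeakHopfAlgebra.comul_comul_one (W := W))
  rw [← sw_assoc _ _ h₁ h₂ h₃]
  have e₁ : T (comul.rTensor W (comul (1 : W))) =
      sw (1 : W) fun a b => sw a fun c d => f c d b := by
    refine (sw_linearMap (1 : W) (T ∘ₗ comul.rTensor W)).symm.trans (sw_congr fun a b => ?_)
    rw [LinearMap.comp_apply, LinearMap.rTensor_tmul, ← (ℛ ℂ a).eq, TensorProduct.sum_tmul, map_sum]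
    rfl
  rw [← e₁, key, ← sw_tmul (1 : W)]
  simp only [sw, TensorProduct.sum_tmul, TensorProduct.tmul_sum, map_sum, Finset.sum_mul_sum,
    TensorProduct.assoc_symm_tmul, Algebra.TensorProduct.tmul_mul_tmul, one_mul, mul_one, hT]

theorem sw_one_assoc' (f : W → W → W → M) (h₁ : ∀ b c, Lin fun a => f a b c)
    (h₂ : ∀ a c, Lin fun b => f a b c) (h₃ : ∀ a b, Lin fun c => f a b c) :
    (sw (1 : W) fun a b => sw b fun c d => f a c d) =
      sw (1 : W) fun a b => sw (1 : W) fun c d => f a (c * b) d := by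
  let T : (W ⊗[ℂ] W) ⊗[ℂ] W →ₗ[ℂ] M :=
    bil (fun u c => bil (fun a b => f a b c) (fun b => h₁ b c) (fun a => h₂ a c) u)
      (fun c => by fun_prop)
      (fun u => by
        induction u with
        | zero => simpa using ⟨fun _ _ => by simp, fun _ _ => by simp⟩
        | tmul b c => simpa using h₃ b c
        | add u v hu hv =>
          exact ⟨fun a b => by simp only [map_add, hu.map_add, hv.map_add]; abel,
            fun r a => by simp only [map_add, hu.map_smul, hv.map_smul, smul_add]⟩)
  have hT : ∀ a b c, T ((a ⊗ₜ b) ⊗ₜ c) = f a b c := fun _ _ _ => rfl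
  have key := congrArg T (WeakHopfAlgebra.comul_comul_one' (W := W))
  rw [← sw_assoc _ _ h₁ h₂ h₃]
  have e₁ : T (comul.rTensor W (comul (1 : W))) =
      sw (1 : W) fun a b => sw a fun c d => f c d b := by
    refine (sw_linearMap (1 : W) (T ∘ₗ comul.rTensor W)).symm.trans (sw_congr fun a b => ?_)
    rw [LinearMap.comp_apply, LinearMap.rTensor_tmul, ← (ℛ ℂ a).eq, TensorProduct.sum_tmul, map_sum]
    rfl
  rw [← e₁, key, ← sw_tmul (1 : W)]
  simp only [sw, TensorProduct.sum_tmul, TensorProduct.tmul_sum, map_sum, Finset.sum_mul_sum,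
    TensorProduct.assoc_symm_tmul, Algebra.TensorProduct.tmul_mul_tmul, one_mul, mul_one, hT]
  exact Finset.sum_comm

theorem sw_counit_mul (x y z : W) :
    (sw y fun a b => ε (x * a) * ε (b * z)) = ε (x * y * z) := by
  rw [WeakHopfAlgebra.counit_mul_mul]
  exact sw_linearMap y (LinearMap.mul' ℂ ℂ ∘ₗ TensorProduct.map (counit ∘ₗ LinearMap.mulLeft ℂ x)
    (counit ∘ₗ LinearMap.mulRight ℂ z))

theorem sw_counit_mul' (x y z : W) :
    (sw y fun a b => ε (x * b) * ε (a * z)) = ε (x * y * z) := by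
  rw [WeakHopfAlgebra.counit_mul_mul']
  exact sw_linearMap y (LinearMap.mul' ℂ ℂ ∘ₗ TensorProduct.map (counit ∘ₗ LinearMap.mulLeft ℂ x)
    (counit ∘ₗ LinearMap.mulRight ℂ z) ∘ₗ (TensorProduct.comm ℂ W W).toLinearMap)

theorem epsL_eq_sw (x : W) : epsL x = sw (1 : W) fun a b => ε (a * x) • b := by
  rw [epsL, ← sw_tmul (1 : W)]
  simp only [sw, Finset.sum_mul, map_sum, Algebra.TensorProduct.tmul_mul_tmul, mul_one,
    LinearMap.rTensor_tmul, TensorProduct.lid_tmul]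

theorem epsR_eq_sw (x : W) : epsR x = sw (1 : W) fun a b => ε (x * b) • a := by
  rw [epsR, ← sw_tmul (1 : W)]
  simp only [sw, Finset.mul_sum, map_sum, Algebra.TensorProduct.tmul_mul_tmul, one_mul,
    LinearMap.lTensor_tmul, TensorProduct.rid_tmul]

theorem sw_mul_antipode (x : W) : (sw x fun a b => a * 𝓢 b) = epsL x := by
  rw [← WeakHopfAlgebra.mul_antipode]
  exact sw_linearMap x (LinearMap.mul' ℂ W ∘ₗ LinearMap.lTensor W 𝓢)

theorem sw_antipode_mul (x : W) : (sw x fun a b => 𝓢 a * b) = epsR x := by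
  rw [← WeakHopfAlgebra.antipode_mul]
  exact sw_linearMap x (LinearMap.mul' ℂ W ∘ₗ LinearMap.rTensor W 𝓢)

@[fun_prop]
theorem lin_epsL {N : Type*} [AddCommGroup N] [Module ℂ N] {g : N → W} (hg : Lin g) :
    Lin fun z => epsL (g z) := by
  simp only [epsL_eq_sw]; fun_prop

@[fun_prop]
theorem lin_epsR {N : Type*} [AddCommGroup N] [Module ℂ N] {g : N → W} (hg : Lin g) :
    Lin fun z => epsR (g z) := by
  simp only [epsR_eq_sw]; fun_prop

theorem sw_epsR_mul_antipode (x : W) : (sw x fun a b => epsR a * 𝓢 b) = 𝓢 x := by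
  rw [WeakHopfAlgebra.antipode_mul_antipode x]
  refine (sw_congr fun a b => ?_).trans (sw_linearMap x (LinearMap.mul' ℂ W ∘ₗ
    TensorProduct.map (LinearMap.mul' ℂ W ∘ₗ LinearMap.rTensor W 𝓢 ∘ₗ comul) 𝓢))
  simp [← WeakHopfAlgebra.antipode_mul]

theorem sw_antipode_mul_epsL (x : W) : (sw x fun a b => 𝓢 a * epsL b) = 𝓢 x := by
  rw [← sw_epsR_mul_antipode x]
  simp only [← sw_antipode_mul, ← sw_mul_antipode, sw_mul_right, sw_mul_left, ← mul_assoc]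
  rw [sw_assoc] <;> fun_prop

/-! ### The counital maps -/

/-- Since `Δ(x) = Δ(1)Δ(x)`, there is a second copy of `Δ(1)`. The unit axiom merges it with the
copy inside `ε_L` into the iterated coproduct of `1`, and the counit erases the middle leg. -/
theorem sw_epsL_right (x : W) (f : W → W → M) (h₁ : ∀ b, Lin fun a => f a b)
    (h₂ : ∀ a, Lin fun b => f a b) :
    (sw x fun a b => f a (epsL b)) = sw (1 : W) fun a b => f (a * x) b := by
  calc (sw x fun a b => f a (epsL b))
      = sw x fun p q => sw (1 : W) fun c d => ε (c * q) • f p d := by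
        refine sw_congr fun p q => ?_
        rw [epsL_eq_sw, (h₂ p).map_sw]
        simp only [(h₂ p).map_smul]
    _ = sw (1 : W) fun c d => sw (1 * x) fun p q => ε (c * q) • f p d := by rw [sw_comm, one_mul]
    _ = sw (1 : W) fun c d => sw (1 : W) fun a b => sw x fun p q =>
          ε (c * (b * q)) • f (a * p) d :=
        sw_congr fun c d => by rw [sw_mul] <;> fun_prop
    _ = sw (1 : W) fun a b => sw (1 : W) fun c d => sw x fun p q =>
          ε ((c * b) * q) • f (a * p) d := by rw [sw_comm]; simp only [mul_assoc]
    _ = sw (1 : W) fun a b => sw b fun c d => sw x fun p q => ε (c * q) • f (a * p) d := by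
        rw [sw_one_assoc' (fun a b d => sw x fun p q => ε (b * q) • f (a * p) d)] <;> fun_prop
    _ = sw (1 : W) fun a b => sw a fun c d => sw x fun p q => ε (d * q) • f (c * p) b := by
        rw [← sw_assoc (1 : W) (fun a c d => sw x fun p q => ε (c * q) • f (a * p) d)] <;> fun_prop
    _ = sw (1 : W) fun a b => sw (a * x) fun p q => ε q • f p b :=
        sw_congr fun a b => by rw [sw_mul] <;> fun_prop
    _ = sw (1 : W) fun a b => f (a * x) b :=
        sw_congr fun a b => sw_counit_right (a * x) (h₁ b)

theorem sw_epsR_left (x : W) (f : W → W → M) (h₁ : ∀ b, Lin fun a => f a b)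
    (h₂ : ∀ a, Lin fun b => f a b) :
    (sw x fun a b => f (epsR a) b) = sw (1 : W) fun a b => f a (x * b) := by
  calc (sw x fun a b => f (epsR a) b)
      = sw x fun p q => sw (1 : W) fun a b => ε (p * b) • f a q := by
        refine sw_congr fun p q => ?_
        rw [epsR_eq_sw, (h₁ q).map_sw]
        simp only [(h₁ q).map_smul]
    _ = sw (1 : W) fun a b => sw (x * 1) fun p q => ε (p * b) • f a q := by rw [sw_comm, mul_one]
    _ = sw (1 : W) fun a b => sw x fun p q => sw (1 : W) fun c d =>
          ε (p * c * b) • f a (q * d) :=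
        sw_congr fun c d => by rw [sw_mul] <;> fun_prop
    _ = sw (1 : W) fun a b => sw (1 : W) fun c d => sw x fun p q =>
          ε (p * (c * b)) • f a (q * d) := by
        refine sw_congr fun a b => ?_
        rw [sw_comm]; simp only [mul_assoc]
    _ = sw (1 : W) fun a b => sw b fun c d => sw x fun p q => ε (p * c) • f a (q * d) := by
        rw [sw_one_assoc' (fun a b d => sw x fun p q => ε (p * b) • f a (q * d))] <;> fun_prop
    _ = sw (1 : W) fun a b => sw (x * b) fun p q => ε p • f a q := by
        refine sw_congr fun a b => ?_
        rw [sw_comm, sw_mul] <;> fun_prop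
    _ = sw (1 : W) fun a b => f a (x * b) :=
        sw_congr fun a b => sw_counit_left (x * b) (h₂ a)

theorem counit_mul_epsL (x y : W) : ε (x * epsL y) = ε (x * y) := by
  rw [epsL_eq_sw, Lin.map_sw (F := fun z => ε (x * z)) (by fun_prop)]
  simp only [mul_smul_comm, map_smul, smul_eq_mul]
  simpa [mul_comm] using sw_counit_mul' x 1 y

theorem counit_epsR_mul (x y : W) : ε (epsR x * y) = ε (x * y) := by
  rw [epsR_eq_sw, Lin.map_sw (F := fun z => ε (z * y)) (by fun_prop)]
  simp only [smul_mul_assoc, map_smul, smul_eq_mul]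
  simpa using sw_counit_mul' x 1 y

theorem epsL_mul_epsL (x y : W) : epsL (x * epsL y) = epsL (x * y) := by
  rw [epsL_eq_sw, epsL_eq_sw (x * y)]
  simp only [← mul_assoc, counit_mul_epsL]

theorem epsR_epsR_mul (x y : W) : epsR (epsR x * y) = epsR (x * y) := by
  rw [epsR_eq_sw, epsR_eq_sw (x * y)]
  simp only [mul_assoc, counit_epsR_mul]

/-- `Δ(a) = 1⁽¹⁾a ⊗ 1⁽²⁾ = a1⁽¹⁾ ⊗ 1⁽²⁾`, the defining property of the left counital subalgebra. -/
structure IsLeftBase (a : W) : Prop where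
  comul_mul_left : comul (R := ℂ) a = (a ⊗ₜ[ℂ] (1 : W)) * comul (R := ℂ) (1 : W)
  comul_mul_right : comul (R := ℂ) a = comul (R := ℂ) (1 : W) * (a ⊗ₜ[ℂ] (1 : W))

/-- `Δ(b) = 1⁽¹⁾ ⊗ 1⁽²⁾b = 1⁽¹⁾ ⊗ b1⁽²⁾`, the defining property of the right counital subalgebra. -/
structure IsRightBase (b : W) : Prop where
  comul_mul_left : comul (R := ℂ) b = ((1 : W) ⊗ₜ[ℂ] b) * comul (R := ℂ) (1 : W)
  comul_mul_right : comul (R := ℂ) b = comul (R := ℂ) (1 : W) * ((1 : W) ⊗ₜ[ℂ] b)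

theorem comul_one_mul_comul (x : W) : comul (R := ℂ) (1 : W) * comul x = comul (R := ℂ) x := by
  rw [← WeakHopfAlgebra.comul_mul, one_mul]

theorem comul_mul_comul_one (x : W) : comul (R := ℂ) x * comul (1 : W) = comul (R := ℂ) x := by
  rw [← WeakHopfAlgebra.comul_mul, mul_one]

theorem IsLeftBase.comul_mul {a : W} (ha : IsLeftBase a) (x : W) :
    comul (R := ℂ) (a * x) = (a ⊗ₜ[ℂ] (1 : W)) * comul (R := ℂ) x := by
  rw [WeakHopfAlgebra.comul_mul, ha.comul_mul_left, mul_assoc, comul_one_mul_comul]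

theorem IsLeftBase.comul_mul' {a : W} (ha : IsLeftBase a) (x : W) :
    comul (R := ℂ) (x * a) = comul (R := ℂ) x * (a ⊗ₜ[ℂ] (1 : W)) := by
  rw [WeakHopfAlgebra.comul_mul, ha.comul_mul_right, ← mul_assoc, comul_mul_comul_one]

theorem IsRightBase.comul_mul {a : W} (ha : IsRightBase a) (x : W) :
    comul (R := ℂ) (a * x) = ((1 : W) ⊗ₜ[ℂ] a) * comul (R := ℂ) x := by
  rw [WeakHopfAlgebra.comul_mul, ha.comul_mul_left, mul_assoc, comul_one_mul_comul]

theorem IsRightBase.comul_mul' {a : W} (ha : IsRightBase a) (x : W) :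
    comul (R := ℂ) (x * a) = comul (R := ℂ) x * ((1 : W) ⊗ₜ[ℂ] a) := by
  rw [WeakHopfAlgebra.comul_mul, ha.comul_mul_right, ← mul_assoc, comul_mul_comul_one]

end Basic

/-! ### The antipode reverses products and coproducts -/

section Antipode

variable {W : Type*} [Ring W] [Algebra ℂ W] [WeakHopfAlgebra W]
variable {M : Type*} [AddCommGroup M] [Module ℂ M]

local notation "ε" => counit (R := ℂ)
local notation "𝓢" => WeakHopfAlgebra.antipode

theorem sw_eq_of_comul_eq {x : W} {F : W ⊗[ℂ] W → W ⊗[ℂ] W} {y : W} {g : W → W → M}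
    (hx : comul (R := ℂ) x = F (comul y)) (f : W → W → M) (h₁ : ∀ b, Lin fun a => f a b)
    (h₂ : ∀ a, Lin fun b => f a b) (hF : Lin F) (hg : ∀ a b, bil f h₁ h₂ (F (a ⊗ₜ b)) = g a b) :
    sw x f = sw y g := by
  rw [sw_eq_bil x f h₁ h₂, hx, ← sw_tmul y,
    Lin.map_sw (F := fun t => bil f h₁ h₂ (F t)) (by fun_prop)]
  exact sw_congr hg

theorem IsLeftBase.sw_mul {a : W} (ha : IsLeftBase a) (x : W) (f : W → W → M)
    (h₁ : ∀ b, Lin fun a => f a b) (h₂ : ∀ a, Lin fun b => f a b) :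
    sw (a * x) f = sw x fun c d => f (a * c) d :=
  sw_eq_of_comul_eq (F := fun t => (a ⊗ₜ[ℂ] (1 : W)) * t) (ha.comul_mul x) f h₁ h₂ (by fun_prop)
    fun c d => by simp [Algebra.TensorProduct.tmul_mul_tmul]

theorem IsLeftBase.sw_mul' {a : W} (ha : IsLeftBase a) (x : W) (f : W → W → M)
    (h₁ : ∀ b, Lin fun a => f a b) (h₂ : ∀ a, Lin fun b => f a b) :
    sw (x * a) f = sw x fun c d => f (c * a) d :=
  sw_eq_of_comul_eq (F := fun t => t * (a ⊗ₜ[ℂ] (1 : W))) (ha.comul_mul' x) f h₁ h₂ (by fun_prop)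
    fun c d => by simp [Algebra.TensorProduct.tmul_mul_tmul]

theorem IsRightBase.sw_mul {a : W} (ha : IsRightBase a) (x : W) (f : W → W → M)
    (h₁ : ∀ b, Lin fun a => f a b) (h₂ : ∀ a, Lin fun b => f a b) :
    sw (a * x) f = sw x fun c d => f c (a * d) :=
  sw_eq_of_comul_eq (F := fun t => ((1 : W) ⊗ₜ[ℂ] a) * t) (ha.comul_mul x) f h₁ h₂ (by fun_prop)
    fun c d => by simp [Algebra.TensorProduct.tmul_mul_tmul]

theorem IsRightBase.sw_mul' {a : W} (ha : IsRightBase a) (x : W) (f : W → W → M)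
    (h₁ : ∀ b, Lin fun a => f a b) (h₂ : ∀ a, Lin fun b => f a b) :
    sw (x * a) f = sw x fun c d => f c (d * a) :=
  sw_eq_of_comul_eq (F := fun t => t * ((1 : W) ⊗ₜ[ℂ] a)) (ha.comul_mul' x) f h₁ h₂ (by fun_prop)
    fun c d => by simp [Algebra.TensorProduct.tmul_mul_tmul]

theorem isLeftBase_epsL (x : W) : IsLeftBase (epsL x) := by
  have h : comul (R := ℂ) (epsL x) =
      sw (1 : W) fun p q => sw q fun c d => ε (p * x) • (c ⊗ₜ[ℂ] d) := by
    rw [epsL_eq_sw, Lin.map_sw (F := fun z => comul (R := ℂ) z) (by fun_prop)]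
    refine sw_congr fun p q => ?_
    rw [map_smul, ← sw_tmul q, Lin.map_sw (F := fun z => ε (p * x) • z) (by fun_prop)]
  constructor
  · rw [h, sw_one_assoc (fun p c d => ε (p * x) • (c ⊗ₜ[ℂ] d)), epsL_eq_sw, ← sw_tmul (1 : W),
      Lin.map_sw (F := fun z => (z ⊗ₜ[ℂ] (1 : W)) * sw (1 : W) fun a b => a ⊗ₜ[ℂ] b) (by fun_prop)]
    · refine sw_congr fun p q => ?_
      rw [sw_mul_left]
      refine sw_congr fun c d => ?_
      rw [Algebra.TensorProduct.tmul_mul_tmul, one_mul, smul_mul_assoc, TensorProduct.smul_tmul']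
    all_goals fun_prop
  · rw [h, sw_one_assoc' (fun p c d => ε (p * x) • (c ⊗ₜ[ℂ] d)), epsL_eq_sw, ← sw_tmul (1 : W),
      Lin.map_sw (F := fun z => (sw (1 : W) fun a b => a ⊗ₜ[ℂ] b) * (z ⊗ₜ[ℂ] (1 : W))) (by fun_prop)]
    · refine sw_congr fun p q => ?_
      rw [sw_mul_right]
      refine sw_congr fun c d => ?_
      rw [Algebra.TensorProduct.tmul_mul_tmul, mul_one, mul_smul_comm, TensorProduct.smul_tmul']
    all_goals fun_prop

theorem isRightBase_epsR (x : W) : IsRightBase (epsR x) := by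
  have h : comul (R := ℂ) (epsR x) =
      sw (1 : W) fun p q => sw q fun c d => ε (x * d) • (p ⊗ₜ[ℂ] c) := by
    rw [epsR_eq_sw, Lin.map_sw (F := fun z => comul (R := ℂ) z) (by fun_prop),
      ← sw_assoc (1 : W) (fun p c d => ε (x * d) • (p ⊗ₜ[ℂ] c))]
    · refine sw_congr fun p q => ?_
      rw [map_smul, ← sw_tmul p, Lin.map_sw (F := fun z => ε (x * q) • z) (by fun_prop)]
    all_goals fun_prop
  constructor
  · rw [h, sw_one_assoc' (fun p c d => ε (x * d) • (p ⊗ₜ[ℂ] c)), epsR_eq_sw, ← sw_tmul (1 : W),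
      Lin.map_sw (F := fun z => ((1 : W) ⊗ₜ[ℂ] z) * sw (1 : W) fun a b => a ⊗ₜ[ℂ] b) (by fun_prop),
      sw_comm]
    · refine sw_congr fun p q => ?_
      rw [sw_mul_left]
      refine sw_congr fun c d => ?_
      rw [Algebra.TensorProduct.tmul_mul_tmul, one_mul, smul_mul_assoc, TensorProduct.tmul_smul]
    all_goals fun_prop
  · rw [h, sw_one_assoc (fun p c d => ε (x * d) • (p ⊗ₜ[ℂ] c)), epsR_eq_sw, ← sw_tmul (1 : W),
      Lin.map_sw (F := fun z => (sw (1 : W) fun a b => a ⊗ₜ[ℂ] b) * ((1 : W) ⊗ₜ[ℂ] z)) (by fun_prop),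
      sw_comm]
    · refine sw_congr fun p q => ?_
      rw [sw_mul_right]
      refine sw_congr fun c d => ?_
      rw [Algebra.TensorProduct.tmul_mul_tmul, mul_one, mul_smul_comm, TensorProduct.tmul_smul]
    all_goals fun_prop

/-- The two unit axioms, contracted with `ε(· x)` on the first leg and `ε(y ·)` on the third, leave
the product of the same two elements in either order. -/
theorem epsL_mul_epsR (x y : W) : epsL x * epsR y = epsR y * epsL x := by
  have e₁ := sw_one_assoc (W := W) (fun a b c => (ε (a * x) * ε (y * c)) • b)
    (by fun_prop) (by fun_prop) (by fun_prop)
  rw [sw_one_assoc' (W := W) (fun a b c => (ε (a * x) * ε (y * c)) • b)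
    (by fun_prop) (by fun_prop) (by fun_prop)] at e₁
  rw [epsL_eq_sw, epsR_eq_sw, sw_mul_right, sw_mul_left]
  simp only [sw_mul_right, sw_mul_left, smul_mul_smul_comm]
  rw [← e₁]
  exact sw_congr fun a b => sw_congr fun c d => by rw [mul_comm (ε (y * d))]

theorem IsLeftBase.epsL_mul {a : W} (ha : IsLeftBase a) (x : W) : epsL (a * x) = a * epsL x := by
  rw [← sw_mul_antipode, ha.sw_mul, ← sw_mul_antipode, sw_mul_left]
  · simp only [mul_assoc]
  all_goals fun_prop

theorem IsRightBase.epsR_mul {b : W} (hb : IsRightBase b) (x : W) :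
    epsR (x * b) = epsR x * b := by
  rw [← sw_antipode_mul, hb.sw_mul', ← sw_antipode_mul, sw_mul_right]
  · simp only [mul_assoc]
  all_goals fun_prop

theorem epsL_mul_eq_sw (x y : W) : epsL (x * y) = sw x fun a b => a * epsL y * 𝓢 b := by
  rw [← epsL_mul_epsL, ← sw_mul_antipode, (isLeftBase_epsL y).sw_mul'] <;> fun_prop

theorem epsR_mul_eq_sw (x y : W) : epsR (x * y) = sw y fun c d => 𝓢 c * epsR x * d := by
  rw [← epsR_epsR_mul, ← sw_antipode_mul, (isRightBase_epsR x).sw_mul]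
  · simp only [mul_assoc]
  all_goals fun_prop

theorem epsL_one : epsL (1 : W) = 1 := by
  rw [epsL_eq_sw]; simpa using sw_counit_left (1 : W) (f := fun z : W => z) (by fun_prop)

theorem epsR_one : epsR (1 : W) = 1 := by
  rw [epsR_eq_sw]; simpa using sw_counit_right (1 : W) (f := fun z : W => z) (by fun_prop)

/-- The antipode is antimultiplicative. -/
theorem antipode_mul (x y : W) : (𝓢 (x * y) : W) = 𝓢 y * 𝓢 x := by
  calc (𝓢 (x * y) : W)
      = sw x fun a b => sw y fun c d => 𝓢 (a * c) * epsL (b * d) := by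
        rw [← sw_antipode_mul_epsL, sw_mul] <;> fun_prop
    -- `ε_L(x⁽²⁾y⁽²⁾)` is opened to `x⁽²⁾y⁽²⁾S(y⁽³⁾)S(x⁽³⁾)`, which exhibits `S(y)S(x)` on the
    -- right. Regrouping then turns `S(x⁽¹⁾y⁽¹⁾)x⁽²⁾y⁽²⁾` into a value of `ε_R`.
    _ = sw x fun a b => sw y fun c d => sw b fun b₁ b₂ => sw d fun d₁ d₂ =>
          𝓢 (a * c) * (b₁ * d₁) * (𝓢 d₂ * 𝓢 b₂) := by
        refine sw_congr fun a b => sw_congr fun c d => ?_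
        rw [epsL_mul_eq_sw, sw_mul_left]
        refine sw_congr fun b₁ b₂ => ?_
        rw [← sw_mul_antipode, sw_mul_left, sw_mul_right, sw_mul_left]
        simp only [mul_assoc]
    _ = sw x fun a b => sw b fun b₁ b₂ => sw y fun c d => sw d fun d₁ d₂ =>
          𝓢 (a * c) * (b₁ * d₁) * (𝓢 d₂ * 𝓢 b₂) := by
        refine sw_congr fun a b => ?_
        rw [sw_comm]
    _ = sw x fun a b => sw b fun b₁ b₂ => sw y fun c d => sw c fun c₁ c₂ =>
          𝓢 (a * c₁) * (b₁ * c₂) * (𝓢 d * 𝓢 b₂) := by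
        refine sw_congr fun a b => sw_congr fun b₁ b₂ => ?_
        rw [sw_assoc] <;> fun_prop
    _ = sw x fun a b => sw a fun a₁ a₂ => sw y fun c d => sw c fun c₁ c₂ =>
          𝓢 (a₁ * c₁) * (a₂ * c₂) * (𝓢 d * 𝓢 b) := by
        rw [sw_assoc x (fun a b₁ b₂ => sw y fun c d => sw c fun c₁ c₂ =>
          𝓢 (a * c₁) * (b₁ * c₂) * (𝓢 d * 𝓢 b₂))] <;> fun_prop
    _ = sw x fun a b => sw y fun c d => epsR (a * c) * (𝓢 d * 𝓢 b) := by
        refine sw_congr fun a b => ?_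
        rw [sw_comm]
        refine sw_congr fun c d => ?_
        rw [← sw_antipode_mul, sw_mul, sw_mul_right]
        · simp only [sw_mul_right]
        all_goals fun_prop
    _ = sw x fun a b => sw y fun c d => sw c fun c₁ c₂ =>
          𝓢 c₁ * (epsR a * ((c₂ * 𝓢 d) * 𝓢 b)) := by
        refine sw_congr fun a b => sw_congr fun c d => ?_
        rw [epsR_mul_eq_sw, sw_mul_right]
        simp only [mul_assoc]
    _ = sw x fun a b => sw y fun c d => 𝓢 c * (epsR a * (epsL d * 𝓢 b)) := by
        refine sw_congr fun a b => ?_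
        rw [sw_assoc]
        · refine sw_congr fun c d => ?_
          rw [← sw_mul_antipode, sw_mul_right, sw_mul_left, sw_mul_left]
        all_goals fun_prop
    _ = sw x fun a b => 𝓢 y * (epsR a * 𝓢 b) := by
        refine sw_congr fun a b => ?_
        rw [← sw_antipode_mul_epsL y, sw_mul_right]
        refine sw_congr fun c d => ?_
        -- The images of `ε_L` and `ε_R` commute, so `ε_L(y⁽²⁾)` can move next to `S(y⁽¹⁾)` and be
        -- absorbed.
        rw [← mul_assoc (epsR a), ← epsL_mul_epsR, mul_assoc, mul_assoc]
    _ = 𝓢 y * 𝓢 x := by rw [← sw_mul_left, sw_epsR_mul_antipode]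

/-- The left side contains `ε(1⁽¹⁾ x 1'⁽²⁾)` for two copies of `Δ(1)`. Weak multiplicativity of `ε`
splits this number at `Δ(x)` into the coefficient of `ε_L(x⁽¹⁾)` and that of `ε_R(x⁽²⁾)`. -/
theorem sw_epsR_epsL (x : W) (f : W → W → M) (h₁ : ∀ b, Lin fun a => f a b)
    (h₂ : ∀ a, Lin fun b => f a b) :
    (sw x fun a b => f (epsR a) (epsL b)) = sw x fun a b => f (epsR b) (epsL a) := by
  calc (sw x fun a b => f (epsR a) (epsL b))
      = sw (1 : W) fun p q => f (epsR (p * x)) q :=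
        sw_epsL_right x (fun a b => f (epsR a) b) (by fun_prop) (by fun_prop)
    _ = sw (1 : W) fun p q => sw (1 : W) fun c d => sw x fun a b =>
          (ε (p * a) * ε (b * d)) • f c q := by
        refine sw_congr fun p q => ?_
        rw [epsR_eq_sw, (h₁ q).map_sw]
        refine sw_congr fun c d => ?_
        rw [(h₁ q).map_smul, ← sw_counit_mul,
          Lin.map_sw (F := fun z : ℂ => z • f c q) (by fun_prop)]
    _ = sw x fun a b => sw (1 : W) fun p q => sw (1 : W) fun c d =>
          (ε (p * a) * ε (b * d)) • f c q := by
        rw [sw_comm x]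
        refine sw_congr fun p q => ?_
        rw [sw_comm x]
    _ = sw x fun a b => f (epsR b) (epsL a) := by
        refine sw_congr fun a b => ?_
        rw [epsL_eq_sw, (h₂ _).map_sw]
        refine sw_congr fun p q => ?_
        rw [(h₂ _).map_smul, epsR_eq_sw, (h₁ q).map_sw, Lin.map_sw (F := fun z : M => ε (p * a) • z)
          (by fun_prop)]
        refine sw_congr fun c d => ?_
        rw [(h₁ q).map_smul, mul_smul]

/-- The comultiplication of the antipode in Sweedler form, `∑ S(x⁽²⁾) ⊗ S(x⁽¹⁾)`. -/
def flipAntipode (x : W) : W ⊗[ℂ] W := sw x fun a b => (𝓢 b : W) ⊗ₜ[ℂ] (𝓢 a : W)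

@[fun_prop]
theorem lin_flipAntipode {N : Type*} [AddCommGroup N] [Module ℂ N] {g : N → W} (hg : Lin g) :
    Lin fun z => flipAntipode (g z) := by
  unfold flipAntipode; fun_prop

theorem sw_comul_mul_flipAntipode (x : W) :
    (sw x fun a b => comul (R := ℂ) a * flipAntipode b) =
      sw x fun k d => sw k fun a m => (a * 𝓢 d) ⊗ₜ[ℂ] epsL m := by
  calc (sw x fun a b => comul (R := ℂ) a * flipAntipode b)
      = sw x fun a b => sw a fun a₁ a₂ => sw b fun b₁ b₂ =>
          (a₁ * 𝓢 b₂) ⊗ₜ[ℂ] (a₂ * 𝓢 b₁) := by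
        refine sw_congr fun a b => ?_
        rw [← sw_tmul a, flipAntipode, sw_mul_right]
        simp only [sw_mul_left, Algebra.TensorProduct.tmul_mul_tmul]
    _ = sw x fun a₁ r => sw r fun a₂ b => sw b fun b₁ b₂ => (a₁ * 𝓢 b₂) ⊗ₜ[ℂ] (a₂ * 𝓢 b₁) := by
        rw [sw_assoc x (fun a₁ a₂ b => sw b fun b₁ b₂ => (a₁ * 𝓢 b₂) ⊗ₜ[ℂ] (a₂ * 𝓢 b₁))] <;>
          fun_prop
    _ = sw x fun a₁ r => sw r fun m b₂ => sw m fun a₂ b₁ => (a₁ * 𝓢 b₂) ⊗ₜ[ℂ] (a₂ * 𝓢 b₁) := by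
        refine sw_congr fun a₁ r => ?_
        rw [sw_assoc] <;> fun_prop
    _ = sw x fun a₁ r => sw r fun m b₂ => (a₁ * 𝓢 b₂) ⊗ₜ[ℂ] epsL m := by
        refine sw_congr fun a₁ r => sw_congr fun m b₂ => ?_
        rw [← sw_mul_antipode, Lin.map_sw (F := fun z : W => (a₁ * 𝓢 b₂) ⊗ₜ[ℂ] z) (by fun_prop)]
    _ = sw x fun k d => sw k fun a m => (a * 𝓢 d) ⊗ₜ[ℂ] epsL m := by
        rw [sw_assoc] <;> fun_prop

/-- `flipAntipode` is a one-sided convolution quasi-inverse of `Δ`, with `Δ ∘ ε_L` in place of the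
unit; `comul_epsR` is the other side. -/
theorem comul_epsL (x : W) :
    comul (R := ℂ) (epsL x) = sw x fun a b => comul (R := ℂ) a * flipAntipode b := by
  calc comul (R := ℂ) (epsL x)
      = sw (1 : W) fun p q => (p * epsL x) ⊗ₜ[ℂ] q := by
        rw [(isLeftBase_epsL x).comul_mul_right, ← sw_tmul (1 : W), sw_mul_right]
        simp only [Algebra.TensorProduct.tmul_mul_tmul, mul_one]
    _ = sw (1 : W) fun p q => sw x fun k d => (p * k * 𝓢 d) ⊗ₜ[ℂ] q := by
        refine sw_congr fun p q => ?_
        rw [← sw_mul_antipode, sw_mul_left, Lin.map_sw (F := fun z : W => z ⊗ₜ[ℂ] q) (by fun_prop)]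
        simp only [mul_assoc]
    _ = sw x fun k d => sw k fun a m => (a * 𝓢 d) ⊗ₜ[ℂ] epsL m := by
        rw [sw_comm]
        refine sw_congr fun k d => ?_
        rw [sw_epsL_right k (fun a m => (a * 𝓢 d) ⊗ₜ[ℂ] m)] <;> fun_prop
    _ = _ := (sw_comul_mul_flipAntipode x).symm

theorem comul_epsR (x : W) :
    comul (R := ℂ) (epsR x) = sw x fun a b => flipAntipode a * comul (R := ℂ) b := by
  symm
  calc (sw x fun a b => flipAntipode a * comul (R := ℂ) b)
      = sw x fun a b => sw a fun a₁ a₂ => sw b fun b₁ b₂ =>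
          (𝓢 a₂ * b₁) ⊗ₜ[ℂ] (𝓢 a₁ * b₂) := by
        refine sw_congr fun a b => ?_
        rw [← sw_tmul b, flipAntipode, sw_mul_right]
        simp only [sw_mul_left, Algebra.TensorProduct.tmul_mul_tmul]
    _ = sw x fun a₁ r => sw r fun a₂ b => sw b fun b₁ b₂ => (𝓢 a₂ * b₁) ⊗ₜ[ℂ] (𝓢 a₁ * b₂) := by
        rw [sw_assoc x (fun a₁ a₂ b => sw b fun b₁ b₂ => (𝓢 a₂ * b₁) ⊗ₜ[ℂ] (𝓢 a₁ * b₂))] <;>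
          fun_prop
    _ = sw x fun a₁ r => sw r fun m b₂ => sw m fun a₂ b₁ => (𝓢 a₂ * b₁) ⊗ₜ[ℂ] (𝓢 a₁ * b₂) := by
        refine sw_congr fun a₁ r => ?_
        rw [sw_assoc] <;> fun_prop
    _ = sw x fun a₁ r => sw r fun m b₂ => epsR m ⊗ₜ[ℂ] (𝓢 a₁ * b₂) := by
        refine sw_congr fun a₁ r => sw_congr fun m b₂ => ?_
        rw [← sw_antipode_mul, Lin.map_sw (F := fun z : W => z ⊗ₜ[ℂ] (𝓢 a₁ * b₂)) (by fun_prop)]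
    _ = sw x fun a₁ r => sw (1 : W) fun p q => p ⊗ₜ[ℂ] (𝓢 a₁ * (r * q)) := by
        refine sw_congr fun a₁ r => ?_
        rw [sw_epsR_left r (fun m b => m ⊗ₜ[ℂ] (𝓢 a₁ * b))] <;> fun_prop
    _ = sw (1 : W) fun p q => p ⊗ₜ[ℂ] (epsR x * q) := by
        rw [sw_comm]
        refine sw_congr fun p q => ?_
        rw [← sw_antipode_mul, sw_mul_right, Lin.map_sw (F := fun z : W => p ⊗ₜ[ℂ] z) (by fun_prop)]
        simp only [mul_assoc]
    _ = comul (R := ℂ) (epsR x) := by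
        rw [(isRightBase_epsR x).comul_mul_left, ← sw_tmul (1 : W), sw_mul_left]
        simp only [Algebra.TensorProduct.tmul_mul_tmul, one_mul]

/-- The antipode is anticomultiplicative. -/
theorem comul_antipode (x : W) : comul (R := ℂ) (𝓢 x : W) = flipAntipode x := by
  -- `Δ ∘ S` and `flipAntipode` are both quasi-inverses of `Δ` under convolution, so the usual
  -- uniqueness argument for inverses applies: the first is traded for the second through
  -- `comul_epsL` and `comul_epsR`.
  calc comul (R := ℂ) (𝓢 x : W)
      = sw x fun a b => comul (R := ℂ) (𝓢 a : W) * comul (R := ℂ) (epsL b) := by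
        rw [← sw_antipode_mul_epsL, Lin.map_sw (F := fun z : W => comul (R := ℂ) z) (by fun_prop)]
        simp only [WeakHopfAlgebra.comul_mul]
    _ = sw x fun a b => sw b fun c d =>
          comul (R := ℂ) (𝓢 a : W) * comul (R := ℂ) c * flipAntipode d := by
        refine sw_congr fun a b => ?_
        rw [comul_epsL, sw_mul_left]
        simp only [mul_assoc]
    _ = sw x fun m d => comul (R := ℂ) (epsR m) * flipAntipode d := by
        rw [← sw_assoc]
        · refine sw_congr fun m d => ?_
          rw [← sw_antipode_mul m, Lin.map_sw (F := fun z : W => comul (R := ℂ) z) (by fun_prop),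
            sw_mul_right]
          simp only [WeakHopfAlgebra.comul_mul]
        all_goals fun_prop
    _ = sw x fun a r => flipAntipode a * sw r fun b d => comul (R := ℂ) b * flipAntipode d := by
        simp only [comul_epsR, sw_mul_right, sw_mul_left, mul_assoc]
        rw [sw_assoc] <;> fun_prop
    _ = sw x fun a r => sw a fun a₁ a₂ => sw r fun k d => sw k fun b m =>
          (𝓢 a₂ * (b * 𝓢 d)) ⊗ₜ[ℂ] (𝓢 a₁ * epsL m) := by
        refine sw_congr fun a r => ?_
        rw [sw_comul_mul_flipAntipode, flipAntipode, sw_mul_right]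
        simp only [sw_mul_left, Algebra.TensorProduct.tmul_mul_tmul]
    _ = sw x fun a₁ r => sw r fun a₂ s => sw s fun k d => sw k fun b m =>
          (𝓢 a₂ * (b * 𝓢 d)) ⊗ₜ[ℂ] (𝓢 a₁ * epsL m) := by
        rw [sw_assoc x (fun a₁ a₂ s => sw s fun k d => sw k fun b m =>
          (𝓢 a₂ * (b * 𝓢 d)) ⊗ₜ[ℂ] (𝓢 a₁ * epsL m))] <;> fun_prop
    _ = sw x fun a₁ r => sw r fun a₂ s => sw s fun b t => sw t fun m d =>
          (𝓢 a₂ * (b * 𝓢 d)) ⊗ₜ[ℂ] (𝓢 a₁ * epsL m) := by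
        refine sw_congr fun a₁ r => sw_congr fun a₂ s => ?_
        rw [sw_assoc] <;> fun_prop
    _ = sw x fun a₁ r => sw r fun u t => sw t fun m d =>
          (epsR u * 𝓢 d) ⊗ₜ[ℂ] (𝓢 a₁ * epsL m) := by
        refine sw_congr fun a₁ r => ?_
        rw [← sw_assoc r (fun a₂ b t => sw t fun m d =>
          (𝓢 a₂ * (b * 𝓢 d)) ⊗ₜ[ℂ] (𝓢 a₁ * epsL m))]
        · refine sw_congr fun u t => ?_
          rw [sw_comm]
          refine sw_congr fun m d => ?_
          rw [← sw_antipode_mul u, sw_mul_right,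
            Lin.map_sw (F := fun z : W => z ⊗ₜ[ℂ] (𝓢 a₁ * epsL m)) (by fun_prop)]
          simp only [mul_assoc]
        all_goals fun_prop
    -- Exchanging `ε_R` and `ε_L` brings each next to the antipode that absorbs it.
    _ = sw x fun a₁ r => sw r fun u t => sw t fun m d =>
          (epsR m * 𝓢 d) ⊗ₜ[ℂ] (𝓢 a₁ * epsL u) := by
        refine sw_congr fun a₁ r => ?_
        rw [← sw_assoc, ← sw_assoc]
        · refine sw_congr fun v d => ?_
          rw [sw_epsR_epsL v (fun p q => (p * 𝓢 d) ⊗ₜ[ℂ] (𝓢 a₁ * q))] <;> fun_prop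
        all_goals fun_prop
    _ = sw x fun a₁ r => sw r fun u t => (𝓢 t : W) ⊗ₜ[ℂ] (𝓢 a₁ * epsL u) := by
        refine sw_congr fun a₁ r => sw_congr fun u t => ?_
        rw [← sw_epsR_mul_antipode t,
          Lin.map_sw (F := fun z : W => z ⊗ₜ[ℂ] (𝓢 a₁ * epsL u)) (by fun_prop)]
    _ = flipAntipode x := by
        rw [← sw_assoc]
        · refine sw_congr fun w t => ?_
          rw [← sw_antipode_mul_epsL w, Lin.map_sw (F := fun z : W => (𝓢 t : W) ⊗ₜ[ℂ] z)
            (by fun_prop)]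
        all_goals fun_prop

theorem sw_antipode (x : W) (f : W → W → M) (h₁ : ∀ b, Lin fun a => f a b)
    (h₂ : ∀ a, Lin fun b => f a b) : sw (𝓢 x : W) f = sw x fun a b => f (𝓢 b) (𝓢 a) := by
  rw [sw_eq_bil _ f h₁ h₂, comul_antipode, flipAntipode,
    Lin.map_sw (F := fun t => bil f h₁ h₂ t) (by fun_prop)]
  rfl

/-! ### The antipode on the counital subalgebras -/

theorem IsLeftBase.epsL_eq {a : W} (ha : IsLeftBase a) : epsL a = a := by
  simpa [epsL_one] using ha.epsL_mul 1

theorem IsRightBase.epsR_eq {b : W} (hb : IsRightBase b) : epsR b = b := by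
  simpa [epsR_one] using hb.epsR_mul 1

theorem isRightBase_one : IsRightBase (1 : W) := by simpa [epsR_one] using isRightBase_epsR (1 : W)

theorem IsRightBase.epsL_eq {b : W} (hb : IsRightBase b) : epsL b = 𝓢 b := by
  rw [← sw_mul_antipode, ← mul_one b, hb.sw_mul]
  · simp only [antipode_mul, ← mul_assoc]
    rw [← sw_mul_right, sw_mul_antipode, epsL_one, one_mul, ← antipode_mul, mul_one]
  all_goals fun_prop

theorem IsLeftBase.epsR_eq {a : W} (ha : IsLeftBase a) : epsR a = 𝓢 a := by
  rw [← sw_antipode_mul, ← one_mul a, ha.sw_mul']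
  · simp only [antipode_mul, mul_assoc]
    rw [← sw_mul_left, sw_antipode_mul, epsR_one, mul_one, ← antipode_mul, one_mul]
  all_goals fun_prop

theorem antipode_one : (𝓢 (1 : W) : W) = 1 := isRightBase_one.epsL_eq.symm.trans epsL_one

theorem IsRightBase.antipode {b : W} (hb : IsRightBase b) : IsLeftBase (𝓢 b : W) :=
  hb.epsL_eq ▸ isLeftBase_epsL b

theorem IsLeftBase.antipode {a : W} (ha : IsLeftBase a) : IsRightBase (𝓢 a : W) :=
  ha.epsR_eq ▸ isRightBase_epsR a

theorem IsLeftBase.commute {a b : W} (ha : IsLeftBase a) (hb : IsRightBase b) : a * b = b * a := by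
  rw [← ha.epsL_eq, ← hb.epsR_eq, epsL_mul_epsR]

/-- Because `Δ(1) = ∑ ε_R(1⁽¹⁾) ⊗ ε_L(1⁽²⁾)`, the legs of `Δ(1)` may be assumed to lie in the right
and the left counital subalgebra. -/
theorem sw_one_congr {f g : W → W → M} (hf₁ : ∀ b, Lin fun a => f a b)
    (hf₂ : ∀ a, Lin fun b => f a b) (hg₁ : ∀ b, Lin fun a => g a b) (hg₂ : ∀ a, Lin fun b => g a b)
    (h : ∀ b a, IsRightBase b → IsLeftBase a → f b a = g b a) : sw (1 : W) f = sw (1 : W) g := by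
  have key : ∀ f : W → W → M, (∀ b, Lin fun a => f a b) → (∀ a, Lin fun b => f a b) →
      sw (1 : W) f = sw (1 : W) fun p q => f (epsR p) (epsL q) := fun f h₁ h₂ => by
    rw [sw_epsL_right 1 (fun p q => f (epsR p) q) (by fun_prop) (by fun_prop)]
    simp only [mul_one]
    rw [sw_epsR_left 1 f h₁ h₂]
    simp only [one_mul]
  rw [key f hf₁ hf₂, key g hg₁ hg₂]
  exact sw_congr fun a b => h _ _ (isRightBase_epsR a) (isLeftBase_epsL b)

theorem sw_one_antipode (f : W → W → M) (h₁ : ∀ b, Lin fun a => f a b)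
    (h₂ : ∀ a, Lin fun b => f a b) :
    (sw (1 : W) fun a b => f (𝓢 b) (𝓢 a)) = sw (1 : W) f := by
  rw [← sw_antipode (1 : W) f h₁ h₂, antipode_one]

theorem epsR_antipode (x : W) : epsR (𝓢 x) = 𝓢 (epsL x) := by
  rw [← sw_antipode_mul, sw_antipode, ← sw_mul_antipode x,
    Lin.map_sw (F := fun z : W => (𝓢 z : W)) (by fun_prop)]
  · simp only [antipode_mul]
  all_goals fun_prop

/-- Counterpart of `sw_epsL_right` with `ε_L` on the other leg. The antipode appears because `S`
agrees with `ε_L` on the right counital subalgebra, where `1⁽¹⁾` lives. -/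
theorem sw_epsL_left (x : W) (f : W → W → M) (h₁ : ∀ b, Lin fun a => f a b)
    (h₂ : ∀ a, Lin fun b => f a b) :
    (sw x fun a b => f (epsL a) b) = sw (1 : W) fun p q => f (𝓢 p) (q * x) := by
  symm
  calc (sw (1 : W) fun p q => f (𝓢 p) (q * x))
      = sw (1 : W) fun p q => sw q fun c d => sw x fun a b => ε (c * a) • f (𝓢 p) (d * b) := by
        refine sw_congr fun p q => ?_
        rw [← sw_counit_left (q * x) (h₂ _), sw_mul] <;> fun_prop
    _ = sw (1 : W) fun p q => sw (1 : W) fun c d => sw x fun a b =>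
          ε (q * (c * a)) • f (𝓢 p) (d * b) := by
        rw [sw_one_assoc (fun p c d => sw x fun a b => ε (c * a) • f (𝓢 p) (d * b))]
        · simp only [mul_assoc]
        all_goals fun_prop
    _ = sw (1 : W) fun p q => sw x fun a b => ε (q * a) • f (𝓢 p) b := by
        refine sw_congr fun p q => ?_
        nth_rw 2 [← one_mul x]
        rw [sw_mul] <;> fun_prop
    _ = sw (1 : W) fun p q => sw x fun a b => ε (q * a) • f (epsL p) b := by
        refine sw_one_congr ?_ ?_ ?_ ?_ fun b a hb ha => ?_
        · fun_prop
        · fun_prop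
        · fun_prop
        · fun_prop
        · rw [hb.epsL_eq]
    _ = sw x fun a b => f (epsL a) b := by
        rw [sw_comm]
        refine sw_congr fun a b => ?_
        calc (sw (1 : W) fun p q => ε (q * a) • f (epsL p) b)
            = sw (1 : W) fun p q => sw (1 : W) fun c d => (ε (c * p) * ε (q * a)) • f d b := by
              refine sw_congr fun p q => ?_
              rw [epsL_eq_sw, (h₁ b).map_sw, Lin.map_sw (F := fun z : M => ε (q * a) • z)
                (by fun_prop)]
              refine sw_congr fun c d => ?_
              rw [(h₁ b).map_smul, smul_smul, mul_comm]
          _ = sw (1 : W) fun c d => ε (c * a) • f d b := by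
              rw [sw_comm]
              refine sw_congr fun c d => ?_
              rw [← Lin.map_sw (F := fun z : ℂ => z • f d b) (by fun_prop), sw_counit_mul, mul_one]
          _ = f (epsL a) b := by
              rw [epsL_eq_sw, (h₁ b).map_sw]
              exact sw_congr fun c d => ((h₁ b).map_smul _ _).symm

theorem sw_epsR_right (x : W) (f : W → W → M) (h₁ : ∀ b, Lin fun a => f a b)
    (h₂ : ∀ a, Lin fun b => f a b) :
    (sw x fun a b => f a (epsR b)) = sw (1 : W) fun p q => f (x * p) (𝓢 q) := by
  symm
  calc (sw (1 : W) fun p q => f (x * p) (𝓢 q))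
      = sw (1 : W) fun p q => sw p fun c d => sw x fun a b => ε (b * d) • f (a * c) (𝓢 q) := by
        refine sw_congr fun p q => ?_
        rw [← sw_counit_right (x * p) (h₁ _), sw_mul, sw_comm] <;> fun_prop
    _ = sw (1 : W) fun c e => sw e fun d q => sw x fun a b => ε (b * d) • f (a * c) (𝓢 q) := by
        rw [sw_assoc (1 : W) (fun c d q => sw x fun a b => ε (b * d) • f (a * c) (𝓢 q))] <;>
          fun_prop
    _ = sw (1 : W) fun p q => sw (1 : W) fun c d => sw x fun a b =>
          ε (b * q * c) • f (a * p) (𝓢 d) := by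
        rw [sw_one_assoc (fun c d q => sw x fun a b => ε (b * d) • f (a * c) (𝓢 q))]
        · simp only [mul_assoc]
        all_goals fun_prop
    _ = sw (1 : W) fun c d => sw x fun a b => ε (b * c) • f a (𝓢 d) := by
        rw [sw_comm]
        refine sw_congr fun c d => ?_
        nth_rw 2 [← mul_one x]
        rw [sw_mul, sw_comm] <;> fun_prop
    _ = sw (1 : W) fun c d => sw x fun a b => ε (b * c) • f a (epsR d) := by
        refine sw_one_congr ?_ ?_ ?_ ?_ fun b a hb ha => ?_
        · fun_prop
        · fun_prop
        · fun_prop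
        · fun_prop
        · rw [ha.epsR_eq]
    _ = sw x fun a b => f a (epsR b) := by
        rw [sw_comm]
        refine sw_congr fun a b => ?_
        calc (sw (1 : W) fun c d => ε (b * c) • f a (epsR d))
            = sw (1 : W) fun c d => sw (1 : W) fun p q => (ε (b * c) * ε (d * q)) • f a p := by
              refine sw_congr fun p q => ?_
              rw [epsR_eq_sw, (h₂ a).map_sw, Lin.map_sw (F := fun z : M => ε (b * p) • z)
                (by fun_prop)]
              refine sw_congr fun c d => ?_
              rw [(h₂ a).map_smul, smul_smul]
          _ = sw (1 : W) fun p q => ε (b * q) • f a p := by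
              rw [sw_comm]
              refine sw_congr fun c d => ?_
              rw [← Lin.map_sw (F := fun z : ℂ => z • f a c) (by fun_prop), sw_counit_mul, mul_one]
          _ = f a (epsR b) := by
              rw [epsR_eq_sw, (h₂ a).map_sw]
              exact sw_congr fun c d => ((h₂ a).map_smul _ _).symm

/-- `∑ x⁽²⁾S(x⁽¹⁾) ⊗ x⁽³⁾ = ∑ 1⁽¹⁾ ⊗ 1⁽²⁾x` if `S² = id`. -/
theorem sw_mul_antipode_flip (hS : ∀ x : W, 𝓢 (𝓢 x) = x) (x : W) (f : W → W → M)
    (h₁ : ∀ b, Lin fun a => f a b) (h₂ : ∀ a, Lin fun b => f a b) :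
    (sw x fun a b => sw a fun c d => f (d * 𝓢 c) b) = sw (1 : W) fun p q => f p (q * x) := by
  have : ∀ a b, (sw a fun c d => f (d * 𝓢 c) b) = f (𝓢 (epsL a)) b := fun a b => by
    rw [← sw_mul_antipode a, Lin.map_sw (F := fun z : W => f (𝓢 z) b) (by fun_prop)]
    simp only [antipode_mul, hS]
  simp only [this]
  rw [sw_epsL_left x (fun a b => f (𝓢 a) b) (by fun_prop) (by fun_prop)]
  simp only [hS]

/-- `∑ x⁽¹⁾ ⊗ S(x⁽³⁾)x⁽²⁾ = ∑ x1⁽¹⁾ ⊗ 1⁽²⁾` if `S² = id`. -/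
theorem sw_antipode_mul_flip (hS : ∀ x : W, 𝓢 (𝓢 x) = x) (x : W) (f : W → W → M)
    (h₁ : ∀ b, Lin fun a => f a b) (h₂ : ∀ a, Lin fun b => f a b) :
    (sw x fun a b => sw b fun c d => f a (𝓢 d * c)) = sw (1 : W) fun p q => f (x * p) q := by
  have : ∀ a b, (sw b fun c d => f a (𝓢 d * c)) = f a (𝓢 (epsR b)) := fun a b => by
    rw [← sw_antipode_mul b, Lin.map_sw (F := fun z : W => f a (𝓢 z)) (by fun_prop)]
    simp only [antipode_mul, hS]
  simp only [this]
  rw [sw_epsR_right x (fun a b => f a (𝓢 b)) (by fun_prop) (by fun_prop)]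
  simp only [hS]

end Antipode

/-! ### Cocommutative Haar integrals, `S² = id` and the regular trace -/

section Haar

variable {W : Type*} [Ring W] [Algebra ℂ W] [WeakHopfAlgebra W]
variable {M : Type*} [AddCommGroup M] [Module ℂ M]

local notation "ε" => counit (R := ℂ)
local notation "𝓢" => WeakHopfAlgebra.antipode

/-- Write `S(a) = ∑ S(a⁽¹⁾)ε_L(a⁽²⁾)` and replace `ε_L(a⁽²⁾)h` by `a⁽²⁾h`. Its coproduct brings
`S(a⁽¹⁾)a⁽²⁾` together into `ε_R`, and the resulting `Δ(1)` is absorbed by `Δ(h)`. -/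
theorem IsHaarIntegral.sw_mul_right {h : W} (hh : IsHaarIntegral h) (a : W) (f : W → W → M)
    (h₁ : ∀ b, Lin fun a => f a b) (h₂ : ∀ a, Lin fun b => f a b) :
    (sw h fun p q => f p (a * q)) = sw h fun p q => f (𝓢 a * p) q := by
  symm
  calc (sw h fun p q => f (𝓢 a * p) q)
      = sw a fun b c => sw h fun p q => f (𝓢 b * (epsL c * p)) q := by
        rw [← sw_antipode_mul_epsL a,
          Lin.map_sw (F := fun z : W => sw h fun p q => f (z * p) q) (by fun_prop)]
        simp only [mul_assoc]
    _ = sw a fun b c => sw c fun d e => sw h fun p q => f (𝓢 b * d * p) (e * q) := by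
        refine sw_congr fun b c => ?_
        rw [← (isLeftBase_epsL c).sw_mul h (fun p q => f (𝓢 b * p) q), ← hh.left_integral, sw_mul]
        · simp only [mul_assoc]
        all_goals fun_prop
    _ = sw a fun m e => sw h fun p q => f (epsR m * p) (e * q) := by
        rw [← sw_assoc a (fun b d e => sw h fun p q => f (𝓢 b * d * p) (e * q))]
        · refine sw_congr fun m e => ?_
          rw [← sw_antipode_mul m,
            Lin.map_sw (F := fun z : W => sw h fun p q => f (z * p) (e * q)) (by fun_prop)]
        all_goals fun_prop
    _ = sw (1 : W) fun b c => sw h fun p q => f (b * p) (a * (c * q)) := by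
        rw [sw_epsR_left a (fun b e => sw h fun p q => f (b * p) (e * q))]
        · simp only [mul_assoc]
        all_goals fun_prop
    _ = sw h fun p q => f p (a * q) := by
        conv_rhs => rw [← one_mul h]
        rw [sw_mul 1 h] <;> fun_prop

theorem IsHaarIntegral.mul_self {h : W} (hh : IsHaarIntegral h) : h * h = h := by
  rw [hh.left_integral, hh.left_normalized, one_mul]

theorem IsCocommutativeElement.sw_swap {C : Type*} [Ring C] [Algebra ℂ C] [Coalgebra ℂ C] {h : C}
    (hc : IsCocommutativeElement h) (f : C → C → M) (h₁ : ∀ b, Lin fun a => f a b)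
    (h₂ : ∀ a, Lin fun b => f a b) : (sw h fun a b => f b a) = sw h f := by
  rw [sw_eq_bil h f h₁ h₂, ← hc]
  exact sw_linearMap h (bil f h₁ h₂ ∘ₗ (TensorProduct.comm ℂ C C).toLinearMap)

theorem IsCocommutativeElement.sw_cycle {C : Type*} [Ring C] [Algebra ℂ C] [Coalgebra ℂ C] {h : C}
    (hc : IsCocommutativeElement h) (f : C → C → C → M) (h₁ : ∀ b c, Lin fun a => f a b c)
    (h₂ : ∀ a c, Lin fun b => f a b c) (h₃ : ∀ a b, Lin fun c => f a b c) :
    (sw h fun a b => sw b fun c d => f c d a) = sw h fun a b => sw b fun c d => f a c d := by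
  rw [← sw_assoc h f h₁ h₂ h₃]
  exact hc.sw_swap (fun a b => sw a fun c d => f c d b) (by fun_prop) (by fun_prop)

variable [FiniteDimensional ℂ W]

/-- In coordinates the trace is `∑ᵢ bᵢ*(S(S(bᵢ)h⁽¹⁾))`. The exchange rule moves `bᵢ` to the second
leg, where the sum over `i` rebuilds `S(h⁽¹⁾)`. What remains is `∑ S(h⁽¹⁾)h⁽²⁾ = ε_R(h) = 1`. -/
theorem IsHaarIntegral.sw_trace {h : W} (hh : IsHaarIntegral h) :
    (sw h fun p q => LinearMap.trace ℂ W (LinearMap.mulLeft ℂ (𝓢 p) ∘ₗ 𝓢 ∘ₗ 𝓢) • q) = 1 := by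
  let b := Module.finBasis ℂ W
  have htr : ∀ f : W →ₗ[ℂ] W, LinearMap.trace ℂ W f = ∑ i, b.coord i (f (b i)) := fun f => by
    rw [LinearMap.trace_eq_matrix_trace ℂ b]
    exact Finset.sum_congr rfl fun i _ => LinearMap.toMatrix_apply _ _ _ _ _
  have hsum : ∀ x : W, ∑ i, b.coord i x • b i = x := b.sum_repr
  calc (sw h fun p q => LinearMap.trace ℂ W (LinearMap.mulLeft ℂ (𝓢 p) ∘ₗ 𝓢 ∘ₗ 𝓢) • q)
      = sw h fun p q => ∑ i, b.coord i (𝓢 (𝓢 (b i) * p)) • q := by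
        refine sw_congr fun p q => ?_
        rw [htr, Finset.sum_smul]
        simp [antipode_mul]
    _ = ∑ i, sw h fun p q => b.coord i (𝓢 (𝓢 (b i) * p)) • q := by
        unfold sw; rw [Finset.sum_comm]
    _ = ∑ i, sw h fun p q => b.coord i (𝓢 p) • (b i * q) := by
        refine Finset.sum_congr rfl fun i _ => ?_
        rw [hh.sw_mul_right (b i) (fun p q => b.coord i (𝓢 p) • q)] <;> fun_prop
    _ = sw h fun p q => ∑ i, b.coord i (𝓢 p) • (b i * q) := by
        unfold sw; rw [Finset.sum_comm]
    _ = sw h fun p q => 𝓢 p * q := by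
        refine sw_congr fun p q => ?_
        simp only [← smul_mul_assoc, ← Finset.sum_mul, hsum]
    _ = 1 := by rw [sw_antipode_mul, hh.right_normalized]

/-- The antipode is involutive if the Haar integral is cocommutative. -/
theorem IsHaarIntegral.antipode_antipode {h : W} (hh : IsHaarIntegral h)
    (hc : IsCocommutativeElement h) (x : W) : 𝓢 (𝓢 x) = x := by
  let ω : W →ₗ[ℂ] ℂ := LinearMap.trace ℂ W ∘ₗ
    LinearMap.lcomp ℂ W (𝓢 ∘ₗ 𝓢 : W →ₗ[ℂ] W) ∘ₗ LinearMap.mul ℂ W ∘ₗ 𝓢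
  have hω : (sw h fun p q => ω p • q) = 1 := hh.sw_trace
  -- The element `x` is carried to the first leg as `S(x)`; after a swap of the legs the exchange
  -- rule applies again and returns it as `S(S(x))`.
  have key : (sw h fun p q => ω p • (x * q)) = sw h fun p q => ω p • (𝓢 (𝓢 x) * q) := by
    rw [hh.sw_mul_right x (fun p q => ω p • q) (by fun_prop) (by fun_prop),
      ← hc.sw_swap (fun p q => ω (𝓢 x * p) • q) (by fun_prop) (by fun_prop),
      hh.sw_mul_right (𝓢 x) (fun p q => ω q • p) (by fun_prop) (by fun_prop),
      ← hc.sw_swap (fun p q => ω q • (𝓢 (𝓢 x) * p)) (by fun_prop) (by fun_prop)]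
  simpa only [← mul_smul_comm, ← WeakHopf.sw_mul_left, hω, mul_one] using key.symm

/-- The trace of the left regular representation. -/
def regTrace (W : Type*) [Ring W] [Algebra ℂ W] : W →ₗ[ℂ] ℂ := LinearMap.trace ℂ W ∘ₗ LinearMap.mul ℂ W

theorem regTrace_mul_comm (x y : W) : regTrace W (x * y) = regTrace W (y * x) := by
  have : ∀ a b : W, LinearMap.mul ℂ W (a * b) = LinearMap.mul ℂ W a * LinearMap.mul ℂ W b :=
    fun a b => LinearMap.ext fun z => mul_assoc a b z
  simp only [regTrace, LinearMap.comp_apply, this]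
  exact LinearMap.trace_mul_comm ℂ _ _

/-- The data on which the argument rests: a cocommutative Haar integral `h`. -/
structure IsCocommutativeHaar (h : W) : Prop extends IsHaarIntegral h where
  cocomm : IsCocommutativeElement h

namespace IsCocommutativeHaar

variable {h : W} (hh : IsCocommutativeHaar h)
include hh

theorem antipode_antipode (x : W) : 𝓢 (𝓢 x) = x :=
  hh.toIsHaarIntegral.antipode_antipode hh.cocomm x

/-- With `S² = id` the trace identity says `∑ τ(S(h⁽¹⁾)) h⁽²⁾ = 1`, and the exchange rule inserts
`x`. Thus `S(h⁽¹⁾)` and `h⁽²⁾` behave as dual bases for the form `τ(xy)`, which is therefore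
nondegenerate. -/
theorem sw_regTrace (x : W) : (sw h fun p q => regTrace W (𝓢 p * x) • q) = x := by
  have e : (sw h fun p q => regTrace W (𝓢 p) • q) = 1 := by
    rw [← hh.sw_trace]
    refine sw_congr fun p q => ?_
    have : LinearMap.mulLeft ℂ (𝓢 p : W) ∘ₗ 𝓢 ∘ₗ 𝓢 = LinearMap.mul ℂ W (𝓢 p) :=
      LinearMap.ext fun y => by simp [hh.antipode_antipode]
    rw [this]; rfl
  calc (sw h fun p q => regTrace W (𝓢 p * x) • q)
      = sw h fun p q => regTrace W (𝓢 (𝓢 x * p)) • q := by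
        simp only [antipode_mul, hh.antipode_antipode]
    _ = sw h fun p q => regTrace W (𝓢 p) • (x * q) := by
        rw [hh.sw_mul_right x (fun p q => regTrace W (𝓢 p) • q)] <;> fun_prop
    _ = x := by simp only [← mul_smul_comm, ← WeakHopf.sw_mul_left, e, mul_one]

theorem apply_eq_regTrace (χ : W →ₗ[ℂ] ℂ) (x : W) :
    χ x = regTrace W ((sw h fun p q => χ p • 𝓢 q) * x) := by
  conv_lhs => rw [← hh.sw_regTrace x, Lin.map_sw (F := fun z => χ z) (by fun_prop)]
  rw [Lin.map_sw (F := fun z => regTrace W (z * x)) (by fun_prop),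
    ← hh.cocomm.sw_swap (fun p q => regTrace W ((χ p • 𝓢 q) * x)) (by fun_prop) (by fun_prop)]
  exact sw_congr fun p q => by simp [mul_comm]

/-- The functional `τ ∘ S` is represented with respect to `τ` by `∑ τ(S(h⁽¹⁾)) S(h⁽²⁾) = S(1) = 1`.
-/
theorem regTrace_antipode (x : W) : regTrace W (𝓢 x) = regTrace W x := by
  have e : (sw h fun p q => (regTrace W ∘ₗ 𝓢) p • (𝓢 q : W)) = 1 := by
    have := hh.sw_regTrace 1
    simp only [mul_one] at this
    calc _ = 𝓢 (sw h fun p q => regTrace W (𝓢 p) • q) := by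
          rw [Lin.map_sw (F := fun z : W => (𝓢 z : W)) (by fun_prop)]
          simp
      _ = 1 := by rw [this, antipode_one]
  have := hh.apply_eq_regTrace (regTrace W ∘ₗ 𝓢) x
  rwa [e, one_mul] at this

theorem regTrace_epsL (x : W) : regTrace W (epsL x) = regTrace W (epsR x) := by
  rw [← sw_mul_antipode, ← sw_antipode_mul, Lin.map_sw (F := fun z => regTrace W z) (by fun_prop),
    Lin.map_sw (F := fun z => regTrace W z) (by fun_prop)]
  refine sw_congr fun a b => ?_
  rw [regTrace_mul_comm, ← hh.regTrace_antipode (𝓢 a * b), antipode_mul, hh.antipode_antipode]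

end IsCocommutativeHaar

end Haar

/-! ### Haar integrals of the dual -/

section DualHaar

variable {W : Type*} [Ring W] [Algebra ℂ W] [WeakHopfAlgebra W] [FiniteDimensional ℂ W]
variable {M : Type*} [AddCommGroup M] [Module ℂ M]

local notation "ε" => counit (R := ℂ)
local notation "𝓢" => WeakHopfAlgebra.antipode

theorem dual_one_apply (x : W) : (1 : DualAlg W) x = ε x := rfl

theorem dual_mul_apply (χ ψ : DualAlg W) (x : W) : (χ * ψ) x = sw x fun a b => χ a * ψ b :=
  (ℛ ℂ x).convMul_apply χ ψ

theorem pair₂_mul (s t : DualAlg W ⊗[ℂ] DualAlg W) (x y : W) :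
    pair₂ W (s * t) (x ⊗ₜ y) =
      sw x fun a b => sw y fun c d => pair₂ W s (a ⊗ₜ c) * pair₂ W t (b ⊗ₜ d) := by
  have hz : ∀ t : DualAlg W ⊗[ℂ] DualAlg W, 0 * t = 0 := fun t => zero_mul t
  have hz' : ∀ t : DualAlg W ⊗[ℂ] DualAlg W, t * 0 = 0 := fun t => mul_zero t
  have ha : ∀ s s' t : DualAlg W ⊗[ℂ] DualAlg W, (s + s') * t = s * t + s' * t :=
    fun s s' t => NonUnitalNonAssocSemiring.right_distrib s s' t
  have ha' : ∀ s t t' : DualAlg W ⊗[ℂ] DualAlg W, s * (t + t') = s * t + s * t' :=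
    fun s t t' => NonUnitalNonAssocSemiring.left_distrib s t t'
  induction s with
  | zero => simp [sw, hz]
  | add s s' hs hs' =>
    rw [ha, map_add, LinearMap.add_apply, hs, hs']
    simp [sw, add_mul, Finset.sum_add_distrib]
  | tmul φ ψ =>
    induction t with
    | zero => simp [sw, hz']
    | add t t' ht ht' =>
      rw [ha', map_add, LinearMap.add_apply, ht, ht']
      simp [sw, mul_add, Finset.sum_add_distrib]
    | tmul φ' ψ' =>
      rw [Algebra.TensorProduct.tmul_mul_tmul]
      simp only [pair₂_tmul, dual_mul_apply, sw_mul_right, sw_mul_left]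
      rw [sw_comm]
      exact sw_congr fun a b => sw_congr fun c d => by ring

theorem dual_epsL_apply (χ : DualAlg W) (x : W) : (epsL χ : DualAlg W) x = χ (epsL x) := by
  have e : (epsL χ : DualAlg W) x =
      pair₂ W (dualComul W (1 : DualAlg W) * (χ ⊗ₜ[ℂ] (1 : DualAlg W))) (1 ⊗ₜ x) :=
    lid_rTensor_dualCounit _ x
  rw [e, pair₂_mul, epsL_eq_sw, Lin.map_sw (F := fun z => χ z) (by fun_prop)]
  refine sw_congr fun a b => ?_
  simp only [pair₂_dualComul, pair₂_tmul, dual_one_apply, map_smul, smul_eq_mul]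
  rw [← sw_counit_right (x : W) (f := fun z => ε (a * z) * χ b) (by fun_prop)]
  exact sw_congr fun c d => by simp only [smul_eq_mul]; ring

theorem dual_epsR_apply (χ : DualAlg W) (x : W) : (epsR χ : DualAlg W) x = χ (epsR x) := by
  have e : (epsR χ : DualAlg W) x =
      pair₂ W (((1 : DualAlg W) ⊗ₜ[ℂ] χ) * dualComul W (1 : DualAlg W)) (x ⊗ₜ 1) :=
    rid_lTensor_dualCounit _ x
  rw [e, pair₂_mul, epsR_eq_sw, Lin.map_sw (F := fun z => χ z) (by fun_prop), sw_comm]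
  refine sw_congr fun a b => ?_
  simp only [pair₂_dualComul, pair₂_tmul, dual_one_apply, map_smul, smul_eq_mul]
  rw [← sw_counit_left (x : W) (f := fun z => ε (z * b) * χ a) (by fun_prop)]
  exact sw_congr fun c d => by simp only [smul_eq_mul]; ring

theorem eq_of_forall_dual {x y : W} (h : ∀ χ : DualAlg W, χ x = χ y) : x = y := by
  rw [← sub_eq_zero, ← Module.forall_dual_apply_eq_zero_iff ℂ]
  intro χ
  have := h (WithConv.toConv χ)
  rw [map_sub, sub_eq_zero]; exact this

section

variable {φ : DualAlg W} (hφ : IsHaarIntegral φ)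
include hφ

theorem dual_sw_left (x : W) : (sw x fun a b => φ b • a) = sw x fun a b => φ b • epsL a := by
  refine eq_of_forall_dual fun χ => ?_
  have := congrArg (fun ψ : DualAlg W => ψ x) (hφ.left_integral χ)
  simp only [dual_mul_apply, dual_epsL_apply] at this
  rw [Lin.map_sw (F := fun z => χ z) (by fun_prop), Lin.map_sw (F := fun z => χ z) (by fun_prop)]
  simpa [mul_comm] using this

theorem dual_sw_right (x : W) : (sw x fun a b => φ a • b) = sw x fun a b => φ a • epsR b := by
  refine eq_of_forall_dual fun χ => ?_
  have := congrArg (fun ψ : DualAlg W => ψ x) (hφ.right_integral χ)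
  simp only [dual_mul_apply, dual_epsR_apply] at this
  rw [Lin.map_sw (F := fun z => χ z) (by fun_prop), Lin.map_sw (F := fun z => χ z) (by fun_prop)]
  simpa using this

theorem dual_epsL (x : W) : φ (epsL x) = ε x := by
  rw [← dual_epsL_apply, hφ.left_normalized, dual_one_apply]

theorem dual_epsR (x : W) : φ (epsR x) = ε x := by
  rw [← dual_epsR_apply, hφ.right_normalized, dual_one_apply]

end

/-- Both sides are `∑ f(b⁽¹⁾, ε_L(b⁽²⁾))`: a right base element crosses `Δ(1)` at the cost of an
antipode. -/
theorem IsRightBase.sw_one_mul {b : W} (hb : IsRightBase b) (f : W → W → M)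
    (h₁ : ∀ b, Lin fun a => f a b) (h₂ : ∀ a, Lin fun b => f a b) :
    (sw (1 : W) fun p q => f (p * b) q) = sw (1 : W) fun p q => f p (q * 𝓢 b) := by
  rw [← sw_epsL_right b f h₁ h₂]
  conv_lhs => rw [← one_mul b, hb.sw_mul' 1 (fun p q => f p (epsL q)) (by fun_prop) (by fun_prop)]
  refine sw_one_congr ?_ ?_ ?_ ?_ fun p a hp ha => ?_
  · fun_prop
  · fun_prop
  · fun_prop
  · fun_prop
  · rw [ha.epsL_mul, hb.epsL_eq]

/-- The Haar integral of the dual is a multiple of the regular trace by a central element. -/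
theorem exists_central_of_isHaarIntegral {h : W} (hh : IsCocommutativeHaar h) {φ : DualAlg W}
    (hφ : IsHaarIntegral φ) :
    ∃ u v : W, u * v = 1 ∧ (∀ x, u * x = x * u) ∧ 𝓢 v = v ∧ (∀ x, φ x = regTrace W (v * x)) ∧
      ∀ f : W → W → ℂ, (∀ b, Lin fun a => f a b) → (∀ a, Lin fun b => f a b) →
        ∀ x, sw (x * u) f = sw x fun a b => f (a * u) b := by
  have hS := hh.antipode_antipode
  -- `v` is the density of `φ` with respect to the regular trace, read off from the dual bases.
  obtain ⟨v, hv⟩ : ∃ v : W, v = sw h fun p q => φ p • 𝓢 q := ⟨_, rfl⟩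
  have hφv : ∀ x, φ x = regTrace W (v * x) := fun x => hv ▸ hh.apply_eq_regTrace φ.ofConv x
  -- Right invariance of `φ` replaces `h⁽²⁾` by its image under `ε_R`. For `hvr`, cocommutativity of
  -- `h` and left invariance give `ε_L` instead, so `v` lies in both counital subalgebras.
  have hvl : IsLeftBase v := by
    have : v = 𝓢 (epsR (sw h fun p q => φ p • q)) := by
      rw [hv, Lin.map_sw (F := fun z : W => (𝓢 (epsR z) : W)) (by fun_prop)]
      calc (sw h fun p q => φ p • (𝓢 q : W)) = 𝓢 (sw h fun p q => φ p • q) := by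
            rw [Lin.map_sw (F := fun z : W => (𝓢 z : W)) (by fun_prop)]
            simp only [map_smul]
        _ = _ := by
            rw [dual_sw_right hφ, Lin.map_sw (F := fun z : W => (𝓢 z : W)) (by fun_prop)]
            refine sw_congr fun p q => congrArg _ ?_
            exact ((show Lin fun z : W => epsR z by fun_prop).map_smul _ _).symm
    rw [this]; exact (isRightBase_epsR _).antipode
  have hvr : IsRightBase v := by
    have : v = 𝓢 (epsL (sw h fun p q => φ q • p)) := by
      rw [hv, Lin.map_sw (F := fun z : W => (𝓢 (epsL z) : W)) (by fun_prop),
        ← hh.cocomm.sw_swap (fun p q => φ p • (𝓢 q : W)) (by fun_prop) (by fun_prop)]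
      calc (sw h fun p q => φ q • (𝓢 p : W)) = 𝓢 (sw h fun p q => φ q • p) := by
            rw [Lin.map_sw (F := fun z : W => (𝓢 z : W)) (by fun_prop)]
            simp only [map_smul]
        _ = _ := by
            rw [dual_sw_left hφ, Lin.map_sw (F := fun z : W => (𝓢 z : W)) (by fun_prop)]
            refine sw_congr fun p q => congrArg _ ?_
            exact ((show Lin fun z : W => epsL z by fun_prop).map_smul _ _).symm
    rw [this]; exact (isLeftBase_epsL _).antipode
  have hSv : 𝓢 v = v := by rw [← hvr.epsL_eq, hvl.epsL_eq]
  -- The inverse of `v`: sliding `v` across `Δ(1)` turns `τ` into `φ`, and `∑ φ(1⁽¹⁾) 1⁽²⁾ = 1` is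
  -- the normalization of `φ`.
  obtain ⟨w, hw⟩ : ∃ w : W, w = sw (1 : W) fun p q => regTrace W p • q := ⟨_, rfl⟩
  have hwl : IsLeftBase w := by
    have : w = epsL w := by
      rw [hw, Lin.map_sw (F := fun z : W => epsL z) (by fun_prop)]
      refine sw_one_congr ?_ ?_ ?_ ?_ fun b a hb ha => ?_
      · fun_prop
      · fun_prop
      · fun_prop
      · fun_prop
      · rw [(show Lin fun z : W => epsL z by fun_prop).map_smul, ha.epsL_eq]
    rw [this]; exact isLeftBase_epsL w
  have hwv : w * v = 1 := by
    calc w * v = sw (1 : W) fun p q => regTrace W p • (q * 𝓢 v) := by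
          rw [hw, sw_mul_right, hSv]; simp only [smul_mul_assoc]
      _ = sw (1 : W) fun p q => regTrace W (p * v) • q := by
          rw [hvr.sw_one_mul (fun p q => regTrace W p • q) (by fun_prop) (by fun_prop)]
      _ = sw (1 : W) fun p q => φ p • q := by simp only [regTrace_mul_comm _ v, hφv]
      _ = sw (1 : W) fun p q => φ (epsR p) • q := by
          rw [sw_epsR_left 1 (fun p q => φ p • q) (by fun_prop) (by fun_prop)]
          simp only [one_mul]
      _ = 1 := by
          simp only [dual_epsR hφ]
          exact sw_counit_left (1 : W) (f := fun z => z) (by fun_prop)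
  have hvw : v * w = 1 := by rw [← hwl.commute hvr, hwv]
  have hφw : ∀ x, φ (w * x) = regTrace W x := fun x => by rw [hφv, ← mul_assoc, hvw, one_mul]
  have hφw' : ∀ x, φ (x * w) = regTrace W x := fun x => by
    rw [hφv, ← mul_assoc, regTrace_mul_comm, ← mul_assoc, hwv, one_mul]
  have hL : ∀ x, epsL (w * x) = w * epsL x := hwl.epsL_mul
  have hR : ∀ x, epsR (x * w) = epsR x * w := fun x => by
    have := hvr.epsR_mul (x * w)
    rw [mul_assoc, hwv, mul_one] at this
    rw [this, mul_assoc, hvw, mul_one]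
  -- Since `ε = φ ∘ ε_L = φ ∘ ε_R` and `w` turns `φ` into `τ`, this is `τ ∘ ε_L = τ ∘ ε_R`. As `w`
  -- acts only on the first leg of a coproduct, applying the counit to that leg promotes the
  -- equality to centrality of `w`.
  have hε : ∀ x, ε (w * x) = ε (x * w) := fun x => by
    rw [← dual_epsL hφ, ← dual_epsR hφ, hL, hR, hφw, hφw', hh.regTrace_epsL]
  have hcw : ∀ x, w * x = x * w := fun x => by
    calc w * x = sw x fun a b => ε (w * a) • b := by
          rw [← sw_counit_left (w * x) (f := fun z => z) (by fun_prop), hwl.sw_mul] <;> fun_prop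
      _ = sw x fun a b => ε (a * w) • b := by simp only [hε]
      _ = x * w := by
          rw [← sw_counit_left (x * w) (f := fun z => z) (by fun_prop), hwl.sw_mul'] <;> fun_prop
  exact ⟨w, v, hwv, hcw, hSv, hφv, fun f h₁ h₂ x => hwl.sw_mul' x f h₁ h₂⟩

section

variable {h : W} (hh : IsCocommutativeHaar h) {φ : DualAlg W} (hφ : IsHaarIntegral φ)
include hh hφ

theorem dualHaar_mul_comm (x y : W) : φ (x * y) = φ (y * x) := by
  obtain ⟨u, v, huv, hu, -, hφv, -⟩ := exists_central_of_isHaarIntegral hh hφ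
  have hv : ∀ x, v * x = x * v := fun x => by
    calc v * x = v * (x * (u * v)) := by rw [huv, mul_one]
      _ = (v * u) * x * v := by rw [← mul_assoc x, ← hu x]; simp only [mul_assoc]
      _ = x * v := by rw [← hu v, huv, one_mul]
  rw [hφv, hφv, ← mul_assoc, regTrace_mul_comm, ← mul_assoc, ← hv, mul_assoc]

theorem dualHaar_antipode (x : W) : φ (𝓢 x) = φ x := by
  obtain ⟨u, v, huv, hu, hSv, hφv, -⟩ := exists_central_of_isHaarIntegral hh hφ
  rw [hφv, hφv]
  conv_lhs => rw [← hSv]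
  rw [← antipode_mul, hh.regTrace_antipode, regTrace_mul_comm]

theorem isCocommutativeElement_dualHaar : IsCocommutativeElement φ := by
  apply (pair₂ W).injective
  refine TensorProduct.ext' fun x y => ?_
  have key : ∀ t : DualAlg W ⊗[ℂ] DualAlg W,
      pair₂ W (TensorProduct.comm ℂ _ _ t) (x ⊗ₜ y) = pair₂ W t (y ⊗ₜ x) := by
    intro t
    induction t with
    | zero => simp
    | tmul a b => simp [pair₂_tmul, mul_comm]
    | add a b ha hb => simp [ha, hb]
  rw [key]
  exact (pair₂_dualComul φ y x).trans ((dualHaar_mul_comm hh hφ y x).trans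
    (pair₂_dualComul φ x y).symm)

omit hh in
theorem dualHaar_mul_self : φ * φ = φ := by
  rw [hφ.left_integral, hφ.left_normalized, one_mul]

end

end DualHaar

/-! ### Convolution algebras -/

section Convolution

variable {C A B : Type*} [AddCommGroup C] [Module ℂ C] [Coalgebra ℂ C] [Ring A] [Algebra ℂ A]
  [Ring B] [Algebra ℂ B]

theorem conv_mul_apply (X Y : WithConv (C →ₗ[ℂ] A)) (c : C) :
    (X * Y) c = sw c fun a b => X a * Y b :=
  (ℛ ℂ c).convMul_apply X Y

theorem sweedler_nil (c : C) : sweedler ([] : List (C →ₗ[ℂ] A)) c = counit (R := ℂ) c • 1 := by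
  simp [sweedler, Algebra.algebraMap_eq_smul_one]

theorem sweedler_cons (f : C →ₗ[ℂ] A) (l : List (C →ₗ[ℂ] A)) (c : C) :
    sweedler (f :: l) c = sw c fun a b => f a * sweedler l b := by
  rw [sweedler, LinearMap.comp_apply, LinearMap.comp_apply, ← sw_tmul c]
  simp only [sw, map_sum, TensorProduct.map_tmul, LinearMap.mul'_apply]

/-- The convolution product has the Sweedler sum built in, so words of letters become ordinary
products in a ring. -/
theorem toConv_sweedler (l : List (C →ₗ[ℂ] A)) :
    WithConv.toConv (sweedler l) = (l.map WithConv.toConv).prod := by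
  induction l with
  | nil => rfl
  | cons f l ih => rw [List.map_cons, List.prod_cons, ← ih]; rfl

theorem map_sweedler (F : A →ₐ[ℂ] B) (l : List (C →ₗ[ℂ] A)) (c : C) :
    F (sweedler l c) = sweedler (l.map fun f => F.toLinearMap ∘ₗ f) c := by
  induction l generalizing c with
  | nil => simp [sweedler_nil]
  | cons f l ih =>
    rw [sweedler_cons, List.map_cons, sweedler_cons, Lin.map_sw (F := fun z => F z) F.toLinearMap.isLinear]
    simp only [map_mul, ih]; rfl

variable (C) in
/-- The constant `O` in the convolution algebra of a coalgebra. -/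
def cst : A →ₗ[ℂ] WithConv (C →ₗ[ℂ] A) where
  toFun O := WithConv.toConv (LinearMap.toSpanSingleton ℂ A O ∘ₗ counit)
  map_add' O O' := by ext c; simp
  map_smul' r O := by ext c; simp [smul_comm r]

theorem cst_apply (O : A) (c : C) : cst C O c = counit (R := ℂ) c • O := rfl

theorem cst_mul_apply (O : A) (X : WithConv (C →ₗ[ℂ] A)) (c : C) : (cst C O * X) c = O * X c := by
  rw [conv_mul_apply, ← sw_counit_left c (f := fun z => O * X.ofConv z) (by fun_prop)]
  exact sw_congr fun a b => by rw [cst_apply, smul_mul_assoc]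

theorem mul_cst_apply (O : A) (X : WithConv (C →ₗ[ℂ] A)) (c : C) : (X * cst C O) c = X c * O := by
  rw [conv_mul_apply, ← sw_counit_right c (f := fun z => X.ofConv z * O) (by fun_prop)]
  exact sw_congr fun a b => by rw [cst_apply, mul_smul_comm]

theorem cst_mul (O O' : A) : cst C (O * O') = cst C O * cst C O' := by
  ext c; rw [cst_mul_apply, cst_apply, cst_apply, mul_smul_comm]

theorem cst_one : cst C (1 : A) = 1 := by
  ext c
  rw [cst_apply, LinearMap.convOne_apply, Algebra.algebraMap_eq_smul_one]

variable (C) in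
/-- `cst` as a homomorphism of algebras. -/
def cstHom : A →ₐ[ℂ] WithConv (C →ₗ[ℂ] A) :=
  AlgHom.ofLinearMap (cst C) cst_one cst_mul

end Convolution

/-! ### Translated functionals and evaluations in the convolution algebra of `Ŵ` -/

section Shift

variable {W : Type*} [Ring W] [Algebra ℂ W] [WeakHopfAlgebra W] [FiniteDimensional ℂ W]
variable {A M : Type*} [Ring A] [Algebra ℂ A] [AddCommGroup M] [Module ℂ M]

/-- The functional `χ(c ·)`. -/
def lshift : W →ₗ[ℂ] DualAlg W →ₗ[ℂ] DualAlg W :=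
  LinearMap.mk₂ ℂ (fun c χ => WithConv.toConv (χ.ofConv ∘ₗ LinearMap.mulLeft ℂ c))
    (fun _ _ _ => by ext; simp [add_mul]) (fun _ _ _ => by ext; simp)
    (fun _ _ _ => by ext; simp) (fun _ _ _ => by ext; simp)

/-- The functional `χ(· c)`. -/
def rshift : W →ₗ[ℂ] DualAlg W →ₗ[ℂ] DualAlg W :=
  LinearMap.mk₂ ℂ (fun c χ => WithConv.toConv (χ.ofConv ∘ₗ LinearMap.mulRight ℂ c))
    (fun _ _ _ => by ext; simp [mul_add]) (fun _ _ _ => by ext; simp)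
    (fun _ _ _ => by ext; simp) (fun _ _ _ => by ext; simp)

theorem lshift_apply (c x : W) (χ : DualAlg W) : lshift c χ x = χ (c * x) := rfl

theorem rshift_apply (c x : W) (χ : DualAlg W) : rshift c χ x = χ (x * c) := rfl

theorem sw_dual_apply (χ : DualAlg W) (x y : W) : (sw χ fun α β => α x * β y) = χ (x * y) :=
  (sw_linearMap χ ((LinearMap.applyₗ (R := ℂ) (M₂ := ℂ) (x ⊗ₜ[ℂ] y)) ∘ₗ
    (pair₂ W).toLinearMap)).trans (pair₂_dualComul χ x y)

theorem sw_dual_smul_left (χ : DualAlg W) (c : W) {f : DualAlg W → M} (hf : Lin f) :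
    (sw χ fun α β => α c • f β) = f (lshift c χ) := by
  have : lshift c χ = sw χ fun α β => α c • β := by
    ext x
    rw [lshift_apply, ← sw_dual_apply, sw, sw]
    simp
  rw [this, hf.map_sw]
  simp only [hf.map_smul]

theorem sw_dual_smul_right (χ : DualAlg W) (c : W) {f : DualAlg W → M} (hf : Lin f) :
    (sw χ fun α β => β c • f α) = f (rshift c χ) := by
  have : rshift c χ = sw χ fun α β => β c • α := by
    ext x
    rw [rshift_apply, ← sw_dual_apply, sw, sw]
    simp [mul_comm]
  rw [this, hf.map_sw]
  simp only [hf.map_smul]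

/-- Evaluation at `c` as an element of a convolution algebra of `Ŵ`. -/
def evalAt : W →ₗ[ℂ] WithConv (DualAlg W →ₗ[ℂ] A) where
  toFun c := WithConv.toConv (Algebra.linearMap ℂ A ∘ₗ LinearMap.applyₗ (R := ℂ) (M₂ := ℂ) c ∘ₗ
    (toDual W).toLinearMap)
  map_add' c d := by ext χ; simp
  map_smul' r c := by
    ext χ
    change algebraMap ℂ A (χ (r • c)) = r • algebraMap ℂ A (χ c)
    rw [map_smul, smul_eq_mul, map_mul, Algebra.smul_def]

theorem evalAt_apply (c : W) (χ : DualAlg W) : (evalAt c : WithConv (DualAlg W →ₗ[ℂ] A)) χ = χ c • 1 :=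
  Algebra.algebraMap_eq_smul_one _

/-- The coproduct of `Ŵ` is dual to multiplication, so an evaluation factor on the left translates
the functional. Translations thereby become multiplications that can be moved through words. -/
theorem evalAt_mul_apply (c : W) (X : WithConv (DualAlg W →ₗ[ℂ] A)) (χ : DualAlg W) :
    (evalAt c * X : WithConv (DualAlg W →ₗ[ℂ] A)) χ = X (lshift c χ) := by
  rw [conv_mul_apply, ← sw_dual_smul_left χ c (f := fun z => X.ofConv z) (by fun_prop)]
  exact sw_congr fun a b => by rw [evalAt_apply, smul_mul_assoc, one_mul]

theorem mul_evalAt_apply (c : W) (X : WithConv (DualAlg W →ₗ[ℂ] A)) (χ : DualAlg W) :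
    (X * evalAt c : WithConv (DualAlg W →ₗ[ℂ] A)) χ = X (rshift c χ) := by
  rw [conv_mul_apply, ← sw_dual_smul_right χ c (f := fun z => X.ofConv z) (by fun_prop)]
  exact sw_congr fun a b => by rw [evalAt_apply, mul_smul_comm, mul_one]

theorem evalAt_mul (c d : W) :
    (evalAt (c * d) : WithConv (DualAlg W →ₗ[ℂ] A)) = evalAt c * evalAt d := by
  ext χ; rw [evalAt_mul_apply, evalAt_apply, evalAt_apply, lshift_apply]

theorem evalAt_one : (evalAt (1 : W) : WithConv (DualAlg W →ₗ[ℂ] A)) = 1 := by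
  ext χ; rw [evalAt_apply, LinearMap.convOne_apply, Algebra.algebraMap_eq_smul_one]; rfl

theorem commute_cst_evalAt (O : A) (c : W) :
    Commute (cst (DualAlg W) O) (evalAt c : WithConv (DualAlg W →ₗ[ℂ] A)) := by
  ext χ
  rw [cst_mul_apply, mul_cst_apply, evalAt_apply, mul_smul_comm, smul_mul_assoc, one_mul, mul_one]

end Shift

/-! ### Cycles of permutations as lists -/

namespace DirectedLattice

variable {E : Type*} (σ : Equiv.Perm (E × Bool))

/-- The list `[d, σ d, …, σⁿ⁻¹ d]`. -/
def iterList (d : E × Bool) (n : ℕ) : List (E × Bool) := (List.range n).map fun k => (σ^[k]) d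

theorem iterList_succ (d : E × Bool) (n : ℕ) :
    iterList σ d (n + 1) = d :: iterList σ (σ d) n := by
  simp [iterList, List.range_succ_eq_map, Function.comp_def]

theorem iterList_succ' (d : E × Bool) (n : ℕ) :
    iterList σ d (n + 1) = iterList σ d n ++ [(σ^[n]) d] := by
  simp [iterList, List.range_succ]

theorem cycleList_eq (d : E × Bool) : cycleList σ d = iterList σ d (Function.minimalPeriod σ d) := rfl

theorem nodup_cycleList (d : E × Bool) : (cycleList σ d).Nodup :=
  Cycle.nodup_coe_iff.1 (Function.nodup_periodicOrbit (f := σ) (x := d))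

variable [Finite E]

theorem mem_periodicPts (d : E × Bool) : d ∈ Function.periodicPts σ :=
  Function.Injective.mem_periodicPts σ.injective d

theorem exists_minimalPeriod_eq (d : E × Bool) : ∃ n, Function.minimalPeriod σ d = n + 1 :=
  Nat.exists_eq_succ_of_ne_zero (Function.minimalPeriod_pos_of_mem_periodicPts (mem_periodicPts σ d)).ne'

theorem mem_cycleList {d x : E × Bool} : x ∈ cycleList σ d ↔ σ.SameCycle d x := by
  refine (Function.mem_periodicOrbit_iff (f := σ) (x := d) (y := x) (mem_periodicPts σ d)).trans ?_
  constructor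
  · rintro ⟨n, rfl⟩
    exact ⟨n, by simp [Equiv.Perm.iterate_eq_pow]⟩
  · intro h
    obtain ⟨n, -, hn⟩ := h.exists_pow_eq'
    exact ⟨n, by rw [Equiv.Perm.iterate_eq_pow]; exact hn⟩

/-- Advancing the starting point moves the head of the list to its end. Applied to the predecessor
of a point, this also identifies the last entry of the list starting at that point. -/
theorem cycleList_apply_eq (d : E × Bool) :
    ∃ l, cycleList σ d = d :: l ∧ cycleList σ (σ d) = l ++ [d] := by
  obtain ⟨n, hn⟩ := exists_minimalPeriod_eq σ d
  refine ⟨iterList σ (σ d) n, ?_, ?_⟩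
  · rw [cycleList_eq, hn, iterList_succ]
  · rw [cycleList_eq, Function.minimalPeriod_apply (mem_periodicPts σ d), hn, iterList_succ',
      ← Function.iterate_succ_apply, Nat.succ_eq_add_one, ← hn, Function.iterate_minimalPeriod]

/-- A property of points that is invariant under `σ` holds on whole cycles. -/
theorem sameCycle_induction {P : E × Bool → Prop} (hP : ∀ d, P d → P (σ d)) {d x : E × Bool}
    (h : σ.SameCycle d x) (hd : P d) : P x := by
  obtain ⟨n, -, rfl⟩ := h.exists_pow_eq'
  induction n with
  | zero => exact hd
  | succ n ih => rw [pow_succ', Equiv.Perm.mul_apply]; exact hP _ (ih ⟨n, by simp⟩)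

end DirectedLattice

open DirectedLattice

/-! ### Moving a flag around vertices and faces -/

section Flags

variable {R E : Type*} [Ring R] [DecidableEq E]

/-- The letter at `d`, with the flag `J` inserted in front of the letter at `y`. -/
def flagBefore (J : R) (lam : E × Bool → R) (y d : E × Bool) : R := if d = y then J * lam d else lam d

/-- The letter at `d`, with the flag `J` inserted behind the letter at `y`. -/
def flagAfter (J : R) (lam : E × Bool → R) (y d : E × Bool) : R := if d = y then lam d * J else lam d

variable (J : R) (lam side : E × Bool → R)

theorem map_flagBefore_of_notMem {y : E × Bool} {l : List (E × Bool)} (h : y ∉ l) :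
    l.map (flagBefore J lam y) = l.map lam :=
  List.map_congr_left fun d hd => if_neg fun e : d = y => h (e ▸ hd)

theorem map_flagAfter_of_notMem {y : E × Bool} {l : List (E × Bool)} (h : y ∉ l) :
    l.map (flagAfter J lam y) = l.map lam :=
  List.map_congr_left fun d hd => if_neg fun e : d = y => h (e ▸ hd)

/-- Behind `y` and in front of `σ y` are the same position in the word. The two inequalities keep
the seam of the list away from this position; if `y` is not in the list, neither is `σ y`, and no
flag occurs. -/
theorem prod_flagAfter (σ : Equiv.Perm (E × Bool)) {y : E × Bool} (n : ℕ) (d : E × Bool)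
    (hd : (iterList σ d (n + 1)).Nodup) (hy : σ y ≠ d) (hy' : y ≠ (σ^[n]) d) :
    ((iterList σ d (n + 1)).map (flagAfter J lam y)).prod =
      ((iterList σ d (n + 1)).map (flagBefore J lam (σ y))).prod := by
  induction n generalizing d with
  | zero =>
    have h₁ : d ≠ y := fun h => hy' (by simp [h])
    simp [iterList, flagAfter, flagBefore, h₁, hy.symm]
  | succ n ih =>
    rw [iterList_succ] at hd ⊢
    obtain ⟨hd₁, hd₂⟩ := List.nodup_cons.1 hd
    rw [List.map_cons, List.map_cons, List.prod_cons, List.prod_cons, flagBefore, if_neg hy.symm,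
      flagAfter]
    by_cases h : d = y
    · subst h
      rw [if_pos rfl, map_flagAfter_of_notMem J lam hd₁, mul_assoc]
      rw [iterList_succ] at hd₂ ⊢
      rw [List.map_cons, List.map_cons, List.prod_cons, List.prod_cons, flagBefore, if_pos rfl,
        map_flagBefore_of_notMem J lam (List.nodup_cons.1 hd₂).1, mul_assoc]
    · rw [if_neg h, ih (σ d) hd₂ (fun e => h (σ.injective e).symm)
        (by rwa [← Function.iterate_succ_apply])]

theorem prod_flagAfter_vertexOrder [Finite E] (L : DirectedLattice E) (s : L.Site) {y : E × Bool}
    (hy : y ≠ s) :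
    ((L.vertexOrder s).map (flagAfter J lam y)).prod =
      ((L.vertexOrder s).map (flagBefore J lam (L.rot y))).prod := by
  obtain ⟨n, hn⟩ := exists_minimalPeriod_eq L.rot s
  have hn' : Function.minimalPeriod L.rot (L.rot s) = n + 1 := by
    rw [Function.minimalPeriod_apply (mem_periodicPts L.rot s), hn]
  have hd := nodup_cycleList L.rot (L.rot s)
  rw [vertexOrder, cycleList_eq, hn'] at *
  refine prod_flagAfter J lam L.rot n _ hd (fun e => hy (L.rot.injective e)) ?_
  rwa [← Function.iterate_succ_apply, Nat.succ_eq_add_one, ← hn, Function.iterate_minimalPeriod]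

theorem prod_flagBefore_vertexOrder [Finite E] (L : DirectedLattice E) (s : L.Site) :
    ((L.vertexOrder s).map (flagBefore J lam (L.rot s))).prod =
      J * ((L.vertexOrder s).map lam).prod := by
  obtain ⟨l, hl, -⟩ := cycleList_apply_eq L.rot (L.rot s)
  have hd := nodup_cycleList L.rot (L.rot s)
  rw [vertexOrder, hl] at *
  rw [List.map_cons, List.prod_cons, flagBefore, if_pos rfl,
    map_flagBefore_of_notMem J lam (List.nodup_cons.1 hd).1, List.map_cons, List.prod_cons, mul_assoc]

theorem prod_flagAfter_vertexOrder_self [Finite E] (L : DirectedLattice E) (s : L.Site) :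
    ((L.vertexOrder s).map (flagAfter J lam s)).prod = ((L.vertexOrder s).map lam).prod * J := by
  obtain ⟨l, -, hl⟩ := cycleList_apply_eq L.rot s
  have hd := nodup_cycleList L.rot (L.rot s)
  rw [vertexOrder, hl] at *
  have hs : s ∉ l := (List.nodup_middle.1 hd).notMem.comp (by simp)
  rw [List.map_append, List.prod_append, map_flagAfter_of_notMem J lam hs, List.map_append,
    List.prod_append]
  simp [flagAfter, mul_assoc]

/-- If a flag can be moved along the sides of each edge, it can be moved around a face. -/
theorem semiconjBy_faceOrder [Finite E] (h₁ : ∀ d, side d * lam d = lam d * J * side d)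
    (h₂ : ∀ d, side d * (J * lam (opp d)) = lam (opp d) * side d)
    (h₃ : ∀ d d', d.1 ≠ d'.1 → Commute (side d) (lam d')) (L : DirectedLattice E) (s : L.Site) :
    ((L.faceOrder s).map side).prod * (J * ((L.vertexOrder s).map lam).prod) =
      ((L.vertexOrder s).map lam).prod * J * ((L.faceOrder s).map side).prod := by
  -- A side `x` passing through the vertex word removes the flag in front of `opp x` and leaves one
  -- behind `x`.
  have step : ∀ (x : E × Bool) (l : List (E × Bool)), SemiconjBy (side x)
      (l.map (flagBefore J lam (opp x))).prod (l.map (flagAfter J lam x)).prod := by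
    intro x l
    induction l with
    | nil => exact SemiconjBy.one_right _
    | cons d l ih =>
      rw [List.map_cons, List.map_cons, List.prod_cons, List.prod_cons]
      refine SemiconjBy.mul_right ?_ ih
      have ho : opp x ≠ x := fun e => by simpa [opp] using congrArg Prod.snd e
      unfold flagBefore flagAfter
      by_cases hd : d = opp x
      · subst hd
        rw [if_pos rfl, if_neg ho]; exact h₂ x
      · rw [if_neg hd]
        by_cases hx : d = x
        · subst hx
          rw [if_pos rfl]; exact h₁ d
        · rw [if_neg hx]
          refine h₃ x d fun e => ?_
          rcases Bool.eq_or_eq_not d.2 x.2 with h | h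
          · exact hx (Prod.ext e.symm h)
          · exact hd (Prod.ext e.symm h)
  -- Consecutive sides fit together because `rot (faceRot d) = opp d`: the flag left behind `faceRot
  -- d` is the flag in front of `opp d`. Away from `s` the seam of the vertex word is not met.
  have key : ∀ (n : ℕ) (d : E × Bool), (∀ k, 0 < k → k < n + 1 → (L.faceRot^[k]) d ≠ s) →
      SemiconjBy ((iterList L.faceRot d (n + 1)).map side).prod
        ((L.vertexOrder s).map (flagBefore J lam (L.rot ((L.faceRot^[n + 1]) d)))).prod
        ((L.vertexOrder s).map (flagAfter J lam d)).prod := by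
    intro n
    induction n with
    | zero =>
      intro d _
      have : L.rot (L.faceRot d) = opp d := L.rot.apply_symm_apply _
      simpa [iterList, this] using step d (L.vertexOrder s)
    | succ n ih =>
      intro d hd
      rw [iterList_succ, List.map_cons, List.prod_cons, Function.iterate_succ_apply]
      refine SemiconjBy.mul_left ?_ (ih (L.faceRot d) fun k hk hk' => ?_)
      · rw [prod_flagAfter_vertexOrder J lam L s (y := L.faceRot d) (hd 1 (by simp) (by simp))]
        have : L.rot (L.faceRot d) = opp d := L.rot.apply_symm_apply _
        rw [this]; exact step d _
      · rw [← Function.iterate_succ_apply]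
        exact hd _ (by simp) (by omega)
  obtain ⟨n, hn⟩ := exists_minimalPeriod_eq L.faceRot s
  have := key n s fun k hk hk' =>
    Function.not_isPeriodicPt_of_pos_of_lt_minimalPeriod hk.ne' (hn ▸ hk')
  rw [← hn, Function.iterate_minimalPeriod, prod_flagBefore_vertexOrder,
    prod_flagAfter_vertexOrder_self] at this
  exact this

end Flags

/-! ### Sweedler products of commuting letters -/

section CommutingLetters

variable {C A : Type*} [Ring C] [Algebra ℂ C] [Coalgebra ℂ C] [Ring A] [Algebra ℂ A]
variable {M : Type*} [AddCommGroup M] [Module ℂ M]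

theorem sweedler_singleton (f : C →ₗ[ℂ] A) (c : C) : sweedler [f] c = f c := by
  rw [sweedler_cons, ← sw_counit_right c (f := fun z => f z) (by fun_prop)]
  exact sw_congr fun a b => by rw [sweedler_nil, mul_smul_comm, mul_one]

theorem sweedler_append_singleton (l : List (C →ₗ[ℂ] A)) (f : C →ₗ[ℂ] A) (c : C) :
    sweedler (l ++ [f]) c = sw c fun a b => sweedler l a * f b := by
  induction l generalizing c with
  | nil =>
    rw [List.nil_append, sweedler_singleton, ← sw_counit_left c (f := fun z => f z) (by fun_prop)]
    exact sw_congr fun a b => by rw [sweedler_nil, smul_mul_assoc, one_mul]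
  | cons g l ih =>
    simp only [List.cons_append, sweedler_cons, ih, sw_mul_left, sw_mul_right, mul_assoc]
    rw [sw_assoc c (fun a b d => g a * (sweedler l b * f d))] <;> fun_prop

theorem commute_sweedler {l : List (C →ₗ[ℂ] A)} {x : A} (h : ∀ f ∈ l, ∀ c, Commute x (f c)) (c : C) :
    Commute x (sweedler l c) := by
  induction l generalizing c with
  | nil => rw [sweedler_nil]; exact (Commute.one_right x).smul_right _
  | cons f l ih =>
    rw [sweedler_cons]
    exact Commute.sum_right _ _ _ fun i _ => (h f (by simp) _).mul_right
      (ih (fun g hg => h g (by simp [hg])) _)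

/-- Rotating the letters does not change the value at a cocommutative element. -/
theorem sweedler_rotate {f : C →ₗ[ℂ] A} {l : List (C →ₗ[ℂ] A)}
    (h : ∀ g ∈ l, ∀ a b, Commute (f a) (g b)) {c : C} (hc : IsCocommutativeElement c) :
    sweedler (l ++ [f]) c = sweedler (f :: l) c := by
  rw [sweedler_append_singleton, sweedler_cons,
    ← hc.sw_swap (fun a b => f a * sweedler l b) (by fun_prop) (by fun_prop)]
  exact sw_congr fun a b => (commute_sweedler (fun g hg => h g hg b) a).eq.symm

theorem sw_mul_of_comul_mul (hΔ : ∀ x y : C, comul (R := ℂ) (x * y) = comul x * comul y) (x y : C)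
    (f : C → C → M) (h₁ : ∀ b, Lin fun a => f a b) (h₂ : ∀ a, Lin fun b => f a b) :
    sw (x * y) f = sw x fun a b => sw y fun c d => f (a * c) (b * d) := by
  rw [sw_eq_bil _ f h₁ h₂, hΔ, ← (ℛ ℂ x).eq, ← (ℛ ℂ y).eq, Finset.sum_mul_sum, map_sum]
  refine Finset.sum_congr rfl fun i _ => ?_
  rw [map_sum]
  exact Finset.sum_congr rfl fun j _ => by rw [Algebra.TensorProduct.tmul_mul_tmul]; rfl

/-- Multiplicativity of `Δ` interleaves the two words, and letters at different places commute past
each other. The word must be nonempty, because the empty one is the counit, which is not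
multiplicative in a weak Hopf algebra. -/
theorem sweedler_mul {ι : Type*} (hΔ : ∀ x y : C, comul (R := ℂ) (x * y) = comul x * comul y)
    {f : ι → C →ₗ[ℂ] A} (hf : ∀ i x y, f i (x * y) = f i x * f i y)
    (hcomm : ∀ i j, i ≠ j → ∀ x y, Commute (f i x) (f j y)) {l : List ι} (hl : l.Nodup) (h0 : l ≠ [])
    (x y : C) : sweedler (l.map f) (x * y) = sweedler (l.map f) x * sweedler (l.map f) y := by
  induction l generalizing x y with
  | nil => exact absurd rfl h0
  | cons i l ih =>
    obtain ⟨hi, hl'⟩ := List.nodup_cons.1 hl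
    rcases eq_or_ne l [] with rfl | hne
    · simp only [List.map_cons, List.map_nil, sweedler_singleton, hf]
    rw [List.map_cons, sweedler_cons, sw_mul_of_comul_mul hΔ x y
      (fun a b => f i a * sweedler (l.map f) b) (by fun_prop) (by fun_prop)]
    rw [sweedler_cons, sweedler_cons, sw_mul_right]
    have hcl : ∀ b c, Commute (f i c) (sweedler (l.map f) b) := fun b c =>
      commute_sweedler (fun g hg z => by
        obtain ⟨j, hj, rfl⟩ := List.mem_map.1 hg
        exact hcomm i j (fun e => hi (e ▸ hj)) _ _) b
    refine sw_congr fun a b => ?_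
    rw [sw_mul_left]
    refine sw_congr fun c d => ?_
    rw [hf, ih hl' hne, mul_assoc, mul_assoc, ← mul_assoc (f i c), ← mul_assoc (sweedler _ b),
      (hcl b c).eq]

end CommutingLetters

/-! ### The calculus of the edge operators -/

section EdgeCalculus

variable {W : Type*} [Ring W] [Algebra ℂ W] [WeakHopfAlgebra W] [FiniteDimensional ℂ W]
variable {E A : Type*} [DecidableEq E] [Ring A] [Algebra ℂ A]

local notation "ε" => counit (R := ℂ)
local notation "𝓢" => WeakHopfAlgebra.antipode

theorem dual_comul_mul (χ ψ : DualAlg W) : comul (R := ℂ) (χ * ψ) = comul χ * comul ψ := by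
  apply (pair₂ W).injective
  refine TensorProduct.ext' fun x y => ?_
  have : pair₂ W (comul (χ * ψ)) (x ⊗ₜ y) = (χ * ψ) (x * y) := pair₂_dualComul _ x y
  rw [this, dual_mul_apply, pair₂_mul, sw_mul] <;> try fun_prop
  exact sw_congr fun a b => sw_congr fun c d => by
    rw [show pair₂ W (comul χ) (a ⊗ₜ c) = χ (a * c) from pair₂_dualComul _ a c,
      show pair₂ W (comul ψ) (b ⊗ₜ d) = ψ (b * d) from pair₂_dualComul _ b d]

/-- The relations between vertex letters `Lo` and face letters `To` of the edges of a lattice. -/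
structure EdgeCalculus (Lo : E × Bool → W →ₗ[ℂ] A) (To : E × Bool → DualAlg W →ₗ[ℂ] A) : Prop where
  lo_one : ∀ d, Lo d 1 = 1
  lo_mul : ∀ d a b, Lo d (a * b) = Lo d a * Lo d b
  to_mul : ∀ d χ ψ, To d (χ * ψ) = To d χ * To d ψ
  lo_comm : ∀ d d', d ≠ d' → ∀ a b, Commute (Lo d a) (Lo d' b)
  to_comm : ∀ d d', d ≠ d' → ∀ χ ψ, Commute (To d χ) (To d' ψ)
  to_lo_comm : ∀ d d', d.1 ≠ d'.1 → ∀ χ a, Commute (To d χ) (Lo d' a)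
  to_lo : ∀ d χ a, To d χ * Lo d a = sw a fun p q => Lo d p * To d (lshift q χ)
  to_lo_opp : ∀ d χ a,
    (sw a fun p q => To d (rshift p χ) * Lo (opp d) q) = Lo (opp d) a * To d χ

namespace EdgeCalculus

variable {Lo : E × Bool → W →ₗ[ℂ] A} {To : E × Bool → DualAlg W →ₗ[ℂ] A} (hE : EdgeCalculus Lo To)
include hE

theorem conv_to_lo (d : E × Bool) (a : W) :
    WithConv.toConv (To d) * cst (DualAlg W) (Lo d a) =
      (sw a fun p q => cst (DualAlg W) (Lo d p) * evalAt q) * WithConv.toConv (To d) := by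
  ext χ
  rw [mul_cst_apply, sw_mul_right, Lin.map_sw (F := fun z : WithConv (DualAlg W →ₗ[ℂ] A) => z χ)
    ⟨fun _ _ => rfl, fun _ _ => rfl⟩]
  simp only [mul_assoc, cst_mul_apply, evalAt_mul_apply]
  exact hE.to_lo d χ a

theorem conv_to_lo_opp (d : E × Bool) (a : W) :
    WithConv.toConv (To d) * (sw a fun p q => evalAt p * cst (DualAlg W) (Lo (opp d) q)) =
      cst (DualAlg W) (Lo (opp d) a) * WithConv.toConv (To d) := by
  ext χ
  rw [cst_mul_apply, sw_mul_left, Lin.map_sw (F := fun z : WithConv (DualAlg W →ₗ[ℂ] A) => z χ)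
    ⟨fun _ _ => rfl, fun _ _ => rfl⟩]
  simp only [← mul_assoc, mul_cst_apply, mul_evalAt_apply]
  exact hE.to_lo_opp d χ a

/-- This is `semiconjBy_faceOrder` in the convolution algebra of maps `W → Hom(Ŵ, A)`. Vertex
letters are constant on `Ŵ`, face letters are constant on `W`, and the flag is the tautological
pairing `evalAt`. -/
theorem face_mul_flag_mul_vertex [Finite E] (L : DirectedLattice E) (s : L.Site) (k : W) :
    WithConv.toConv (sweedler ((L.faceOrder s).map To)) *
        (sw k fun p q => evalAt p * cst (DualAlg W) (sweedler ((L.vertexOrder s).map Lo) q)) =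
      (sw k fun p q => cst (DualAlg W) (sweedler ((L.vertexOrder s).map Lo) p) * evalAt q) *
        WithConv.toConv (sweedler ((L.faceOrder s).map To)) := by
  have key := semiconjBy_faceOrder
    (WithConv.toConv (evalAt : W →ₗ[ℂ] WithConv (DualAlg W →ₗ[ℂ] A)))
    (fun d => WithConv.toConv (cst (DualAlg W) ∘ₗ Lo d)) (fun d => cst W (WithConv.toConv (To d)))
    (fun d => ?_) (fun d => ?_) (fun d d' hd => ?_) L s
  · have h₁ : ((L.faceOrder s).map fun d => cst W (WithConv.toConv (To d))).prod =
        cst W (WithConv.toConv (sweedler ((L.faceOrder s).map To))) := by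
      rw [toConv_sweedler, List.map_map]
      exact ((map_list_prod (cstHom W) _).trans (by rw [List.map_map]; rfl)).symm
    have h₂ : ((L.vertexOrder s).map fun d => WithConv.toConv (cst (DualAlg W) ∘ₗ Lo d)).prod =
        WithConv.toConv (cst (DualAlg W) ∘ₗ sweedler ((L.vertexOrder s).map Lo)) := by
      have : (cst (DualAlg W) : A →ₗ[ℂ] _) ∘ₗ sweedler ((L.vertexOrder s).map Lo) =
          sweedler ((L.vertexOrder s).map fun d => cst (DualAlg W) ∘ₗ Lo d) := by
        ext1 c
        exact (map_sweedler (cstHom (DualAlg W)) _ c).trans (by rw [List.map_map]; rfl)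
      rw [this, toConv_sweedler, List.map_map]; rfl
    rw [h₁, h₂] at key
    have := congrArg (fun z : WithConv (W →ₗ[ℂ] WithConv (DualAlg W →ₗ[ℂ] A)) => z k) key
    rw [cst_mul_apply, mul_cst_apply, conv_mul_apply, conv_mul_apply] at this
    exact this
  · ext1; ext1 a
    rw [cst_mul_apply, mul_cst_apply, conv_mul_apply]
    exact hE.conv_to_lo d a
  · ext1; ext1 a
    rw [cst_mul_apply, mul_cst_apply, conv_mul_apply]
    exact hE.conv_to_lo_opp d a
  · ext a χ
    rw [cst_mul_apply, mul_cst_apply]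
    exact (mul_cst_apply _ _ χ).trans ((hE.to_lo_comm d d' hd χ a).eq.trans (cst_mul_apply _ _ χ).symm)

/-- The coproduct of a left base element adds only a factor on the first leg, so it affects only the
first letter; right base elements likewise affect only the last. -/
theorem vertex_leftBase_mul {d : E × Bool} {l : List (E × Bool)} {q : W} (hq : IsLeftBase q) (h : W) :
    sweedler ((d :: l).map Lo) (q * h) = Lo d q * sweedler ((d :: l).map Lo) h := by
  rw [List.map_cons, sweedler_cons, hq.sw_mul, sweedler_cons, sw_mul_left]
  · simp only [hE.lo_mul, mul_assoc]
  all_goals fun_prop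

theorem vertex_mul_rightBase {d : E × Bool} {l : List (E × Bool)} {p : W} (hp : IsRightBase p) (h : W) :
    sweedler ((l ++ [d]).map Lo) (h * p) = sweedler ((l ++ [d]).map Lo) h * Lo d p := by
  rw [List.map_append, List.map_singleton, sweedler_append_singleton, hp.sw_mul',
    sweedler_append_singleton, sw_mul_right]
  · simp only [hE.lo_mul, mul_assoc]
  all_goals fun_prop

/-- The flag identity at `φ` exchanges the two words up to a flag. Inserting the antipode of `h⁽¹⁾`
makes the flag collapse to a leg of `Δ(1)` on either side, and the face word absorbs this `Δ(1)` at
its own seam. -/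
theorem commute_of_site [Finite E] {h : W} (hh : IsCocommutativeHaar h) {φ : DualAlg W}
    (hφ : ∀ c, rshift c φ = lshift c φ) (L : DirectedLattice E) (s : L.Site) :
    Commute (sweedler ((L.faceOrder s).map To) φ) (sweedler ((L.vertexOrder s).map Lo) h) := by
  have hS := hh.antipode_antipode
  obtain ⟨X, hX⟩ : ∃ X, X = WithConv.toConv (sweedler ((L.faceOrder s).map To)) := ⟨_, rfl⟩
  obtain ⟨P, hP⟩ : ∃ P, P = sweedler ((L.vertexOrder s).map Lo) := ⟨_, rfl⟩
  -- `G c` is the face word at the functional `φ(c ·)`. Traciality of `φ` permits the flag `c` to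
  -- stand on either side of the word.
  obtain ⟨G, hG⟩ : ∃ G : W →ₗ[ℂ] A, ∀ c, G c = (evalAt c * X : WithConv (DualAlg W →ₗ[ℂ] A)) φ :=
    ⟨IsLinearMap.mk' (fun c => (evalAt c * X : WithConv (DualAlg W →ₗ[ℂ] A)) φ)
      ⟨fun c d => by rw [map_add, add_mul]; rfl, fun r c => by rw [map_smul, smul_mul_assoc]; rfl⟩,
      fun c => rfl⟩
  have hG' : ∀ c, G c = (X * evalAt c : WithConv (DualAlg W →ₗ[ℂ] A)) φ := fun c => by
    rw [hG, mul_evalAt_apply, evalAt_mul_apply, hφ]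
  have hφL : Lin fun z : WithConv (DualAlg W →ₗ[ℂ] A) => z φ := ⟨fun _ _ => rfl, fun _ _ => rfl⟩
  have main : ∀ c k : W, (sw k fun a b => G (a * c) * P b) = sw k fun a b => P a * G (c * b) := by
    intro c k
    have := congrArg (fun z => (evalAt c * z : WithConv (DualAlg W →ₗ[ℂ] A)) φ) (hE.face_mul_flag_mul_vertex L s k)
    rw [← hX, ← hP] at this
    simp only [sw_mul_left, sw_mul_right] at this
    rw [hφL.map_sw, hφL.map_sw] at this
    refine Eq.trans (sw_congr fun a b => ?_) (this.trans (sw_congr fun a b => ?_))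
    · rw [← mul_assoc, ← mul_assoc, mul_cst_apply, mul_evalAt_apply, hφ, ← evalAt_mul_apply,
        ← mul_assoc, ← evalAt_mul, ← hG]
    · rw [← mul_assoc, ← mul_assoc, ← (commute_cst_evalAt (P a) c).eq, mul_assoc, mul_assoc,
        cst_mul_apply, ← mul_assoc, ← evalAt_mul, ← hG]
  -- Here `∑ h⁽²⁾S(h⁽¹⁾) ⊗ h⁽³⁾` reduces to `Δ(1)` times `h`. The two legs of `Δ(1)` act at the last
  -- side of the face and at the half-edge `L.rot s`, which is opposite to it, so the relation for
  -- opposite half-edges at `1` absorbs them.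
  have e₁ : (sw h fun a b => sw b fun c d => G (c * 𝓢 a) * P d) = G 1 * P h := by
    obtain ⟨l, hl, -⟩ := cycleList_apply_eq L.rot (L.rot s)
    obtain ⟨m, -, hm⟩ := cycleList_apply_eq L.faceRot (L.faceRot.symm s)
    rw [Equiv.apply_symm_apply] at hm
    have hy : opp (L.faceRot.symm s) = L.rot s :=
      (Equiv.symm_apply_eq _).1 (L.faceRot.apply_symm_apply s)
    have hX' : X * (sw 1 fun p q => evalAt p * cst (DualAlg W) (Lo (L.rot s) q)) = X := by
      rw [hX, faceOrder, hm, toConv_sweedler, List.map_append, List.map_append, List.prod_append,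
        List.map_singleton, List.map_singleton, List.prod_singleton, mul_assoc, ← hy,
        hE.conv_to_lo_opp, hE.lo_one, cst_one, one_mul]
    rw [← sw_assoc h (fun a c d => G (c * 𝓢 a) * P d),
      sw_mul_antipode_flip hS h (fun z w => G z * P w)] <;> try fun_prop
    calc (sw 1 fun p q => G p * P (q * h)) = sw 1 fun p q => G p * Lo (L.rot s) q * P h := by
          refine sw_one_congr ?_ ?_ ?_ ?_ fun p q hp hq => ?_
          · fun_prop
          · fun_prop
          · fun_prop
          · fun_prop
          · rw [hP, vertexOrder, hl, hE.vertex_leftBase_mul hq, mul_assoc]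
      _ = G 1 * P h := by
          rw [← sw_mul_right]
          congr 1
          rw [hG, evalAt_one, one_mul]
          conv_rhs => rw [← hX', sw_mul_left, hφL.map_sw]
          exact sw_congr fun p q => by rw [hG', ← mul_assoc, mul_cst_apply]
  -- Cyclic invariance of the threefold coproduct first brings the flag into the form `S(h⁽³⁾)h⁽²⁾`.
  -- The leftover `Δ(1)` sits at the first side of the face, which is the last half-edge `s` of the
  -- vertex word.
  have e₂ : (sw h fun a b => sw b fun c d => P c * G (𝓢 a * d)) = P h * G 1 := by
    obtain ⟨l, -, hl⟩ := cycleList_apply_eq L.rot s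
    obtain ⟨m, hm, -⟩ := cycleList_apply_eq L.faceRot s
    have hX' : (sw 1 fun p q => cst (DualAlg W) (Lo s p) * evalAt q) * X = X := by
      rw [hX, faceOrder, hm, toConv_sweedler, List.map_cons, List.map_cons, List.prod_cons,
        ← mul_assoc, ← hE.conv_to_lo, hE.lo_one, cst_one, mul_one]
    rw [hh.cocomm.sw_cycle (fun a b c => P a * G (𝓢 c * b)),
      sw_antipode_mul_flip hS h (fun z w => P z * G w)] <;> try fun_prop
    calc (sw 1 fun p q => P (h * p) * G q) = sw 1 fun p q => P h * (Lo s p * G q) := by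
          refine sw_one_congr ?_ ?_ ?_ ?_ fun p q hp hq => ?_
          · fun_prop
          · fun_prop
          · fun_prop
          · fun_prop
          · rw [hP, vertexOrder, hl, hE.vertex_mul_rightBase hp, mul_assoc]
      _ = P h * G 1 := by
          rw [← sw_mul_left]
          congr 1
          rw [hG, evalAt_one, one_mul]
          conv_rhs => rw [← hX', sw_mul_right, hφL.map_sw]
          exact sw_congr fun p q => by rw [hG, mul_assoc, cst_mul_apply]
  have e₃ : (sw h fun a b => sw b fun c d => G (c * 𝓢 a) * P d) =
      sw h fun a b => sw b fun c d => P c * G (𝓢 a * d) := sw_congr fun a b => main (𝓢 a) b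
  have hG1 : G 1 = sweedler ((L.faceOrder s).map To) φ := by
    rw [hG, evalAt_one, one_mul, hX]
  rw [← hG1, ← hP]
  exact e₁.symm.trans (e₃.trans e₂)

end EdgeCalculus

end EdgeCalculus

/-! ### Words of commuting letters along cycles -/

section CycleWords

variable {C A E : Type*} [Ring C] [Algebra ℂ C] [Coalgebra ℂ C] [Ring A] [Algebra ℂ A] [Finite E]
  {f : E × Bool → C →ₗ[ℂ] A} (hcomm : ∀ d d', d ≠ d' → ∀ a b, Commute (f d a) (f d' b))
include hcomm

/-- Moving the starting point by one step rotates the word, which a cocommutative argument does not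
detect. -/
theorem sweedler_cycleList_eq (σ : Equiv.Perm (E × Bool)) {c : C} (hc : IsCocommutativeElement c)
    {d d' : E × Bool} (h : σ.SameCycle d d') :
    sweedler ((cycleList σ d').map f) c = sweedler ((cycleList σ d).map f) c := by
  refine sameCycle_induction σ
    (P := fun x => sweedler ((cycleList σ x).map f) c = sweedler ((cycleList σ d).map f) c)
    (fun x hx => ?_) h rfl
  rw [← hx]
  obtain ⟨l, hl, hl'⟩ := cycleList_apply_eq σ x
  have hd := nodup_cycleList σ x
  rw [hl] at hd ⊢
  rw [hl', List.map_append, List.map_singleton, List.map_cons]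
  refine sweedler_rotate (fun g hg a b => ?_) hc
  obtain ⟨y, hy, rfl⟩ := List.mem_map.1 hg
  exact hcomm x y (fun e => (List.nodup_cons.1 hd).1 (e ▸ hy)) a b

theorem commute_sweedler_cycleList (σ : Equiv.Perm (E × Bool)) {c : C}
    (hc : IsCocommutativeElement c) (d d' : E × Bool) :
    Commute (sweedler ((cycleList σ d).map f) c) (sweedler ((cycleList σ d').map f) c) := by
  by_cases h : σ.SameCycle d d'
  · rw [sweedler_cycleList_eq hcomm σ hc h]
  · refine commute_sweedler (fun g hg a => (commute_sweedler (fun g' hg' b => ?_) c).symm) c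
    obtain ⟨y, hy, rfl⟩ := List.mem_map.1 hg
    obtain ⟨z, hz, rfl⟩ := List.mem_map.1 hg'
    rw [mem_cycleList] at hy hz
    exact hcomm y z (fun e => h (hz.trans (e ▸ hy.symm))) a b |>.symm.symm

theorem sweedler_cycleList_mul_self (σ : Equiv.Perm (E × Bool))
    (hΔ : ∀ x y : C, comul (R := ℂ) (x * y) = comul x * comul y)
    (hf : ∀ d a b, f d (a * b) = f d a * f d b) {c : C} (hc : c * c = c) (d : E × Bool) :
    sweedler ((cycleList σ d).map f) c * sweedler ((cycleList σ d).map f) c =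
      sweedler ((cycleList σ d).map f) c := by
  rw [← sweedler_mul hΔ hf hcomm (nodup_cycleList σ d), hc]
  obtain ⟨l, hl, -⟩ := cycleList_apply_eq σ d
  simp [hl]

end CycleWords

/-! ### Commutation of face words with vertex words -/

namespace EdgeCalculus

variable {W : Type*} [Ring W] [Algebra ℂ W] [WeakHopfAlgebra W] [FiniteDimensional ℂ W]
variable {E A : Type*} [DecidableEq E] [Ring A] [Algebra ℂ A]
variable {Lo : E × Bool → W →ₗ[ℂ] A} {To : E × Bool → DualAlg W →ₗ[ℂ] A} (hE : EdgeCalculus Lo To)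
include hE

/-- If the face and the vertex have a common corner, both words can be started there. Otherwise no
edge occurs in both: a common edge would produce the corner `y` or the corner `faceRot y`. -/
theorem commute_face_vertex [Finite E] {h : W} (hh : IsCocommutativeHaar h) {φ : DualAlg W}
    (hφc : IsCocommutativeElement φ) (hφ : ∀ c, rshift c φ = lshift c φ) (L : DirectedLattice E)
    (s s' : L.Site) :
    Commute (sweedler ((L.faceOrder s).map To) φ) (sweedler ((L.vertexOrder s').map Lo) h) := by
  by_cases hx : ∃ x, L.faceRot.SameCycle s x ∧ L.rot.SameCycle s' x
  · obtain ⟨x, h₁, h₂⟩ := hx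
    have := hE.commute_of_site hh hφ L x
    rwa [vertexOrder, faceOrder, sweedler_cycleList_eq hE.to_comm _ hφc h₁,
      sweedler_cycleList_eq hE.lo_comm _ hh.cocomm
        ((Equiv.Perm.sameCycle_apply_left.2 h₂).trans (Equiv.Perm.sameCycle_apply_right.2
          (Equiv.Perm.SameCycle.refl _ _)))] at this
  · refine commute_sweedler (fun g hg a => (commute_sweedler (fun g' hg' b => ?_) φ).symm) h
    obtain ⟨d, hd, rfl⟩ := List.mem_map.1 hg
    obtain ⟨y, hy, rfl⟩ := List.mem_map.1 hg'
    rw [vertexOrder, mem_cycleList, Equiv.Perm.sameCycle_apply_left] at hd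
    rw [faceOrder, mem_cycleList] at hy
    refine (hE.to_lo_comm y d (fun e => ?_) b a).symm
    rcases Bool.eq_or_eq_not d.2 y.2 with h | h
    · exact hx ⟨y, hy, (Prod.ext e.symm h : d = y) ▸ hd⟩
    · refine hx ⟨L.faceRot y, Equiv.Perm.sameCycle_apply_right.2 hy, ?_⟩
      have : d = L.rot (L.faceRot y) :=
        (Prod.ext e.symm h : d = opp y).trans (L.rot.apply_symm_apply _).symm
      rw [this] at hd
      exact Equiv.Perm.sameCycle_apply_right.1 hd

end EdgeCalculus

/-! ### The edge operators of the quantum double model -/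

section EdgeOperators

variable {W : Type*} [Ring W] [Algebra ℂ W] [WeakHopfAlgebra W] [FiniteDimensional ℂ W]

local notation "ε" => counit (R := ℂ)
local notation "𝓢" => WeakHopfAlgebra.antipode

theorem Lplus_apply (a x : W) : Lplus a x = a * x := rfl

theorem antipodeInv_apply (hS : ∀ x : W, 𝓢 (𝓢 x) = x) (x : W) : antipodeInv x = 𝓢 x := by
  have e : (𝓢 : Module.End ℂ W) * 𝓢 = 1 := LinearMap.ext hS
  have : antipodeInv = (𝓢 : Module.End ℂ W) :=
    Ring.inverse_unit (⟨𝓢, 𝓢, e, e⟩ : (Module.End ℂ W)ˣ)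
  rw [this]

theorem Lminus_apply (hS : ∀ x : W, 𝓢 (𝓢 x) = x) (a x : W) : Lminus a x = x * 𝓢 a := by
  rw [← antipodeInv_apply hS]; rfl

theorem Tplus_apply (χ : DualAlg W) (x : W) : Tplus χ x = sw x fun a b => χ b • a :=
  (sw_linearMap x ((TensorProduct.rid ℂ W).toLinearMap ∘ₗ (toDual W χ).lTensor W)).symm

theorem Tminus_apply (χ : DualAlg W) (x : W) : Tminus χ x = sw x fun a b => χ (𝓢 a) • b :=
  (sw_linearMap x ((TensorProduct.lid ℂ W).toLinearMap ∘ₗ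
    (toDual W χ ∘ₗ WeakHopfAlgebra.antipode).rTensor W)).symm

theorem Lplus_comm_Lminus (hS : ∀ x : W, 𝓢 (𝓢 x) = x) (a b : W) :
    Commute (Lplus a : Module.End ℂ W) (Lminus b) := by
  ext x
  simp [Lplus_apply, Lminus_apply hS, mul_assoc]

theorem Tplus_comm_Tminus (χ ψ : DualAlg W) : Commute (Tplus χ) (Tminus ψ) := by
  ext x
  rw [Module.End.mul_apply, Module.End.mul_apply, Tplus_apply χ x, Tminus_apply ψ x,
    Lin.map_sw (F := fun z => Tplus χ z) (by fun_prop),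
    Lin.map_sw (F := fun z => Tminus ψ z) (by fun_prop)]
  simp only [map_smul, Tplus_apply, Tminus_apply]
  calc (sw x fun a b => ψ (𝓢 a) • sw b fun c d => χ d • c)
      = sw x fun a b => sw b fun c d => (ψ (𝓢 a) * χ d) • c :=
        sw_congr fun a b => by
          rw [Lin.map_sw (F := fun z : W => ψ (𝓢 a) • z) (by fun_prop)]; simp only [smul_smul]
    _ = sw x fun a b => sw a fun c d => (ψ (𝓢 c) * χ b) • d := by
        rw [sw_assoc x (fun c d b => (ψ (𝓢 c) * χ b) • d)] <;> fun_prop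
    _ = _ := sw_congr fun a b => by
          rw [Lin.map_sw (F := fun z : W => χ b • z) (by fun_prop)]
          simp only [smul_smul, mul_comm]

theorem Lplus_mul (a b : W) : (Lplus (a * b) : Module.End ℂ W) = Lplus a * Lplus b := by
  ext x; simp [Lplus_apply, mul_assoc]

theorem Lminus_mul (hS : ∀ x : W, 𝓢 (𝓢 x) = x) (a b : W) :
    (Lminus (a * b) : Module.End ℂ W) = Lminus a * Lminus b := by
  ext x; simp [Lminus_apply hS, antipode_mul, mul_assoc]

theorem Tplus_mul (χ ψ : DualAlg W) : Tplus (χ * ψ) = Tplus χ * Tplus ψ := by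
  ext x
  rw [Module.End.mul_apply, Tplus_apply, Tplus_apply ψ, 
    Lin.map_sw (F := fun z => Tplus χ z) (by fun_prop)]
  simp only [map_smul, Tplus_apply, dual_mul_apply]
  calc (sw x fun a b => (sw b fun c d => χ c * ψ d) • a)
      = sw x fun a b => sw b fun c d => (χ c * ψ d) • a :=
        sw_congr fun a b => Lin.map_sw (F := fun z : ℂ => z • a) (by fun_prop) _ _
    _ = sw x fun a b => sw a fun c d => (χ d * ψ b) • c := by
        rw [sw_assoc x (fun c d b => (χ d * ψ b) • c)] <;> fun_prop
    _ = _ := sw_congr fun a b => by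
          rw [Lin.map_sw (F := fun z : W => ψ b • z) (by fun_prop)]
          simp only [smul_smul, mul_comm]

theorem Tminus_mul (χ ψ : DualAlg W) : Tminus (χ * ψ) = Tminus χ * Tminus ψ := by
  ext x
  rw [Module.End.mul_apply, Tminus_apply, Tminus_apply ψ,
    Lin.map_sw (F := fun z => Tminus χ z) (by fun_prop)]
  simp only [map_smul, Tminus_apply, dual_mul_apply]
  calc (sw x fun a b => (sw (𝓢 a : W) fun c d => χ c * ψ d) • b)
      = sw x fun a b => sw a fun c d => (χ (𝓢 d) * ψ (𝓢 c)) • b :=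
        sw_congr fun a b => by
          rw [sw_antipode _ _ (by fun_prop) (by fun_prop)]
          exact Lin.map_sw (F := fun z : ℂ => z • b) (by fun_prop) _ _
    _ = sw x fun a b => sw b fun c d => (χ (𝓢 c) * ψ (𝓢 a)) • d := by
        rw [sw_assoc x (fun c d b => (χ (𝓢 d) * ψ (𝓢 c)) • b)] <;> fun_prop
    _ = _ := sw_congr fun a b => by
          rw [Lin.map_sw (F := fun z : W => ψ (𝓢 a) • z) (by fun_prop)]
          simp only [smul_smul, mul_comm]

theorem Tplus_mul_Lplus (χ : DualAlg W) (a : W) :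
    Tplus χ * Lplus a = sw a fun p q => Lplus p * Tplus (lshift q χ) := by
  ext x
  rw [Lin.map_sw (F := fun z : Module.End ℂ W => z x) (by fun_prop)]
  simp only [Module.End.mul_apply, Lplus_apply, Tplus_apply, lshift_apply, sw_mul_left]
  rw [sw_mul]
  · simp only [mul_smul_comm]
  all_goals fun_prop

theorem Tminus_mul_Lminus (hS : ∀ x : W, 𝓢 (𝓢 x) = x) (χ : DualAlg W) (a : W) :
    Tminus χ * Lminus a = sw a fun p q => Lminus p * Tminus (lshift q χ) := by
  ext x
  rw [Lin.map_sw (F := fun z : Module.End ℂ W => z x) (by fun_prop)]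
  simp only [Module.End.mul_apply, Lminus_apply hS, Tminus_apply, lshift_apply, sw_mul_right]
  rw [sw_mul, sw_comm a x]
  · refine sw_congr fun c d => ?_
    rw [sw_antipode]
    · simp only [antipode_mul, hS, smul_mul_assoc]
    all_goals fun_prop
  all_goals fun_prop

/-- On the left the functional receives `S(a⁽²⁾)a⁽¹⁾ = S(S(a⁽¹⁾)a⁽²⁾)`, a value of `S ∘ ε_R` by `S²
= id`. The copy of `Δ(1)` that this produces is absorbed by `Δ(x)`. -/
theorem Tminus_mul_Lplus (hS : ∀ x : W, 𝓢 (𝓢 x) = x) (χ : DualAlg W) (a : W) :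
    (sw a fun p q => Tminus (rshift p χ) * Lplus q) = Lplus a * Tminus χ := by
  ext x
  rw [Lin.map_sw (F := fun z : Module.End ℂ W => z x) (by fun_prop)]
  simp only [Module.End.mul_apply, Lplus_apply, Tminus_apply, rshift_apply, sw_mul_left]
  have e₁ : ∀ p q : W, (sw (q * x) fun c d => χ (𝓢 c * p) • d) =
      sw q fun r t => sw x fun c d => χ (𝓢 c * 𝓢 r * p) • (t * d) := fun p q => by
    rw [sw_mul _ _ _ (by fun_prop) (by fun_prop)]; simp only [antipode_mul]
  calc (sw a fun p q => sw (q * x) fun c d => χ (𝓢 c * p) • d)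
      = sw a fun p q => sw q fun r t => sw x fun c d => χ (𝓢 c * 𝓢 r * p) • (t * d) := by
        simp only [e₁]
    _ = sw a fun b t => sw x fun c d => χ (𝓢 c * 𝓢 (epsR b)) • (t * d) := by
        rw [← sw_assoc a (fun p r t => sw x fun c d => χ (𝓢 c * 𝓢 r * p) • (t * d))] <;>
          try fun_prop
        refine sw_congr fun b t => ?_
        rw [← sw_antipode_mul b,
          Lin.map_sw (F := fun z : W => sw x fun c d => χ (𝓢 c * 𝓢 z) • (t * d)) (by fun_prop)]
        simp only [antipode_mul, hS, mul_assoc]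
    _ = sw 1 fun p q => sw x fun c d => χ (𝓢 (p * c)) • (a * (q * d)) := by
        rw [sw_epsR_left a (fun b t => sw x fun c d => χ (𝓢 c * 𝓢 b) • (t * d))]
        · simp only [antipode_mul, mul_assoc]
        all_goals fun_prop
    _ = sw x fun c d => a * χ (𝓢 c) • d := by
        rw [← sw_mul 1 x (fun c d => χ (𝓢 c) • (a * d)), one_mul]
        · simp only [mul_smul_comm]
        all_goals fun_prop

theorem Tplus_mul_Lminus (hS : ∀ x : W, 𝓢 (𝓢 x) = x) (χ : DualAlg W) (a : W) :
    (sw a fun p q => Tplus (rshift p χ) * Lminus q) = Lminus a * Tplus χ := by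
  ext x
  rw [Lin.map_sw (F := fun z : Module.End ℂ W => z x) (by fun_prop)]
  simp only [Module.End.mul_apply, Lminus_apply hS, Tplus_apply, rshift_apply, sw_mul_right]
  have e₁ : ∀ p q : W, (sw (x * 𝓢 q) fun c d => χ (d * p) • c) =
      sw q fun r t => sw x fun c d => χ (d * 𝓢 r * p) • (c * 𝓢 t) := fun p q => by
    rw [sw_mul _ _ _ (by fun_prop) (by fun_prop), sw_comm q x]
    refine sw_congr fun c d => ?_
    rw [sw_antipode _ _ (by fun_prop) (by fun_prop)]
  calc (sw a fun p q => sw (x * 𝓢 q) fun c d => χ (d * p) • c)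
      = sw a fun p q => sw q fun r t => sw x fun c d => χ (d * 𝓢 r * p) • (c * 𝓢 t) := by
        simp only [e₁]
    _ = sw a fun b t => sw x fun c d => χ (d * 𝓢 (epsR b)) • (c * 𝓢 t) := by
        rw [← sw_assoc a (fun p r t => sw x fun c d => χ (d * 𝓢 r * p) • (c * 𝓢 t))] <;>
          try fun_prop
        refine sw_congr fun b t => ?_
        rw [← sw_antipode_mul b,
          Lin.map_sw (F := fun z : W => sw x fun c d => χ (d * 𝓢 z) • (c * 𝓢 t)) (by fun_prop)]
        simp only [antipode_mul, hS, mul_assoc]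
    _ = sw 1 fun p q => sw x fun c d => χ (d * 𝓢 p) • (c * 𝓢 q * 𝓢 a) := by
        rw [sw_epsR_left a (fun b t => sw x fun c d => χ (d * 𝓢 b) • (c * 𝓢 t))]
        · simp only [antipode_mul, mul_assoc]
        all_goals fun_prop
    _ = sw x fun c d => χ d • c * 𝓢 a := by
        rw [sw_one_antipode (fun p q => sw x fun c d => χ (d * q) • (c * p * 𝓢 a)), sw_comm 1 x,
          ← sw_mul x 1 (fun c d => χ d • (c * 𝓢 a)), mul_one]
        · simp only [smul_mul_assoc]
        all_goals fun_prop

end EdgeOperators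

/-! ### Operators on single tensor factors -/

section TotalSpace

variable {W : Type*} [Ring W] [Algebra ℂ W] {E : Type*} [DecidableEq E]

theorem onEdge_tprod (e : E) (T : Module.End ℂ W) (x : E → W) :
    onEdge e T (PiTensorProduct.tprod ℂ x) =
      PiTensorProduct.tprod ℂ (Function.update x e (T (x e))) := by
  have : onEdge e T = PiTensorProduct.map (Function.update (fun _ : E => LinearMap.id) e T) := rfl
  rw [this, PiTensorProduct.map_tprod]
  congr 1
  ext i
  by_cases h : i = e
  · subst h; simp
  · simp [h]

theorem onEdge_mul (e : E) (S T : Module.End ℂ W) : onEdge e (S * T) = onEdge e S * onEdge e T := by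
  refine PiTensorProduct.ext (MultilinearMap.ext fun x => ?_)
  simp [onEdge_tprod, Module.End.mul_apply]

theorem onEdge_one (e : E) : onEdge e (1 : Module.End ℂ W) = 1 := by
  refine PiTensorProduct.ext (MultilinearMap.ext fun x => ?_)
  simp [onEdge_tprod]

theorem commute_onEdge {e e' : E} (h : e ≠ e') (S T : Module.End ℂ W) :
    Commute (onEdge e S) (onEdge e' T) := by
  refine PiTensorProduct.ext (MultilinearMap.ext fun x => ?_)
  simp [onEdge_tprod, Module.End.mul_apply, h, h.symm, Function.update_comm h]

theorem Commute.onEdge {S T : Module.End ℂ W} (h : Commute S T) (e : E) :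
    Commute (onEdge e S) (WeakHopf.onEdge e T) := by
  rw [Commute, SemiconjBy, ← onEdge_mul, h.eq, onEdge_mul]

end TotalSpace

/-! ### The operators of the model satisfy the edge relations -/

section Letters

variable {W : Type*} [Ring W] [Algebra ℂ W] [WeakHopfAlgebra W] [FiniteDimensional ℂ W]
variable {E : Type*} [DecidableEq E]

local notation "𝓢" => WeakHopfAlgebra.antipode

/-- The operators of the half-edges of a vertex. -/
def vertexLetter (d : E × Bool) : W →ₗ[ℂ] Module.End ℂ (TotalSpace W E) :=
  onEdge d.1 ∘ₗ if d.2 then Lminus else Lplus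

/-- The operators of the sides of a face. -/
def faceLetter (d : E × Bool) : DualAlg W →ₗ[ℂ] Module.End ℂ (TotalSpace W E) :=
  onEdge d.1 ∘ₗ if d.2 then Tminus else Tplus

theorem edgeCalculus (hS : ∀ x : W, 𝓢 (𝓢 x) = x) :
    EdgeCalculus (vertexLetter (W := W) (E := E)) faceLetter where
  lo_one := by
    rintro ⟨e, b⟩
    rw [← onEdge_one e]
    cases b
    · exact congrArg (onEdge e) (LinearMap.ext fun x => by simp [Lplus_apply])
    · exact congrArg (onEdge e) (LinearMap.ext fun x => by simp [Lminus_apply hS, antipode_one])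
  lo_mul := by
    rintro ⟨e, b⟩ x y
    cases b <;> simp [vertexLetter, Lplus_mul, Lminus_mul hS, onEdge_mul]
  to_mul := by
    rintro ⟨e, b⟩ x y
    cases b <;> simp [faceLetter, Tplus_mul, Tminus_mul, onEdge_mul]
  lo_comm := by
    rintro ⟨e, b⟩ ⟨e', b'⟩ hne x y
    by_cases h : e = e'
    · subst h
      cases b <;> cases b' <;> first | exact absurd rfl hne | skip
      · exact Commute.onEdge (Lplus_comm_Lminus hS x y) e
      · exact Commute.onEdge (Lplus_comm_Lminus hS y x).symm e
    · exact commute_onEdge h _ _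
  to_comm := by
    rintro ⟨e, b⟩ ⟨e', b'⟩ hne x y
    by_cases h : e = e'
    · subst h
      cases b <;> cases b' <;> first | exact absurd rfl hne | skip
      · exact Commute.onEdge (Tplus_comm_Tminus x y) e
      · exact Commute.onEdge (Tplus_comm_Tminus y x).symm e
    · exact commute_onEdge h _ _
  to_lo_comm := fun d d' h χ a => commute_onEdge h _ _
  to_lo := by
    rintro ⟨e, b⟩ χ a
    cases b
    · refine (onEdge_mul e (Tplus χ) (Lplus a)).symm.trans ?_
      rw [Tplus_mul_Lplus, Lin.map_sw (F := fun z => onEdge e z) (by fun_prop)]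
      simp only [onEdge_mul]; rfl
    · refine (onEdge_mul e (Tminus χ) (Lminus a)).symm.trans ?_
      rw [Tminus_mul_Lminus hS, Lin.map_sw (F := fun z => onEdge e z) (by fun_prop)]
      simp only [onEdge_mul]; rfl
  to_lo_opp := by
    rintro ⟨e, b⟩ χ a
    cases b
    · refine Eq.trans ?_ (onEdge_mul e (Lminus a) (Tplus χ))
      rw [← Tplus_mul_Lminus hS, Lin.map_sw (F := fun z => onEdge e z) (by fun_prop)]
      simp only [onEdge_mul]; rfl
    · refine Eq.trans ?_ (onEdge_mul e (Lplus a) (Tminus χ))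
      rw [← Tminus_mul_Lplus hS, Lin.map_sw (F := fun z => onEdge e z) (by fun_prop)]
      simp only [onEdge_mul]; rfl

end Letters

/-! ### Tensor network states as images of product states -/

section LetterPairs

variable {W : Type*} [Ring W] [Algebra ℂ W] [WeakHopfAlgebra W] [FiniteDimensional ℂ W]
variable {E A : Type*} [DecidableEq E] [Ring A] [Algebra ℂ A]

/-- The span of the pairs of a product of face letters and the corresponding product of values. -/
def letterPairs (To : E × Bool → DualAlg W →ₗ[ℂ] A) (l : List (E × Bool)) :
    Submodule ℂ (A × ((E × Bool → W) → ℂ)) :=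
  Submodule.span ℂ (Set.range fun θ : E × Bool → DualAlg W =>
    ((l.map fun d => To d (θ d)).prod, fun Y => (l.map fun d => θ d (Y d)).prod))

variable {To : E × Bool → DualAlg W →ₗ[ℂ] A}

theorem mul_mem_letterPairs {l l' : List (E × Bool)} (hl : l.Disjoint l')
    {p q : A × ((E × Bool → W) → ℂ)} (hp : p ∈ letterPairs To l) (hq : q ∈ letterPairs To l') :
    p * q ∈ letterPairs To (l ++ l') := by
  have h := Submodule.mul_mem_mul hp hq
  rw [letterPairs, letterPairs, Submodule.span_mul_span] at h
  refine Submodule.span_mono ?_ h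
  rintro _ ⟨_, ⟨θ, rfl⟩, _, ⟨θ', rfl⟩, rfl⟩
  refine ⟨fun d => if d ∈ l then θ d else θ' d, ?_⟩
  have h₁ : ∀ {β : Type _} (g : E × Bool → DualAlg W → β),
      (l.map fun d => g d (if d ∈ l then θ d else θ' d)) = l.map fun d => g d (θ d) :=
    fun g => List.map_congr_left fun d hd => by rw [if_pos hd]
  have h₂ : ∀ {β : Type _} (g : E × Bool → DualAlg W → β),
      (l'.map fun d => g d (if d ∈ l then θ d else θ' d)) = l'.map fun d => g d (θ' d) :=
    fun g => List.map_congr_left fun d hd => by rw [if_neg fun h => hl h hd]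
  refine Prod.ext ?_ (funext fun Y => ?_)
  · change (List.map (fun d => To d (if d ∈ l then θ d else θ' d)) (l ++ l')).prod = _
    rw [List.map_append, List.prod_append, h₁ fun d χ => To d χ, h₂ fun d χ => To d χ]; rfl
  · change (List.map (fun d => (if d ∈ l then θ d else θ' d) (Y d)) (l ++ l')).prod = _
    rw [List.map_append, List.prod_append, List.map_congr_left fun d hd => by rw [if_pos hd],
      List.map_congr_left (l := l') fun d hd => by rw [if_neg fun h => hl h hd]]
    rfl

theorem one_mem_letterPairs : (1 : A × ((E × Bool → W) → ℂ)) ∈ letterPairs To [] :=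
  Submodule.subset_span ⟨fun _ => 1, rfl⟩

/-- The operator word and the pairing with a product of values expand through the same coproducts of
`χ`. Carrying them as a pair reduces a comparison of the two to words with independent functionals.
-/
theorem sweedler_mem_letterPairs {l : List (E × Bool)} (hl : l.Nodup) (χ : DualAlg W) :
    (sweedler (l.map To) χ, fun Y : E × Bool → W => χ ((l.map Y).prod)) ∈ letterPairs To l := by
  induction l generalizing χ with
  | nil =>
    have : (sweedler (([] : List (E × Bool)).map To) χ,
        fun Y : E × Bool → W => χ ((([] : List (E × Bool)).map Y).prod)) =
        χ 1 • (1 : A × ((E × Bool → W) → ℂ)) := by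
      refine Prod.ext (sweedler_nil χ) (funext fun Y => ?_)
      simp
    rw [this]
    exact Submodule.smul_mem _ _ one_mem_letterPairs
  | cons d l ih =>
    obtain ⟨hd, hl'⟩ := List.nodup_cons.1 hl
    have : (sweedler ((d :: l).map To) χ, fun Y : E × Bool → W => χ (((d :: l).map Y).prod)) =
        sw χ fun α β => (To d α, fun Y : E × Bool → W => α (Y d)) *
          (sweedler (l.map To) β, fun Y : E × Bool → W => β ((l.map Y).prod)) := by
      refine Prod.ext ?_ (funext fun Y => ?_)
      · rw [List.map_cons, sweedler_cons]; simp [sw, Prod.fst_sum]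
      · simp only [List.map_cons, List.prod_cons]
        rw [← sw_dual_apply]; simp [sw, Prod.snd_sum]
    rw [this]
    refine Submodule.sum_mem _ fun i _ => ?_
    refine mul_mem_letterPairs (l := [d]) (by simpa using hd) (Submodule.subset_span ?_) (ih hl' _)
    exact ⟨fun _ => (ℛ ℂ χ).left i, by simp⟩

theorem list_prod_mem_letterPairs {ι : Type*} {w : ι → List (E × Bool)} {fl : List ι} (hfl : fl.Nodup)
    (hw : ∀ f, (w f).Nodup) (hdisj : ∀ f f', f ≠ f' → (w f).Disjoint (w f')) (χ : DualAlg W) :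
    ((fl.map fun f => sweedler ((w f).map To) χ).prod,
      fun Y : E × Bool → W => (fl.map fun f => χ (((w f).map Y).prod)).prod) ∈
      letterPairs To (fl.flatMap w) := by
  induction fl with
  | nil => exact one_mem_letterPairs
  | cons f fl ih =>
    obtain ⟨hf, hfl'⟩ := List.nodup_cons.1 hfl
    refine mul_mem_letterPairs ?_ (sweedler_mem_letterPairs (hw f) χ) (ih hfl')
    intro d hd hd'
    obtain ⟨f', hf', hdf'⟩ := List.mem_flatMap.1 hd'
    exact hdisj f f' (fun e => hf (e ▸ hf')) hd hdf'

end LetterPairs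

/-! ### The tensor network state as the image of a product state -/

section States

variable {W : Type*} [Ring W] [Algebra ℂ W] [WeakHopfAlgebra W] [FiniteDimensional ℂ W]
variable {E : Type*} [DecidableEq E]

local notation "𝓢" => WeakHopfAlgebra.antipode

/-- The action of a face letter on the tensor factor of its edge. -/
def sideOp (b : Bool) : DualAlg W →ₗ[ℂ] Module.End ℂ W := if b then Tminus else Tplus

theorem faceLetter_tprod (d : E × Bool) (χ : DualAlg W) (x : E → W) :
    faceLetter d χ (PiTensorProduct.tprod ℂ x) =
      PiTensorProduct.tprod ℂ (Function.update x d.1 (sideOp d.2 χ (x d.1))) :=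
  onEdge_tprod _ _ _

/-- The order of the list is immaterial because `T₊` and `T₋` on one edge commute. -/
theorem prod_faceLetter_tprod_aux (θ : E × Bool → DualAlg W) {l : List (E × Bool)} (hl : l.Nodup)
    (x : E → W) :
    (l.map fun d => faceLetter d (θ d)).prod (PiTensorProduct.tprod ℂ x) =
      PiTensorProduct.tprod ℂ fun e =>
        (if (e, true) ∈ l then Tminus (θ (e, true)) else 1)
          ((if (e, false) ∈ l then Tplus (θ (e, false)) else 1) (x e)) := by
  induction l with
  | nil => simp
  | cons d l ih =>
    obtain ⟨hd, hl'⟩ := List.nodup_cons.1 hl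
    rw [List.map_cons, List.prod_cons, Module.End.mul_apply, ih hl', faceLetter_tprod]
    congr 1
    ext e
    obtain ⟨e₀, b⟩ := d
    by_cases he : e = e₀
    · subst he
      cases b
      · have := LinearMap.congr_fun
          (Tplus_comm_Tminus (θ (e, false)) (if (e, true) ∈ l then θ (e, true) else 1)).eq (x e)
        by_cases ht : (e, true) ∈ l
        · rw [if_pos ht] at this
          simpa [hd, ht, sideOp] using this
        · simp [hd, ht, sideOp]
      · simp [hd, sideOp]
    · simp [he]

theorem prod_faceLetter_tprod (θ : E × Bool → DualAlg W) {l : List (E × Bool)} (hl : l.Nodup)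
    (hl' : ∀ d, d ∈ l) (x : E → W) :
    (l.map fun d => faceLetter d (θ d)).prod (PiTensorProduct.tprod ℂ x) =
      PiTensorProduct.tprod ℂ fun e => Tminus (θ (e, true)) (Tplus (θ (e, false)) (x e)) := by
  rw [prod_faceLetter_tprod_aux θ hl]; simp [hl']

/-- The two operators leave the middle leg of the threefold coproduct on the edge. Cyclic invariance
makes it the first leg, as in the tensor network state. -/
theorem Tminus_Tplus_apply {h : W} (hc : IsCocommutativeElement h) (χ ψ : DualAlg W) :
    Tminus χ (Tplus ψ h) = sw h fun a b => sw b fun c d => (χ (𝓢 d) * ψ c) • a := by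
  rw [← Module.End.mul_apply, ← (Tplus_comm_Tminus ψ χ).eq, Module.End.mul_apply, Tminus_apply,
    ← hc.sw_cycle (fun a c d => (χ (𝓢 d) * ψ c) • a) (by fun_prop) (by fun_prop) (by fun_prop),
    Lin.map_sw (F := fun z => Tplus ψ z) (by fun_prop)]
  refine sw_congr fun a b => ?_
  rw [map_smul, Tplus_apply, Lin.map_sw (F := fun z : W => χ (𝓢 a) • z) (by fun_prop)]
  simp only [smul_smul]

theorem sweedler_eval (l : List (E × Bool)) (y : E × Bool → W) (χ : DualAlg W) :
    sweedler (l.map fun d => LinearMap.applyₗ (R := ℂ) (M₂ := ℂ) (y d) ∘ₗ (toDual W).toLinearMap) χ =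
      χ ((l.map y).prod) := by
  induction l generalizing χ with
  | nil => rw [List.map_nil, sweedler_nil, smul_eq_mul, mul_one]; rfl
  | cons d l ih =>
    rw [List.map_cons, sweedler_cons, List.map_cons, List.prod_cons, ← sw_dual_apply]
    exact sw_congr fun α β => by rw [ih]; rfl

theorem antipode_prod_reverse (l : List (E × Bool)) (y : E × Bool → W) :
    (𝓢 ((l.reverse.map y).prod) : W) = (l.map fun d => 𝓢 (y d)).prod := by
  induction l with
  | nil => simp [antipode_one]
  | cons d l ih => simp [antipode_mul, ← ih]

/-- Invariance of `φ` under `S` turns the clockwise product into the counterclockwise product of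
antipodes, the order used by the face operators. -/
theorem faceEval_eq {φ : DualAlg W} (hφ : ∀ x, φ (𝓢 x) = φ x) (L : DirectedLattice E) (s : L.Site)
    (y : E × Bool → W) :
    faceEval L s φ y = φ (((L.faceOrder s).map fun d => 𝓢 (y d)).prod) := by
  rw [faceEval, sweedler_eval, ← hφ, antipode_prod_reverse]

variable [Fintype E]

theorem list_prod_eq_prod_edges {l : List (E × Bool)} (hl : l.Nodup) (hl' : ∀ d, d ∈ l)
    (g : E × Bool → ℂ) : (l.map g).prod = ∏ e, g (e, true) * g (e, false) := by
  rw [← List.prod_toFinset g hl, (Finset.eq_univ_iff_forall.2 fun d => by simp [hl'] :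
    l.toFinset = Finset.univ), Fintype.prod_prod_type]
  simp

/-- The values that are attached to the sides of the edges in the definition of a tensor network
state, up to the antipode. -/
def sideValue (h : W) (i j : E → W × W) (d : E × Bool) : W :=
  if d.2 then 𝓢 ((ℛ ℂ ((ℛ ℂ h).right (i d.1))).right (j d.1))
    else (ℛ ℂ ((ℛ ℂ h).right (i d.1))).left (j d.1)

/-- The state with coefficients `G`. -/
def networkSum (h : W) (G : (E × Bool → W) → ℂ) : TotalSpace W E :=
  ∑ i ∈ Fintype.piFinset fun _ : E => (ℛ ℂ h).index,
    (∑ j ∈ Fintype.piFinset fun e => (ℛ ℂ ((ℛ ℂ h).right (i e))).index, G (sideValue h i j)) •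
      PiTensorProduct.tprod ℂ fun e => (ℛ ℂ h).left (i e)

theorem networkSum_prod {h : W} (hc : IsCocommutativeElement h) (θ : E × Bool → DualAlg W) :
    networkSum h (fun Y => ∏ e, θ (e, true) (Y (e, true)) * θ (e, false) (Y (e, false))) =
      PiTensorProduct.tprod ℂ fun e : E => Tminus (θ (e, true)) (Tplus (θ (e, false)) h) := by
  simp only [Tminus_Tplus_apply hc]
  simp only [sw]
  rw [MultilinearMap.map_sum_finset, networkSum]
  refine Finset.sum_congr rfl fun i _ => ?_
  rw [MultilinearMap.map_sum_finset, Finset.sum_smul]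
  refine Finset.sum_congr rfl fun j _ => ?_
  rw [MultilinearMap.map_smul_univ]
  simp [sideValue]

/-- Both sides are linear in the pair, so pure words suffice. There the sum factors over the edges,
each carrying exactly one letter for either side. -/
theorem apply_eq_networkSum {h : W} (hc : IsCocommutativeElement h) {l : List (E × Bool)}
    (hl : l.Nodup) (hl' : ∀ d, d ∈ l)
    {p : Module.End ℂ (TotalSpace W E) × ((E × Bool → W) → ℂ)}
    (hp : p ∈ letterPairs (faceLetter (W := W)) l) :
    p.1 (PiTensorProduct.tprod ℂ fun _ => h) = networkSum h p.2 := by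
  induction hp using Submodule.span_induction with
  | mem p hp =>
    obtain ⟨θ, rfl⟩ := hp
    change (l.map fun d => faceLetter d (θ d)).prod _ = networkSum h fun Y => _
    simp only [list_prod_eq_prod_edges hl hl']
    rw [prod_faceLetter_tprod θ hl hl', networkSum_prod hc]
  | zero => simp [networkSum]
  | add p q _ _ hp hq =>
    simp [hp, hq, networkSum, Finset.sum_add_distrib, add_smul]
  | smul r p _ hp =>
    simp [hp, networkSum, Finset.smul_sum, ← Finset.mul_sum, mul_smul]

section Faces

variable (L : DirectedLattice E) (ts : L.Face → L.Site)

/-- The sides of all the faces. -/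
def allSides : List (E × Bool) :=
  (Finset.univ : Finset L.Face).toList.flatMap fun f => L.faceOrder (ts f)

/-- The product of the values of a functional on the faces. -/
def facesEval (φ : DualAlg W) (Y : E × Bool → W) : ℂ :=
  ((Finset.univ : Finset L.Face).toList.map fun f => φ (((L.faceOrder (ts f)).map Y).prod)).prod

/-- The product of the face operators. -/
def facesOp (φ : DualAlg W) : Module.End ℂ (TotalSpace W E) :=
  ((Finset.univ : Finset L.Face).toList.map fun f => faceOp L (ts f) φ).prod

variable {ts} (hts : ∀ f, Site.face (ts f) = f)
include hts

theorem mem_faceOrder_iff (f : L.Face) (d : E × Bool) :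
    d ∈ L.faceOrder (ts f) ↔ Site.face (L := L) d = f := by
  rw [faceOrder, mem_cycleList]
  conv_rhs => rw [← hts f]
  exact ⟨fun h => Quotient.sound h.symm, fun h => (Quotient.exact h).symm⟩

theorem disjoint_faceOrder {f f' : L.Face} (h : f ≠ f') :
    (L.faceOrder (ts f)).Disjoint (L.faceOrder (ts f')) := fun d hd hd' =>
  h (((mem_faceOrder_iff L hts f d).1 hd).symm.trans ((mem_faceOrder_iff L hts f' d).1 hd'))

theorem nodup_allSides : (allSides L ts).Nodup :=
  List.nodup_flatMap.2 ⟨fun _ _ => nodup_cycleList _ _,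
    (Finset.nodup_toList _).imp fun h => disjoint_faceOrder L hts h⟩

theorem mem_allSides (d : E × Bool) : d ∈ allSides L ts :=
  List.mem_flatMap.2 ⟨Site.face (L := L) d, by simp, (mem_faceOrder_iff L hts _ d).2 rfl⟩

theorem faces_mem_letterPairs (φ : DualAlg W) :
    (facesOp L ts φ, facesEval L ts φ) ∈ letterPairs (faceLetter (W := W)) (allSides L ts) :=
  list_prod_mem_letterPairs (Finset.nodup_toList _) (fun _ => nodup_cycleList _ _)
    (fun _ _ h => disjoint_faceOrder L hts h) φ

omit hts in
theorem tensorNetworkState_eq_networkSum {h : W} (hS : ∀ x : W, 𝓢 (𝓢 x) = x) {φ : DualAlg W}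
    (hφ : ∀ x, φ (𝓢 x) = φ x) :
    tensorNetworkState L ts (fun _ => h) (fun _ => φ) = networkSum h (facesEval L ts φ) := by
  refine Finset.sum_congr rfl fun i _ => ?_
  refine congrArg (· • _) (Finset.sum_congr rfl fun j _ => ?_)
  rw [facesEval, Finset.prod_map_toList]
  refine Finset.prod_congr rfl fun f _ => ?_
  rw [faceEval_eq hφ]
  refine congrArg (fun l : List W => φ l.prod) (List.map_congr_left fun d _ => ?_)
  unfold sideValue
  split_ifs
  · rfl
  -- On the right of an edge the antipode in the trace cancels the one caused by reversing the
  -- order.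
  · exact hS _

/-- The tensor network state is the image of a product state under the face operators. -/
theorem tensorNetworkState_eq {h : W} (hS : ∀ x : W, 𝓢 (𝓢 x) = x) (hc : IsCocommutativeElement h)
    {φ : DualAlg W} (hφ : ∀ x, φ (𝓢 x) = φ x) :
    tensorNetworkState L ts (fun _ => h) (fun _ => φ) =
      facesOp L ts φ (PiTensorProduct.tprod ℂ fun _ => h) := by
  rw [tensorNetworkState_eq_networkSum L hS hφ]
  exact (apply_eq_networkSum hc (nodup_allSides L hts) (mem_allSides L hts)
    (faces_mem_letterPairs L hts φ)).symm

end Faces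

end States

/-! ### The vertex operators fix the state -/

theorem mul_list_prod_of_mem {A : Type*} [Monoid A] {l : List A} (hc : ∀ x ∈ l, ∀ y ∈ l, Commute x y)
    {x : A} (hx : x ∈ l) (hxx : x * x = x) : x * l.prod = l.prod ∧ l.prod * x = l.prod := by
  have hcomm : Commute x l.prod := by
    clear hxx
    have : ∀ l' : List A, (∀ y ∈ l', Commute x y) → Commute x l'.prod := by
      intro l'
      induction l' with
      | nil => intro _; simp
      | cons y l' ih =>
        intro h
        rw [List.prod_cons]
        exact (h y (by simp)).mul_right (ih fun z hz => h z (by simp [hz]))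
    exact this l fun y hy => hc x hx y hy
  have hl : x * l.prod = l.prod := by
    clear hcomm
    induction l with
    | nil => simp at hx
    | cons y l ih =>
      rw [List.prod_cons]
      rcases List.mem_cons.1 hx with rfl | hx'
      · rw [← mul_assoc, hxx]
      · rw [← mul_assoc, (hc x hx y (by simp)).eq, mul_assoc,
          ih (fun z hz w hw => hc z (by simp [hz]) w (by simp [hw])) hx']
  exact ⟨hl, hcomm.eq ▸ hl⟩

namespace EdgeCalculus

variable {W : Type*} [Ring W] [Algebra ℂ W] [WeakHopfAlgebra W] [FiniteDimensional ℂ W]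

local notation "𝓢" => WeakHopfAlgebra.antipode

section Absorption

variable {E A : Type*} [DecidableEq E] [Ring A] [Algebra ℂ A]
variable {Lo : E × Bool → W →ₗ[ℂ] A} {To : E × Bool → DualAlg W →ₗ[ℂ] A} (hE : EdgeCalculus Lo To)
include hE

/-- The edge relation at `1` shows that a face letter carries a `Δ(1)` on its left. A right base
element multiplies the second leg of `Δ(1)`, which is an evaluation and commutes with constants. -/
theorem conv_to_lo_rightBase (d : E × Bool) {p : W} (hp : IsRightBase p) :
    WithConv.toConv (To d) * cst (DualAlg W) (Lo d p) = evalAt p * WithConv.toConv (To d) := by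
  have h₁ := hE.conv_to_lo d 1
  rw [hE.lo_one, cst_one, mul_one] at h₁
  rw [hE.conv_to_lo]
  conv_lhs => rw [← mul_one p, hp.sw_mul 1 (fun x y => cst (DualAlg W) (Lo d x) * evalAt y)
    (by fun_prop) (by fun_prop)]
  conv_rhs => rw [h₁, ← mul_assoc, sw_mul_left]
  refine congrArg (· * _) (sw_congr fun x y => ?_)
  rw [evalAt_mul, ← mul_assoc, (commute_cst_evalAt _ _).eq, mul_assoc]

/-- The relation `conv_to_lo_opp` solved for the opposite order: the additional evaluation at
`S(a⁽¹⁾)` cancels the one created by the relation, since `∑ a⁽²⁾S(a⁽¹⁾) ⊗ a⁽³⁾` reduces to `Δ(1)`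
times `a`. -/
theorem conv_to_lo_opp' (hS : ∀ x : W, 𝓢 (𝓢 x) = x) (d : E × Bool) (a : W) :
    WithConv.toConv (To d) * cst (DualAlg W) (Lo (opp d) a) =
      sw a fun x y => cst (DualAlg W) (Lo (opp d) y) * WithConv.toConv (To d) * evalAt (𝓢 x) := by
  have h₁ := hE.conv_to_lo_opp d 1
  rw [hE.lo_one, cst_one, one_mul] at h₁
  symm
  calc (sw a fun x y => cst (DualAlg W) (Lo (opp d) y) * WithConv.toConv (To d) * evalAt (𝓢 x))
      = sw a fun x y => sw y fun z w =>
          WithConv.toConv (To d) * (evalAt (z * 𝓢 x) * cst (DualAlg W) (Lo (opp d) w)) := by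
        refine sw_congr fun x y => ?_
        rw [← hE.conv_to_lo_opp, sw_mul_left, sw_mul_right]
        refine sw_congr fun z w => ?_
        rw [evalAt_mul, mul_assoc, mul_assoc, mul_assoc, (commute_cst_evalAt _ _).eq]
    _ = sw 1 fun p q =>
          WithConv.toConv (To d) * (evalAt p * cst (DualAlg W) (Lo (opp d) (q * a))) := by
        rw [← sw_assoc a (fun x z w => WithConv.toConv (To d) *
          (evalAt (z * 𝓢 x) * cst (DualAlg W) (Lo (opp d) w))), sw_mul_antipode_flip hS a
          (fun p q => WithConv.toConv (To d) * (evalAt p * cst (DualAlg W) (Lo (opp d) q)))] <;>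
          fun_prop
    _ = _ := by
        conv_rhs => rw [← h₁, sw_mul_left, sw_mul_right]
        exact sw_congr fun p q => by rw [hE.lo_mul, cst_mul, mul_assoc, mul_assoc]

theorem conv_to_lo_opp_leftBase (hS : ∀ x : W, 𝓢 (𝓢 x) = x) (d : E × Bool) {q : W}
    (hq : IsLeftBase q) :
    WithConv.toConv (To d) * cst (DualAlg W) (Lo (opp d) q) =
      WithConv.toConv (To d) * evalAt (𝓢 q) := by
  have h₁ := hE.conv_to_lo_opp' hS d 1
  rw [hE.lo_one, cst_one, mul_one] at h₁
  rw [hE.conv_to_lo_opp' hS]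
  conv_lhs => rw [← mul_one q, hq.sw_mul 1 (fun x y => cst (DualAlg W) (Lo (opp d) y) *
    WithConv.toConv (To d) * evalAt (𝓢 x)) (by fun_prop) (by fun_prop)]
  conv_rhs => rw [h₁, sw_mul_right]
  exact sw_congr fun x y => by rw [antipode_mul, evalAt_mul, mul_assoc, mul_assoc, mul_assoc]

theorem commute_conv_to_lo_opp (hS : ∀ x : W, 𝓢 (𝓢 x) = x) (d : E × Bool) {p : W}
    (hp : IsRightBase p) :
    Commute (WithConv.toConv (To d)) (cst (DualAlg W) (Lo (opp d) p)) := by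
  have h₁ := hE.conv_to_lo_opp' hS d 1
  rw [hE.lo_one, cst_one, mul_one] at h₁
  rw [Commute, SemiconjBy, hE.conv_to_lo_opp' hS]
  conv_lhs => rw [← mul_one p, hp.sw_mul 1 (fun x y => cst (DualAlg W) (Lo (opp d) y) *
    WithConv.toConv (To d) * evalAt (𝓢 x)) (by fun_prop) (by fun_prop)]
  conv_rhs => rw [h₁, sw_mul_left]
  exact sw_congr fun x y => by rw [hE.lo_mul, cst_mul]; simp only [mul_assoc]

/-- A face operator absorbs the separability element of the base algebra, acting on the two edges
at a corner of the face. -/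
theorem face_mul_corner [Finite E] (hS : ∀ x : W, 𝓢 (𝓢 x) = x) {φ : DualAlg W}
    (hφ : ∀ c, rshift c φ = lshift c φ) (L : DirectedLattice E) (s : L.Site) :
    sweedler ((L.faceOrder s).map To) φ * (sw 1 fun p q => Lo s p * Lo (L.rot s) q) =
      sweedler ((L.faceOrder s).map To) φ := by
  obtain ⟨X, hX⟩ : ∃ X, X = WithConv.toConv (sweedler ((L.faceOrder s).map To)) := ⟨_, rfl⟩
  have hφL : Lin fun z : WithConv (DualAlg W →ₗ[ℂ] A) => z φ := ⟨fun _ _ => rfl, fun _ _ => rfl⟩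
  -- The half-edge `L.rot s` is opposite to the last side of the face, so its letter meets that side
  -- first and becomes an evaluation on the right.
  have h₁ : ∀ q, IsLeftBase q → X * cst (DualAlg W) (Lo (L.rot s) q) = X * evalAt (𝓢 q) := by
    intro q hq
    obtain ⟨m, -, hm⟩ := cycleList_apply_eq L.faceRot (L.faceRot.symm s)
    rw [Equiv.apply_symm_apply] at hm
    have hy : opp (L.faceRot.symm s) = L.rot s :=
      (Equiv.symm_apply_eq _).1 (L.faceRot.apply_symm_apply s)
    rw [hX, faceOrder, hm, toConv_sweedler, List.map_append, List.map_append, List.prod_append,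
      List.map_singleton, List.map_singleton, List.prod_singleton, mul_assoc, ← hy,
      hE.conv_to_lo_opp_leftBase hS _ hq, mul_assoc]
  -- The letter at `s` passes every other side, even the other side of its own edge, and becomes an
  -- evaluation on the left at the first side.
  have h₂ : ∀ p, IsRightBase p → X * cst (DualAlg W) (Lo s p) = evalAt p * X := by
    intro p hp
    obtain ⟨m, hm, -⟩ := cycleList_apply_eq L.faceRot s
    have hd := nodup_cycleList L.faceRot s
    rw [hm] at hd
    have hc : ∀ m' : List (E × Bool), s ∉ m' → Commute
        ((m'.map To).map WithConv.toConv).prod (cst (DualAlg W) (Lo s p)) := by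
      intro m'
      induction m' with
      | nil => intro _; simp
      | cons y m' ih =>
        intro hs
        rw [List.map_cons, List.map_cons, List.prod_cons]
        refine Commute.mul_left ?_ (ih fun h => hs (by simp [h]))
        by_cases h : s.1 = y.1
        · have hy : s = opp y := by
            refine Prod.ext h ?_
            rcases Bool.eq_or_eq_not s.2 y.2 with h' | h'
            · exact absurd (Prod.ext h h' : s = y) fun e => hs (by simp [e])
            · exact h'
          rw [hy]; exact hE.commute_conv_to_lo_opp hS y hp
        · ext χ
          rw [cst_mul_apply, mul_cst_apply]
          exact (hE.to_lo_comm y s (fun e => h e.symm) χ p).eq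
    rw [hX, faceOrder, hm, toConv_sweedler, List.map_cons, List.map_cons, List.prod_cons, mul_assoc,
      (hc m (List.nodup_cons.1 hd).1).eq, ← mul_assoc, hE.conv_to_lo_rightBase s hp, mul_assoc]
  -- Traciality of `φ` joins the two evaluations into one at `∑ S(1⁽²⁾)1⁽¹⁾ = S(ε_R(1)) = 1`.
  have h₃ : (sw (1 : W) fun p q => 𝓢 q * p) = 1 := by
    have e := congrArg (fun z : W => (𝓢 z : W)) (sw_antipode_mul (1 : W))
    rw [Lin.map_sw (F := fun z : W => (𝓢 z : W)) (by fun_prop)] at e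
    simpa only [antipode_mul, hS, epsR_one, antipode_one] using e
  rw [show sweedler ((L.faceOrder s).map To) φ = X φ by rw [hX], sw_mul_left]
  calc (sw 1 fun p q => X φ * (Lo s p * Lo (L.rot s) q))
      = sw 1 fun p q => (evalAt (𝓢 q * p) * X : WithConv (DualAlg W →ₗ[ℂ] A)) φ := by
        refine sw_one_congr ?_ ?_ ?_ ?_ fun p q hp hq => ?_
        · fun_prop
        · fun_prop
        · exact fun q => Lin.comp (f := fun p => evalAt (𝓢 q * p) * X) hφL (by fun_prop)
        · exact fun p => Lin.comp (f := fun q => evalAt (𝓢 q * p) * X) hφL (by fun_prop)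
        · rw [← mul_assoc, ← mul_cst_apply, h₂ p hp, ← mul_cst_apply, mul_assoc, h₁ q hq, ← mul_assoc,
            mul_evalAt_apply, hφ, ← evalAt_mul_apply, ← mul_assoc, ← evalAt_mul]
    _ = X φ := by
        rw [← hφL.map_sw, ← sw_mul_right,
          ← Lin.map_sw (F := fun z : W => (evalAt z : WithConv (DualAlg W →ₗ[ℂ] A))) (by fun_prop),
          h₃, evalAt_one, one_mul]

end Absorption

section FixedVector

variable {E V : Type*} [DecidableEq E] [Finite E] [AddCommGroup V] [Module ℂ V]
variable {Lo : E × Bool → W →ₗ[ℂ] Module.End ℂ V} {To : E × Bool → DualAlg W →ₗ[ℂ] Module.End ℂ V}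
  (hE : EdgeCalculus Lo To)
include hE

/-- On `ψ` the first letter sees only `ε_L(k⁽¹⁾)`. Since `∑ ε_L(k⁽¹⁾) ⊗ k⁽²⁾ = ∑ S(1⁽¹⁾) ⊗ 1⁽²⁾k`,
it can be replaced by the legs of `Δ(1)` at the corner between the first two half-edges, which `P`
absorbs. Each round shortens the word by one letter. -/
theorem vertex_apply_aux (L : DirectedLattice E) {P : Module.End ℂ V}
    (hP : ∀ d, P * (sw 1 fun p q => Lo d p * Lo (L.rot d) q) = P) {ψ : V}
    (hψ : ∀ d k, Lo d k ψ = Lo d (epsL k) ψ) (n : ℕ) (d : E × Bool)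
    (hd : (iterList L.rot d (n + 1)).Nodup) (k : W) :
    P (sweedler ((iterList L.rot d (n + 1)).map Lo) k ψ) = P (Lo ((L.rot^[n]) d) k ψ) := by
  induction n generalizing d with
  | zero => simp [iterList, sweedler_singleton]
  | succ n ih =>
    have hd₀ := hd
    rw [iterList_succ] at hd ⊢
    obtain ⟨hd₁, hd₂⟩ := List.nodup_cons.1 hd
    rw [Function.iterate_succ_apply, ← ih (L.rot d) hd₂]
    obtain ⟨Q, hQ⟩ : ∃ Q, Q = sweedler ((iterList L.rot (L.rot d) (n + 1)).map Lo) := ⟨_, rfl⟩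
    have hcomm : ∀ a b, Commute (Lo d a) (Q b) := fun a b => by
      rw [hQ]
      refine commute_sweedler (fun g hg c => ?_) b
      obtain ⟨y, hy, rfl⟩ := List.mem_map.1 hg
      exact hE.lo_comm d y (fun e => hd₁ (e ▸ hy)) a c
    rw [List.map_cons, sweedler_cons, ← hQ]
    have e₁ : (sw k fun a b => Lo d a * Q b) ψ = (sw 1 fun p q => Lo d p * Lo (L.rot d) q) (Q k ψ) := by
      rw [Lin.map_sw (F := fun z : Module.End ℂ V => z ψ) (by fun_prop),
        Lin.map_sw (F := fun z : Module.End ℂ V => z (Q k ψ)) (by fun_prop)]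
      calc (sw k fun a b => (Lo d a * Q b) ψ) = sw k fun a b => Q b (Lo d (epsL a) ψ) :=
            sw_congr fun a b => by rw [(hcomm a b).eq, Module.End.mul_apply, hψ]
        _ = sw 1 fun p q => Q (q * k) (Lo d (𝓢 p) ψ) := by
            rw [sw_epsL_left k (fun a b => Q b (Lo d a ψ))] <;> fun_prop
        _ = _ := by
            refine sw_one_congr ?_ ?_ ?_ ?_ fun p q hp hq => ?_
            · fun_prop
            · fun_prop
            · fun_prop
            · fun_prop
            · rw [← hp.epsL_eq, ← hψ, ← Module.End.mul_apply, ← (hcomm p _).eq, hQ, iterList_succ,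
                hE.vertex_leftBase_mul hq]
              rfl
    rw [e₁, ← Module.End.mul_apply, hP]

theorem vertex_apply (L : DirectedLattice E) {P : Module.End ℂ V}
    (hP : ∀ d, P * (sw 1 fun p q => Lo d p * Lo (L.rot d) q) = P) {ψ : V}
    (hψ : ∀ d k, Lo d k ψ = Lo d (epsL k) ψ) {h : W} (hh : epsL h = 1) (s : L.Site) :
    P (sweedler ((L.vertexOrder s).map Lo) h ψ) = P ψ := by
  obtain ⟨n, hn⟩ := exists_minimalPeriod_eq L.rot (L.rot s)
  have hd := nodup_cycleList L.rot (L.rot s)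
  rw [vertexOrder, cycleList_eq, hn] at *
  rw [hE.vertex_apply_aux L hP hψ n _ hd, hψ, hh, hE.lo_one, Module.End.one_apply]

end FixedVector

end EdgeCalculus

/-! ### Invariance of the tensor network state -/

section StateFixed

variable {W : Type*} [Ring W] [Algebra ℂ W] [WeakHopfAlgebra W] [FiniteDimensional ℂ W]
variable {E : Type*} [DecidableEq E] [Fintype E]

local notation "𝓢" => WeakHopfAlgebra.antipode

variable {h : W} (hh : IsCocommutativeHaar h) {φ : DualAlg W} (hφ : IsHaarIntegral φ)
  (L : DirectedLattice E)
include hh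

/-- For `L₊` this is the left integral property of `h`. For `L₋` it is the right one, because
`ε_R(S(k)) = S(ε_L(k))`. -/
theorem vertexLetter_tprod (d : E × Bool) (k : W) :
    vertexLetter d k (PiTensorProduct.tprod ℂ fun _ : E => h) =
      vertexLetter d (epsL k) (PiTensorProduct.tprod ℂ fun _ => h) := by
  obtain ⟨e, b⟩ := d
  refine (onEdge_tprod e _ _).trans (Eq.trans ?_ (onEdge_tprod e _ _).symm)
  congr 2
  cases b
  · exact hh.left_integral k
  · exact (Lminus_apply hh.antipode_antipode k h).trans
      (Eq.trans (by rw [hh.right_integral, epsR_antipode])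
        (Lminus_apply hh.antipode_antipode (epsL k) h).symm)

include hφ

theorem rshift_eq_lshift (c : W) : rshift c φ = lshift c φ := by
  ext x; exact dualHaar_mul_comm hh hφ x c

theorem vertexOp_mul_self (s : L.Site) : vertexOp L s h * vertexOp L s h = vertexOp L s h :=
  sweedler_cycleList_mul_self (edgeCalculus hh.antipode_antipode).lo_comm _
    WeakHopfAlgebra.comul_mul (edgeCalculus hh.antipode_antipode).lo_mul hh.mul_self _

theorem faceOp_mul_self (s : L.Site) : faceOp L s φ * faceOp L s φ = faceOp L s φ :=
  sweedler_cycleList_mul_self (edgeCalculus hh.antipode_antipode).to_comm _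
    dual_comul_mul (edgeCalculus hh.antipode_antipode).to_mul (dualHaar_mul_self hφ) _

theorem commute_vertexOp (s s' : L.Site) : Commute (vertexOp L s h) (vertexOp L s' h) :=
  commute_sweedler_cycleList (edgeCalculus hh.antipode_antipode).lo_comm _ hh.cocomm _ _

theorem commute_faceOp (s s' : L.Site) : Commute (faceOp L s φ) (faceOp L s' φ) :=
  commute_sweedler_cycleList (edgeCalculus hh.antipode_antipode).to_comm _
    (isCocommutativeElement_dualHaar hh hφ) _ _

theorem commute_faceOp_vertexOp (s s' : L.Site) : Commute (faceOp L s φ) (vertexOp L s' h) :=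
  (edgeCalculus hh.antipode_antipode).commute_face_vertex hh (isCocommutativeElement_dualHaar hh hφ)
    (rshift_eq_lshift hh hφ) L s s'

variable (ts : L.Face → L.Site) (hts : ∀ f, Site.face (ts f) = f)
include hts

theorem faceOp_mul_facesOp (s : L.Site) :
    faceOp L s φ * facesOp L ts φ = facesOp L ts φ ∧
      facesOp L ts φ * faceOp L s φ = facesOp L ts φ := by
  refine mul_list_prod_of_mem (fun x hx y hy => ?_) ?_ (faceOp_mul_self hh hφ L s)
  · obtain ⟨f, -, rfl⟩ := List.mem_map.1 hx
    obtain ⟨g, -, rfl⟩ := List.mem_map.1 hy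
    exact commute_faceOp hh hφ L _ _
  · refine List.mem_map.2 ⟨Site.face s, by simp, ?_⟩
    exact sweedler_cycleList_eq (edgeCalculus hh.antipode_antipode).to_comm _
      (isCocommutativeElement_dualHaar hh hφ) (Quotient.exact (hts (Site.face s)).symm)

theorem faceOp_tensorNetworkState (s : L.Site) :
    faceOp L s φ (tensorNetworkState L ts (fun _ => h) (fun _ => φ)) =
      tensorNetworkState L ts (fun _ => h) (fun _ => φ) := by
  rw [tensorNetworkState_eq L hts hh.antipode_antipode hh.cocomm (dualHaar_antipode hh hφ),
    ← Module.End.mul_apply, (faceOp_mul_facesOp hh hφ L ts hts s).1]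

theorem vertexOp_tensorNetworkState (s : L.Site) :
    vertexOp L s h (tensorNetworkState L ts (fun _ => h) (fun _ => φ)) =
      tensorNetworkState L ts (fun _ => h) (fun _ => φ) := by
  have hE := edgeCalculus (E := E) hh.antipode_antipode
  rw [tensorNetworkState_eq L hts hh.antipode_antipode hh.cocomm (dualHaar_antipode hh hφ)]
  have hc : Commute (vertexOp L s h) (facesOp L ts φ) := by
    refine Commute.list_prod_right _ _ fun x hx => ?_
    obtain ⟨f, -, rfl⟩ := List.mem_map.1 hx
    exact (commute_faceOp_vertexOp hh hφ L _ _).symm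
  rw [← Module.End.mul_apply, hc.eq, Module.End.mul_apply]
  refine hE.vertex_apply L (fun d => ?_) (vertexLetter_tprod hh) hh.left_normalized s
  -- The product of all face operators absorbs a further copy of the one at the corner `d`, and this
  -- copy absorbs the `Δ(1)` placed there.
  have := (faceOp_mul_facesOp hh hφ L ts hts d).2
  rw [← this, mul_assoc]
  exact congrArg (facesOp L ts φ * ·)
    (hE.face_mul_corner hh.antipode_antipode (rshift_eq_lshift hh hφ) L d)

end StateFixed

/-! ### Matrix units -/

section Semisimple

variable {W : Type*} [Ring W] [Algebra ℂ W] [WeakHopfAlgebra W] [FiniteDimensional ℂ W]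

local notation "𝓢" => WeakHopfAlgebra.antipode

theorem regTrace_eq_zero_of_isNilpotent {x : W} (hx : IsNilpotent x) : regTrace W x = 0 := by
  obtain ⟨n, hn⟩ := hx
  refine IsNilpotent.eq_zero (LinearMap.isNilpotent_trace_of_isNilpotent ⟨n, ?_⟩)
  exact (map_pow (Algebra.lmul ℂ W) x n).symm.trans (by rw [hn, map_zero])

/-- For `x` in the Jacobson radical every `S(h⁽¹⁾)x` is nilpotent, so all coefficients in `x = ∑
τ(S(h⁽¹⁾)x) h⁽²⁾` vanish. -/
theorem IsCocommutativeHaar.isSemisimpleRing {h : W} (hh : IsCocommutativeHaar h) :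
    IsSemisimpleRing W := by
  have : IsArtinianRing W := IsArtinianRing.of_finite ℂ W
  rw [IsArtinianRing.isSemisimpleRing_iff_jacobson, eq_bot_iff]
  intro x hx
  obtain ⟨n, hn⟩ := IsSemiprimaryRing.isNilpotent (R := W)
  rw [Ideal.mem_bot, ← hh.sw_regTrace x]
  refine Finset.sum_eq_zero fun i _ => ?_
  dsimp only
  rw [regTrace_eq_zero_of_isNilpotent, zero_smul]
  refine ⟨n, ?_⟩
  have := Ideal.pow_mem_pow ((Ring.jacobson W).mul_mem_left
    (𝓢 ((ℛ ℂ h).left i) : W) hx) n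
  rw [hn] at this
  exact this

end Semisimple

section MatrixUnits

variable {W : Type*} [Ring W] [Algebra ℂ W]
variable {k : ℕ} {n : Fin k → ℕ} (Φ : W ≃ₐ[ℂ] Π i, Matrix (Fin (n i)) (Fin (n i)) ℂ)

/-- The matrix units of an algebra that is identified with a product of matrix algebras. -/
def matUnit (i : Fin k) (a b : Fin (n i)) : W := Φ.symm (Pi.single i (Matrix.single a b 1))

theorem apply_matUnit (i : Fin k) (a b : Fin (n i)) :
    Φ (matUnit Φ i a b) = Pi.single i (Matrix.single a b 1) := Φ.apply_symm_apply _

theorem matUnit_mul (i : Fin k) (a b : Fin (n i)) (x : W) :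
    matUnit Φ i a b * x = ∑ c, Φ x i b c • matUnit Φ i a c := by
  apply Φ.injective
  rw [map_mul, map_sum]
  simp only [map_smul, apply_matUnit]
  ext j p q
  simp only [Pi.mul_apply, Finset.sum_apply, Pi.smul_apply, Matrix.sum_apply]
  by_cases h : j = i
  · subst h
    simp [Matrix.mul_apply, Matrix.single_apply, ite_and, Matrix.smul_apply]
  · simp [h]

theorem mul_matUnit (i : Fin k) (a b : Fin (n i)) (x : W) :
    x * matUnit Φ i a b = ∑ c, Φ x i c a • matUnit Φ i c b := by
  apply Φ.injective
  rw [map_mul, map_sum]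
  simp only [map_smul, apply_matUnit]
  ext j p q
  simp only [Pi.mul_apply, Finset.sum_apply, Pi.smul_apply, Matrix.sum_apply]
  by_cases h : j = i
  · subst h
    simp [Matrix.mul_apply, Matrix.single_apply, ite_and, Matrix.smul_apply]
  · simp [h]

theorem matUnit_mul_matUnit (i : Fin k) (a b c d : Fin (n i)) :
    matUnit Φ i a b * matUnit Φ i c d = if b = c then matUnit Φ i a d else 0 := by
  apply Φ.injective
  rw [map_mul, apply_matUnit, apply_matUnit, ← Pi.single_mul]
  split_ifs with h
  · subst h; simp [apply_matUnit]
  · simp [h]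

theorem eq_sum_matUnit (x : W) : x = ∑ i, ∑ a, ∑ b, Φ x i a b • matUnit Φ i a b := by
  apply Φ.injective
  simp only [map_sum, map_smul, apply_matUnit]
  ext j p q
  simp only [Finset.sum_apply, Pi.smul_apply, Matrix.sum_apply]
  rw [Finset.sum_eq_single j]
  · simp [Matrix.single_apply, ite_and]
  · intro i _ hi
    simp [hi.symm]
  · simp

theorem mul_matUnit_of_central {u : W} (hu : ∀ x, u * x = x * u) [∀ i, NeZero (n i)] (i : Fin k)
    (a b : Fin (n i)) : u * matUnit Φ i a b = Φ u i 0 0 • matUnit Φ i a b := by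
  have : matUnit Φ i a b = matUnit Φ i a 0 * matUnit Φ i 0 b := by simp [matUnit_mul_matUnit]
  conv_lhs => rw [this, ← mul_assoc, hu, mul_assoc, mul_matUnit, Finset.mul_sum]
  simp [matUnit_mul_matUnit]

/-- The indices of the matrix units. -/
abbrev UnitIndex (n : Fin k → ℕ) : Type := Σ i : Fin k, Fin (n i) × Fin (n i)

/-- The index of the transposed matrix unit. -/
def UnitIndex.swap (l : UnitIndex n) : UnitIndex n := ⟨l.1, l.2.swap⟩

/-- The matrix unit with a given index. -/
def unit (l : UnitIndex n) : W := matUnit Φ l.1 l.2.1 l.2.2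

theorem sum_unit_mul {M : Type*} [AddCommGroup M] [Module ℂ M] (f : W → W → M)
    (h₁ : ∀ b, Lin fun a => f a b) (h₂ : ∀ a, Lin fun b => f a b) (x : W) :
    ∑ l : UnitIndex n, (n l.1 : ℂ)⁻¹ • f (unit Φ l * x) (unit Φ l.swap) =
      ∑ l : UnitIndex n, (n l.1 : ℂ)⁻¹ • f (unit Φ l) (x * unit Φ l.swap) := by
  simp only [Fintype.sum_sigma, Fintype.sum_prod_type, unit, UnitIndex.swap, Prod.fst_swap,
    Prod.snd_swap]
  refine Finset.sum_congr rfl fun i _ => Finset.sum_congr rfl fun a _ => ?_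
  simp only [matUnit_mul, mul_matUnit, (h₁ _).map_sum', (h₂ _).map_sum', (h₁ _).map_smul,
    (h₂ _).map_smul, Finset.smul_sum]
  exact Finset.sum_comm

/-- The weights `nᵢ⁻¹` compensate for the `nᵢ` ways of obtaining each diagonal unit as a product
`e_ab e_ba`. -/
theorem sum_unit_mul_unit [∀ i, NeZero (n i)] :
    ∑ l : UnitIndex n, (n l.1 : ℂ)⁻¹ • (unit Φ l * unit Φ l.swap) = 1 := by
  simp only [Fintype.sum_sigma, Fintype.sum_prod_type, unit, UnitIndex.swap, Prod.fst_swap,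
    Prod.snd_swap, matUnit_mul_matUnit, if_true, Finset.sum_const, Finset.card_univ,
    Fintype.card_fin]
  rw [eq_sum_matUnit Φ 1]
  refine Finset.sum_congr rfl fun i _ => Finset.sum_congr rfl fun a _ => ?_
  have : (n i : ℂ) ≠ 0 := Nat.cast_ne_zero.2 (NeZero.ne _)
  rw [map_one, Finset.sum_eq_single a]
  · rw [← Nat.cast_smul_eq_nsmul ℂ, smul_smul, mul_inv_cancel₀ this]; simp
  · intro b _ hb
    simp [hb.symm]
  · simp

/-- A central element acts on a matrix unit by a scalar. -/
def blockScalar [∀ i, NeZero (n i)] (u : W) (l : UnitIndex n) : ℂ := Φ u l.1 0 0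

theorem mul_unit_of_central {u : W} (hu : ∀ x, u * x = x * u) [∀ i, NeZero (n i)]
    (l : UnitIndex n) : u * unit Φ l = blockScalar Φ u l • unit Φ l :=
  mul_matUnit_of_central Φ hu _ _ _

theorem blockScalar_swap [∀ i, NeZero (n i)] (u : W) (l : UnitIndex n) :
    blockScalar Φ u l.swap = blockScalar Φ u l := rfl

/-- Matrix units with entries in the natural numbers. -/
def natUnit (l : UnitIndex n) : Π i, Matrix (Fin (n i)) (Fin (n i)) ℕ :=
  Pi.single l.1 (Matrix.single l.2.1 l.2.2 1)

/-- The weighted trace `∑ᵢ nᵢ tr`. -/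
def natTrace (m : Π i, Matrix (Fin (n i)) (Fin (n i)) ℕ) : ℕ := ∑ i, n i * (m i).trace

/-- The inclusion of the matrices with natural entries. -/
def castMatrix : (Π i, Matrix (Fin (n i)) (Fin (n i)) ℕ) →+* Π i, Matrix (Fin (n i)) (Fin (n i)) ℂ :=
  RingHom.pi fun i => (Nat.castRingHom ℂ).mapMatrix.comp (Pi.evalRingHom _ i)

theorem castMatrix_apply (m : Π i, Matrix (Fin (n i)) (Fin (n i)) ℕ) (i : Fin k) (a b : Fin (n i)) :
    castMatrix m i a b = m i a b := rfl

theorem unit_eq_castMatrix (l : UnitIndex n) : unit Φ l = Φ.symm (castMatrix (natUnit l)) := by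
  rw [unit, matUnit]
  congr 1
  ext i a b
  rw [castMatrix_apply, natUnit]
  by_cases h : i = l.1
  · subst h
    simp [Matrix.single_apply]
  · simp [h]

theorem natTrace_pos [∀ i, NeZero (n i)] (i : Fin k) (q : ℕ) :
    0 < natTrace ((natUnit (n := n) ⟨i, 0, 0⟩) ^ (q + 1)) := by
  have h : ∀ q, ((natUnit (n := n) ⟨i, 0, 0⟩) ^ (q + 1)) = natUnit (n := n) ⟨i, 0, 0⟩ := by
    intro q
    induction q with
    | zero => simp
    | succ q ih => rw [pow_succ, ih, natUnit, ← Pi.single_mul]; simp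
  rw [h, natTrace]
  refine Finset.sum_pos' (fun _ _ => Nat.zero_le _) ⟨i, Finset.mem_univ _, ?_⟩
  simp [natUnit, Nat.pos_of_neZero]

end MatrixUnits

/-! ### The Haar integral and the regular trace in matrix units -/

section HaarMatrixUnits

variable {W : Type*} [Ring W] [Algebra ℂ W] [WeakHopfAlgebra W] [FiniteDimensional ℂ W]
variable {M : Type*} [AddCommGroup M] [Module ℂ M]
variable {k : ℕ} {n : Fin k → ℕ} [∀ i, NeZero (n i)]
  (Φ : W ≃ₐ[ℂ] Π i, Matrix (Fin (n i)) (Fin (n i)) ℂ)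

local notation "𝓢" => WeakHopfAlgebra.antipode

namespace IsCocommutativeHaar

variable {h : W} (hh : IsCocommutativeHaar h)
include hh

/-- The separability idempotent `∑ h⁽¹⁾ ⊗ S(h⁽²⁾)` in terms of matrix units. -/
theorem sw_eq_sum_unit (f : W → W → M) (h₁ : ∀ b, Lin fun a => f a b)
    (h₂ : ∀ a, Lin fun b => f a b) :
    (sw h fun p q => f p (𝓢 q)) =
      ∑ l : UnitIndex n, (n l.1 : ℂ)⁻¹ • f (unit Φ l) (unit Φ l.swap) := by
  have hS := hh.antipode_antipode
  have e₁ : ∀ m a : W, (sw h fun p q => f (m * a * p) (𝓢 q)) =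
      sw h fun p q => f (m * p) (𝓢 q * a) := fun m a => by
    have := hh.sw_mul_right (𝓢 a) (fun p q => f (m * p) (𝓢 q)) (by fun_prop) (by fun_prop)
    simp only [antipode_mul, hS, ← mul_assoc] at this
    exact this.symm
  have e₂ : (sw h fun p q => (𝓢 q : W) * p) = 1 := by
    rw [hh.cocomm.sw_swap (fun p q => (𝓢 p : W) * q) (by fun_prop) (by fun_prop), sw_antipode_mul,
      hh.right_normalized]
  -- Two symmetric separability elements are compared by inserting one into the other. The unit is
  -- expanded in matrix units, the second unit slides through `h`, then `S(h⁽²⁾)h⁽¹⁾` slides through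
  -- the matrix units and contracts to `1`.
  calc (sw h fun p q => f p (𝓢 q))
      = sw h fun p q => f ((∑ l : UnitIndex n, (n l.1 : ℂ)⁻¹ • (unit Φ l * unit Φ l.swap)) * p)
          (𝓢 q) := by
        simp only [sum_unit_mul_unit, one_mul]
    _ = ∑ l : UnitIndex n, (n l.1 : ℂ)⁻¹ • sw h fun p q => f (unit Φ l * unit Φ l.swap * p) (𝓢 q) := by
        simp only [Finset.sum_mul, smul_mul_assoc, (h₁ _).map_sum', (h₁ _).map_smul, sw,
          Finset.smul_sum]
        exact Finset.sum_comm
    _ = ∑ l : UnitIndex n, (n l.1 : ℂ)⁻¹ • sw h fun p q => f (unit Φ l * p) (𝓢 q * unit Φ l.swap) := by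
        simp only [e₁]
    _ = sw h fun p q => ∑ l : UnitIndex n, (n l.1 : ℂ)⁻¹ • f (unit Φ l * p) (𝓢 q * unit Φ l.swap) := by
        simp only [sw, Finset.smul_sum]
        exact Finset.sum_comm
    _ = sw h fun p q => ∑ l : UnitIndex n, (n l.1 : ℂ)⁻¹ • f (unit Φ l) (𝓢 q * p * unit Φ l.swap) := by
        refine sw_congr fun p q => ?_
        rw [sum_unit_mul Φ (fun a b => f a (𝓢 q * b)) (by fun_prop) (by fun_prop)]
        simp only [mul_assoc]
    _ = ∑ l : UnitIndex n, (n l.1 : ℂ)⁻¹ • sw h fun p q => f (unit Φ l) (𝓢 q * p * unit Φ l.swap) := by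
        simp only [sw, Finset.smul_sum]
        exact Finset.sum_comm
    _ = _ := by
        refine Finset.sum_congr rfl fun l _ => congrArg _ ?_
        rw [← Lin.map_sw (F := fun z : W => f (unit Φ l) (z * unit Φ l.swap)) (by fun_prop), e₂,
          one_mul]

/-- Expanding `1` in the dual bases for `τ` gives `∑ nᵢ⁻¹ τ(e_ab) e_ba = 1`; the values are the
coefficients of this identity. -/
theorem regTrace_matUnit (i : Fin k) (a b : Fin (n i)) :
    regTrace W (matUnit Φ i a b) = if a = b then (n i : ℂ) else 0 := by
  have e : ∑ l : UnitIndex n, (n l.1 : ℂ)⁻¹ • (regTrace W (unit Φ l) • unit Φ l.swap) = 1 := by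
    rw [← hh.sw_eq_sum_unit Φ (fun p q => regTrace W p • q) (by fun_prop) (by fun_prop)]
    have := congrArg (fun z : W => (𝓢 z : W)) (hh.sw_regTrace 1)
    simp only [mul_one, hh.regTrace_antipode] at this
    rw [Lin.map_sw (F := fun z : W => (𝓢 z : W)) (by fun_prop), antipode_one] at this
    simpa only [map_smul] using this
  have := congrFun (congrFun (congrFun (congrArg Φ e) i) b) a
  have hn : (n i : ℂ) ≠ 0 := Nat.cast_ne_zero.2 (NeZero.ne _)
  simp only [Fintype.sum_sigma, Fintype.sum_prod_type, unit, UnitIndex.swap, Prod.fst_swap,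
    Prod.snd_swap, map_sum, map_smul, apply_matUnit, Finset.sum_apply, Pi.smul_apply, Matrix.sum_apply,
    map_one] at this
  rw [Finset.sum_eq_single i (fun j _ hj => by simp [hj.symm]) (by simp)] at this
  simp only [Pi.single_eq_same, Matrix.smul_apply, Matrix.single_apply, ite_and, smul_eq_mul, mul_ite,
    mul_one, mul_zero, Finset.sum_ite_eq', Finset.mem_univ, if_true, Pi.one_apply,
    Matrix.one_apply] at this
  rw [inv_mul_eq_iff_eq_mul₀ hn] at this
  rw [this]
  simp [eq_comm]

theorem regTrace_castMatrix (m : Π i, Matrix (Fin (n i)) (Fin (n i)) ℕ) :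
    regTrace W (Φ.symm (castMatrix m)) = natTrace m := by
  conv_lhs => rw [eq_sum_matUnit Φ (Φ.symm (castMatrix m))]
  simp only [map_sum, map_smul, hh.regTrace_matUnit, AlgEquiv.apply_symm_apply, castMatrix_apply,
    natTrace, Matrix.trace, Matrix.diag]
  push_cast
  refine Finset.sum_congr rfl fun i _ => ?_
  rw [Finset.mul_sum]
  refine Finset.sum_congr rfl fun a _ => ?_
  simp [mul_comm]

end IsCocommutativeHaar

end HaarMatrixUnits

/-! ### The state is not zero -/

section NonZero

variable {W : Type*} [Ring W] [Algebra ℂ W] [WeakHopfAlgebra W] [FiniteDimensional ℂ W]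
variable {E : Type*} [DecidableEq E] [Fintype E]

local notation "𝓢" => WeakHopfAlgebra.antipode

/-- The product of functionals on the tensor factors. -/
def prodFunctional (ω : E → W →ₗ[ℂ] ℂ) : TotalSpace W E →ₗ[ℂ] ℂ :=
  PiTensorProduct.lift ((MultilinearMap.mkPiAlgebra ℂ E ℂ).compLinearMap ω)

theorem prodFunctional_tprod (ω : E → W →ₗ[ℂ] ℂ) (x : E → W) :
    prodFunctional ω (PiTensorProduct.tprod ℂ x) = ∏ e, ω e (x e) := by
  simp [prodFunctional]

/-- The functional `regTrace(S(·) x)`. -/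
def traceFunctional (x : W) : W →ₗ[ℂ] ℂ := regTrace W ∘ₗ LinearMap.mulRight ℂ x ∘ₗ 𝓢

theorem IsCocommutativeHaar.sw_traceFunctional {h : W} (hh : IsCocommutativeHaar h) (x : W)
    {g : W → ℂ} (hg : Lin g) : (sw h fun a b => traceFunctional x a * g b) = g x := by
  conv_rhs => rw [← hh.sw_regTrace x, hg.map_sw]
  exact sw_congr fun a b => by rw [hg.map_smul]; rfl

variable {k : ℕ} {n : Fin k → ℕ} [∀ i, NeZero (n i)]
  (Φ : W ≃ₐ[ℂ] Π i, Matrix (Fin (n i)) (Fin (n i)) ℂ)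

/-- The matrix unit at a side of an edge. -/
def sideUnit (J : E → UnitIndex n) (d : E × Bool) : W :=
  unit Φ (if d.2 then (J d.1).swap else J d.1)

/-- Contracting the first leg with `traceFunctional x` puts `x` in place of the second, so the
remaining legs are those of `h u^q`. The power of `u` acts by a scalar on each matrix unit. -/
theorem IsCocommutativeHaar.traceFunctional_apply {h : W} (hh : IsCocommutativeHaar h) {u : W}
    (hu : ∀ x, u * x = x * u)
    (huΔ : ∀ f : W → W → ℂ, (∀ b, Lin fun a => f a b) → (∀ a, Lin fun b => f a b) →
        ∀ x, sw (x * u) f = sw x fun a b => f (a * u) b) (q : ℕ) (χ ψ : DualAlg W) :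
    traceFunctional (h * u ^ q) (Tminus χ (Tplus ψ h)) =
      ∑ l : UnitIndex n, (n l.1 : ℂ)⁻¹ * blockScalar Φ u l ^ q * (χ (unit Φ l.swap) * ψ (unit Φ l)) := by
  have e : ∀ (q : ℕ) (f : W → W → ℂ), (∀ b, Lin fun a => f a b) → (∀ a, Lin fun b => f a b) →
      sw (h * u ^ q) f = sw h fun a b => f (a * u ^ q) b := by
    intro q
    induction q with
    | zero => intro f _ _; simp
    | succ q ih =>
      intro f h₁ h₂
      rw [pow_succ, ← mul_assoc, huΔ f h₁ h₂, ih (fun a b => f (a * u) b) (by fun_prop) (by fun_prop)]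
      simp only [mul_assoc]
  have hp : ∀ (q : ℕ) (l : UnitIndex n), unit Φ l * u ^ q = blockScalar Φ u l ^ q • unit Φ l := by
    intro q l
    induction q with
    | zero => simp
    | succ q ih =>
      rw [pow_succ, ← mul_assoc, ih, smul_mul_assoc, ← hu, mul_unit_of_central Φ hu, smul_smul, pow_succ]
  rw [Tminus_Tplus_apply hh.cocomm, Lin.map_sw (F := fun z => traceFunctional (h * u ^ q) z) (by fun_prop)]
  calc _ = sw h fun a b => traceFunctional (h * u ^ q) a * sw b fun c d => χ (𝓢 d) * ψ c := by
        refine sw_congr fun a b => ?_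
        rw [Lin.map_sw (F := fun z => traceFunctional (h * u ^ q) z) (by fun_prop), sw_mul_left]
        simp only [map_smul, smul_eq_mul, mul_comm]
    _ = sw h fun c d => χ (𝓢 d) * ψ (c * u ^ q) := by
        rw [hh.sw_traceFunctional (h * u ^ q) (g := fun b => sw b fun c d => χ (𝓢 d) * ψ c)
          (by fun_prop), e] <;> fun_prop
    _ = _ := by
        rw [hh.sw_eq_sum_unit Φ (fun c d => χ d * ψ (c * u ^ q)) (by fun_prop) (by fun_prop)]
        refine Finset.sum_congr rfl fun l _ => ?_
        rw [hp, map_smul, smul_eq_mul, smul_eq_mul]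
        ring

theorem prodFunctional_networkSum {h : W} (hh : IsCocommutativeHaar h) {u : W}
    (hu : ∀ x, u * x = x * u)
    (huΔ : ∀ f : W → W → ℂ, (∀ b, Lin fun a => f a b) → (∀ a, Lin fun b => f a b) →
        ∀ x, sw (x * u) f = sw x fun a b => f (a * u) b) (q : E → ℕ) {l : List (E × Bool)}
    (hl : l.Nodup) (hl' : ∀ d, d ∈ l)
    {p : Module.End ℂ (TotalSpace W E) × ((E × Bool → W) → ℂ)}
    (hp : p ∈ letterPairs (faceLetter (W := W)) l) :
    prodFunctional (fun e => traceFunctional (h * u ^ q e)) (networkSum h p.2) =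
      ∑ J : E → UnitIndex n,
        (∏ e, ((n (J e).1 : ℂ)⁻¹ * blockScalar Φ u (J e) ^ q e)) * p.2 (sideUnit Φ J) := by
  induction hp using Submodule.span_induction with
  | mem p hp =>
    obtain ⟨θ, rfl⟩ := hp
    simp only [list_prod_eq_prod_edges hl hl']
    rw [networkSum_prod hh.cocomm, prodFunctional_tprod]
    simp only [hh.traceFunctional_apply Φ hu huΔ]
    rw [Finset.prod_univ_sum, Fintype.piFinset_univ]
    refine Finset.sum_congr rfl fun J _ => ?_
    rw [← Finset.prod_mul_distrib]
    rfl
  | zero => simp [networkSum]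
  | add p p' _ _ hp hp' =>
    have : networkSum (E := E) h (p + p').2 = networkSum h p.2 + networkSum h p'.2 := by
      simp [networkSum, Finset.sum_add_distrib, add_smul]
    rw [this, map_add, hp, hp', ← Finset.sum_add_distrib]
    refine Finset.sum_congr rfl fun J _ => ?_
    rw [← mul_add]; rfl
  | smul r p _ hp =>
    have : networkSum (E := E) h (r • p).2 = r • networkSum h p.2 := by
      simp [networkSum, Finset.smul_sum, ← Finset.mul_sum, mul_smul]
    rw [this, map_smul, hp, smul_eq_mul, Finset.mul_sum]
    refine Finset.sum_congr rfl fun J _ => ?_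
    rw [Prod.smul_snd, Pi.smul_apply, smul_eq_mul]; ring

/-- A suitable product functional takes the state to a sum over labellings of the edges by matrix
units, in which every term is a nonnegative real number and one is positive. -/
theorem tensorNetworkState_ne_zero [Nontrivial W] {h : W} (hh : IsCocommutativeHaar h)
    {φ : DualAlg W} (hφ : IsHaarIntegral φ) (L : DirectedLattice E) {ts : L.Face → L.Site}
    (hts : ∀ f, Site.face (ts f) = f) :
    tensorNetworkState L ts (fun _ => h) (fun _ => φ) ≠ 0 := by
  have := hh.isSemisimpleRing
  obtain ⟨k, n, _, ⟨Φ⟩⟩ := IsSemisimpleRing.exists_algEquiv_pi_matrix_of_isAlgClosed ℂ W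
  obtain ⟨u, v, huv, hu, -, hφv, huΔ⟩ := exists_central_of_isHaarIntegral hh hφ
  have hφu : ∀ x, φ (u * x) = regTrace W x := fun x => by
    rw [hφv, ← mul_assoc, ← hu, huv, one_mul]
  obtain ⟨i₀⟩ : Nonempty (Fin k) := by
    by_contra hk
    rw [not_nonempty_iff] at hk
    exact one_ne_zero (Φ.injective (Subsingleton.elim (Φ (1 : W)) (Φ 0)))
  intro h0
  -- One factor `u` for each face whose chosen site lies on the edge `e`. It multiplies the first
  -- letter of that face and converts `φ` into the regular trace.
  let q : E → ℕ := fun e => (Finset.univ.filter fun f : L.Face => (ts f).1 = e).card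
  -- Words of matrix units have natural entries, so their weighted traces are natural numbers,
  -- whatever the labelling.
  let N : (E → UnitIndex n) → L.Face → ℕ := fun J f =>
    natTrace ((L.faceOrder (ts f)).map fun d => natUnit (if d.2 then (J d.1).swap else J d.1)).prod
  have hN : ∀ J f, regTrace W (((L.faceOrder (ts f)).map (sideUnit Φ J)).prod) = N J f := by
    intro J f
    rw [← hh.regTrace_castMatrix Φ, map_list_prod castMatrix, map_list_prod Φ.symm, List.map_map,
      List.map_map]
    exact congrArg (fun l => regTrace W (List.prod l))
      (List.map_congr_left fun d _ => unit_eq_castMatrix Φ _)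
  have hval : ∀ J : E → UnitIndex n,
      (∏ e, ((n (J e).1 : ℂ)⁻¹ * blockScalar Φ u (J e) ^ q e)) * facesEval L ts φ (sideUnit Φ J) =
        (((∏ e, (n (J e).1 : ℝ)⁻¹) * ∏ f, (N J f : ℝ) : ℝ) : ℂ) := by
    intro J
    have hq : (∏ e, blockScalar Φ u (J e) ^ q e) = ∏ f, blockScalar Φ u (J (ts f).1) := by
      rw [← Finset.prod_fiberwise (s := Finset.univ) (g := fun f : L.Face => (ts f).1)]
      refine Finset.prod_congr rfl fun e _ => ?_
      rw [Finset.prod_congr rfl fun f hf => by rw [(Finset.mem_filter.1 hf).2], Finset.prod_const]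
    rw [facesEval, Finset.prod_map_toList, Finset.prod_mul_distrib, hq, mul_assoc,
      ← Finset.prod_mul_distrib]
    push_cast
    refine congrArg _ (Finset.prod_congr rfl fun f _ => ?_)
    rw [← hN, ← hφu]
    obtain ⟨m, hm, -⟩ := cycleList_apply_eq L.faceRot (ts f)
    have : blockScalar Φ u (J (ts f).1) • sideUnit Φ J (ts f) = u * sideUnit Φ J (ts f) := by
      rw [sideUnit, mul_unit_of_central Φ hu]
      split_ifs
      · rw [blockScalar_swap]
      · rfl
    rw [faceOrder, hm, List.map_cons, List.prod_cons, ← smul_eq_mul, ← map_smul, ← smul_mul_assoc,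
      this, mul_assoc]
  have key := prodFunctional_networkSum Φ hh hu huΔ q (nodup_allSides L hts) (mem_allSides L hts)
    (faces_mem_letterPairs L hts φ)
  simp only at key
  rw [← tensorNetworkState_eq_networkSum L hh.antipode_antipode (dualHaar_antipode hh hφ), h0, map_zero,
    Finset.sum_congr rfl fun J _ => hval J, ← Complex.ofReal_sum, eq_comm, Complex.ofReal_eq_zero] at key
  -- The labelling of all edges by one diagonal matrix unit makes each face word a power of an
  -- idempotent with positive trace.
  refine absurd key (ne_of_gt (Finset.sum_pos' (fun J _ => ?_)
    ⟨fun _ => ⟨i₀, 0, 0⟩, Finset.mem_univ _, ?_⟩))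
  · positivity
  · refine mul_pos (Finset.prod_pos fun e _ => ?_) (Finset.prod_pos fun f _ => ?_)
    · have : 0 < n i₀ := Nat.pos_of_neZero _
      positivity
    · rw [Nat.cast_pos]
      obtain ⟨m, hm, -⟩ := cycleList_apply_eq L.faceRot (ts f)
      have : ((L.faceOrder (ts f)).map fun d => natUnit (n := n)
          (if d.2 then UnitIndex.swap ⟨i₀, 0, 0⟩ else ⟨i₀, 0, 0⟩)) =
          List.replicate (m.length + 1) (natUnit ⟨i₀, 0, 0⟩) := by
        rw [List.eq_replicate_iff]
        refine ⟨by simp [faceOrder, hm], fun x hx => ?_⟩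
        obtain ⟨d, -, rfl⟩ := List.mem_map.1 hx
        split_ifs <;> rfl
      change 0 < natTrace _
      rw [this, List.prod_replicate]
      exact natTrace_pos i₀ _

end NonZero

/-! ### Sums of commuting idempotents -/

/-- If `Q a x = 0`, the idempotent `Q a` drops out. Otherwise `Q a x` is an eigenvector of the
remaining sum with eigenvalue `μ - 1`, so `μ` counts idempotents. -/
theorem exists_nat_of_sum_idempotent {ι V : Type*} [AddCommGroup V] [Module ℂ V]
    {Q : ι → Module.End ℂ V} (hQ : ∀ i, Q i * Q i = Q i) (hc : ∀ i j, Commute (Q i) (Q j))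
    (s : Finset ι) {μ : ℂ} {x : V} (hx : x ≠ 0) (h : (∑ i ∈ s, Q i) x = μ • x) :
    ∃ m : ℕ, μ = m := by
  classical
  induction s using Finset.induction_on generalizing μ x with
  | empty =>
    refine ⟨0, ?_⟩
    simpa [hx, eq_comm] using h
  | insert a s ha ih =>
    rw [Finset.sum_insert ha, LinearMap.add_apply] at h
    by_cases hy : Q a x = 0
    · exact ih hx (by rwa [hy, zero_add] at h)
    · have hcomm : Commute (Q a) (∑ i ∈ s, Q i) := Commute.sum_right _ _ _ fun i _ => hc a i
      have : (∑ i ∈ s, Q i) (Q a x) = (μ - 1) • Q a x := by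
        rw [← Module.End.mul_apply, ← hcomm.eq, Module.End.mul_apply, eq_sub_iff_add_eq'.2 h,
          map_sub, map_smul, ← Module.End.mul_apply, hQ, sub_smul, one_smul]
      obtain ⟨m, hm⟩ := ih hy this
      exact ⟨m + 1, by rw [Nat.cast_add, ← hm]; simp⟩

/-! ### The lowest eigenvalue of the Hamiltonian -/

section GroundState

variable {W : Type*} [Ring W] [Algebra ℂ W] [WeakHopfAlgebra W] [FiniteDimensional ℂ W]
variable {E : Type*} [DecidableEq E] [Fintype E]

theorem isGroundState_hamiltonian {h : W} (hh : IsCocommutativeHaar h) {φ : DualAlg W}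
    (hφ : IsHaarIntegral φ) (L : DirectedLattice E) (vs : L.Vertex → L.Site) (fs : L.Face → L.Site)
    {ψ : TotalSpace W E} (hψ : ψ ≠ 0) (hv : ∀ s, vertexOp L s h ψ = ψ) (hf : ∀ s, faceOp L s φ ψ = ψ) :
    IsGroundState (hamiltonian L h φ vs fs) ψ := by
  refine ⟨0, ⟨?_, hψ⟩, fun μ hμ => ?_⟩
  · rw [Module.End.mem_eigenspace_iff]
    simp [hamiltonian, hv, hf]
  · obtain ⟨x, hx, hx0⟩ := hμ.exists_hasEigenvector
    rw [Module.End.mem_eigenspace_iff] at hx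
    let C : L.Vertex ⊕ L.Face → Module.End ℂ (TotalSpace W E) :=
      Sum.elim (fun v => vertexOp L (vs v) h) fun f => faceOp L (fs f) φ
    have hC : hamiltonian L h φ vs fs = ∑ i, (1 - C i) := by
      rw [Fintype.sum_sum_type]; rfl
    have hCC : ∀ i, C i * C i = C i := by
      rintro (v | f)
      · exact vertexOp_mul_self hh hφ L _
      · exact faceOp_mul_self hh hφ L _
    have hCc : ∀ i j, Commute (C i) (C j) := by
      rintro (v | f) (v' | f')
      · exact commute_vertexOp hh hφ L _ _
      · exact (commute_faceOp_vertexOp hh hφ L _ _).symm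
      · exact commute_faceOp_vertexOp hh hφ L _ _
      · exact commute_faceOp hh hφ L _ _
    obtain ⟨m, hm⟩ := exists_nat_of_sum_idempotent (Q := fun i => 1 - C i)
      (fun i => (show IsIdempotentElem (C i) from hCC i).one_sub)
      (fun i j => ((Commute.one_left _).sub_left
        ((Commute.one_right _).sub_right (hCc i j))))
      Finset.univ hx0 (hC ▸ hx)
    exact ⟨m, by simp [hm], Nat.cast_nonneg m⟩

end GroundState

end WeakHopf

end

theorem mainTheorem7 {W : Type*} [Ring W] [StarRing W] [Algebra ℂ W] [StarModule ℂ W]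
    [Nontrivial W] [FiniteDimensional ℂ W]
    [WeakHopf.WeakHopfAlgebra W] [WeakHopf.IsCStarWeakHopfAlgebra W]
    (h : W) (hh : WeakHopf.IsHaarIntegral h) (hcoc : WeakHopf.IsCocommutativeElement h)
    (φ : WeakHopf.DualAlg W) (hφ : WeakHopf.IsHaarIntegral φ)
    {E : Type*} [Fintype E] [DecidableEq E] (L : WeakHopf.DirectedLattice E)
    (vs : L.Vertex → L.Site) (hvs : ∀ v, WeakHopf.DirectedLattice.Site.vertex (vs v) = v)
    (fs : L.Face → L.Site) (hfs : ∀ f, WeakHopf.DirectedLattice.Site.face (fs f) = f)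
    (ts : L.Face → L.Site) (hts : ∀ f, WeakHopf.DirectedLattice.Site.face (ts f) = f) :
    (∀ s : L.Site, WeakHopf.vertexOp L s h
        (WeakHopf.tensorNetworkState L ts (fun _ => h) (fun _ => φ)) =
      WeakHopf.tensorNetworkState L ts (fun _ => h) (fun _ => φ)) ∧
    (∀ s : L.Site, WeakHopf.faceOp L s φ
        (WeakHopf.tensorNetworkState L ts (fun _ => h) (fun _ => φ)) =
      WeakHopf.tensorNetworkState L ts (fun _ => h) (fun _ => φ)) ∧
    WeakHopf.IsGroundState (WeakHopf.hamiltonian L h φ vs fs)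
      (WeakHopf.tensorNetworkState L ts (fun _ => h) (fun _ => φ)) := by
  have hh' : WeakHopf.IsCocommutativeHaar h := ⟨hh, hcoc⟩
  have hv := WeakHopf.vertexOp_tensorNetworkState hh' hφ L ts hts
  have hf := WeakHopf.faceOp_tensorNetworkState hh' hφ L ts hts
  exact ⟨hv, hf, WeakHopf.isGroundState_hamiltonian hh' hφ L vs fs
    (WeakHopf.tensorNetworkState_ne_zero hh' hφ L hts) hv hf⟩
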